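/- All graphs are finite, simple and undirected. A connected dominating set of a graph $G=(V,E)$ is a set $S\subseteq V$ such that every vertex outside $S$ has a neighbour in $S$ and the induced subgraph $G[S]$ is connected (in particular $S\neq\emptyset$); it is minimal if no proper subset of it is a connected dominating set. The graph $G$ is connected-domishold if there are weights $w:V\to\mathbb{R}_{\ge 0}$ and a threshold $t\in\mathbb{R}_{\ge 0}$ such that, for every $S\subseteq V$, $\sum_{x\in S}w(x)\ge t$ if and only if $S$ is a connected dominating set of $G$. (Disconnected graphs have no connected dominating set and are connected-domishold.) It is chordal if it has no induced cycle of order at least $4$. Algorithms run on a random access machine with words of $O(\log n)$ bits (every stored word and every written address is bounded by a fixed polynomial in $n$), in which addition, truncated subtraction, multiplication and comparison of words, memory accesses, and copying, addition and comparison of real numbers each take one unit of time. A graph on vertices $0,\dots,n-1$ is given by its adjacency matrix. Sets are output as $0/1$ characteristic vectors. **Theorem.** 1. There is a constant $C$ such that every $n$-vertex connected-domishold chordal graph has at most $Cn^2$ minimal connected dominating sets. 2. There is an algorithm that, given any connected-domishold chordal graph with $n\ge 1$ vertices, outputs in time $O(n^3)$ the list of all its minimal connected dominating sets, each exactly once.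 3. There is an algorithm that, given any connected connected-domishold chordal graph $G$ with $n$ vertices and any cost function $c:V(G)\to\mathbb{R}_{\ge 0}$, outputs in time $O(n^3)$ a connected dominating set $S$ of $G$ minimizing $c(S)=\sum_{v\in S}c(v)$. The weights and the threshold witnessing that the graph is connected-domishold are not part of the input. -/

import Mathlib

open scoped NNReal

/-- `S` is a connected dominating set of `G`: every vertex outside `S` has a neighbour in `S`, and
the subgraph induced by `S` is connected (in particular `S` is nonempty). -/
def IsConnectedDominatingSet {V : Type*} (G : SimpleGraph V) (S : Finset V) : Prop :=
  (∀ v, v ∉ S → ∃ u ∈ S, G.Adj v u) ∧ (G.induce (S : Set V)).Connected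

/-- Inclusion-minimal connected dominating sets. -/
def IsMinimalCDS {V : Type*} (G : SimpleGraph V) (S : Finset V) : Prop :=
  Minimal (IsConnectedDominatingSet G) S

/-- `G` is connected-domishold: for some nonnegative real vertex weights `w` and some nonnegative
real threshold `t`, the connected dominating sets are exactly the sets of weight at least `t`. -/
def IsConnectedDomishold {V : Type*} (G : SimpleGraph V) : Prop :=
  ∃ (w : V → ℝ≥0) (t : ℝ≥0), ∀ S : Finset V,
    t ≤ ∑ x ∈ S, w x ↔ IsConnectedDominatingSet G S

/-- `G` is chordal: no induced cycle of order at least 4. -/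
def IsChordalGraph {V : Type*} (G : SimpleGraph V) : Prop :=
  ∀ k : ℕ, 4 ≤ k → IsEmpty (SimpleGraph.cycleGraph k ↪g G)

/-!
The machine model is a random access machine with a fixed finite program. Its memory consists of
registers and arrays of natural numbers (the words) and of registers and arrays of real numbers.
Words may be added, subtracted (with truncation), multiplied and compared; real numbers may only be
copied, added and compared. The words that a computation stores, and the addresses it writes to,
are at most a bound `B` given as a parameter; if `B` is polynomial in the size of the input, this
is the usual RAM with words of logarithmic length. A computation that would exceed `B` is stuck.
-/

namespace RAM

/-- Memory of the machine. -/
structure Memory where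
  /-- word registers -/
  reg : ℕ → ℕ
  /-- word arrays: `arr a i` is the cell with address `i` of array number `a` -/
  arr : ℕ → ℕ → ℕ
  /-- real registers -/
  rreg : ℕ → ℝ
  /-- real arrays -/
  rarr : ℕ → ℕ → ℝ

/-- Word expressions. -/
inductive Expr where
  | const (k : ℕ)
  | reg (i : ℕ)
  | arr (a : ℕ) (e : Expr)
  | add (e f : Expr)
  | sub (e f : Expr)
  | mul (e f : Expr)

/-- Value of a word expression. -/
def Expr.eval (s : Memory) : Expr → ℕ
  | .const k => k
  | .reg i => s.reg i
  | .arr a e => s.arr a (e.eval s)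
  | .add e f => e.eval s + f.eval s
  | .sub e f => e.eval s - f.eval s
  | .mul e f => e.eval s * f.eval s

/-- Time to evaluate a word expression: one unit for each operation or memory access in it. -/
def Expr.cost : Expr → ℕ
  | .const _ => 1
  | .reg _ => 1
  | .arr _ e => e.cost + 1
  | .add e f => e.cost + f.cost + 1
  | .sub e f => e.cost + f.cost + 1
  | .mul e f => e.cost + f.cost + 1

/-- Real expressions. -/
inductive RExpr where
  | zero
  | reg (i : ℕ)
  | arr (a : ℕ) (e : Expr)
  | add (x y : RExpr)

/-- Value of a real expression. -/
def RExpr.eval (s : Memory) : RExpr → ℝ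
  | .zero => 0
  | .reg i => s.rreg i
  | .arr a e => s.rarr a (e.eval s)
  | .add x y => x.eval s + y.eval s

/-- Time to evaluate a real expression. -/
def RExpr.cost : RExpr → ℕ
  | .zero => 1
  | .reg _ => 1
  | .arr _ e => e.cost + 1
  | .add x y => x.cost + y.cost + 1

/-- Tests. -/
inductive Test where
  | lt (e f : Expr)
  | eq (e f : Expr)
  | rlt (x y : RExpr)
  | neg (c : Test)
  | conj (c d : Test)
  | disj (c d : Test)

/-- Truth of a test. -/
def Test.holds (s : Memory) : Test → Prop
  | .lt e f => e.eval s < f.eval s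
  | .eq e f => e.eval s = f.eval s
  | .rlt x y => x.eval s < y.eval s
  | .neg c => ¬ c.holds s
  | .conj c d => c.holds s ∧ d.holds s
  | .disj c d => c.holds s ∨ d.holds s

/-- Time to evaluate a test. -/
def Test.cost : Test → ℕ
  | .lt e f => e.cost + f.cost + 1
  | .eq e f => e.cost + f.cost + 1
  | .rlt x y => x.cost + y.cost + 1
  | .neg c => c.cost + 1
  | .conj c d => c.cost + d.cost + 1
  | .disj c d => c.cost + d.cost + 1

/-- Programs. -/
inductive Program where
  | skip
  | setReg (i : ℕ) (e : Expr)
  | setArr (a : ℕ) (addr e : Expr)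
  | setRReg (i : ℕ) (x : RExpr)
  | setRArr (a : ℕ) (addr : Expr) (x : RExpr)
  | seq (p q : Program)
  | ite (c : Test) (p q : Program)
  | loop (c : Test) (p : Program)

/-- Write a word register. -/
def Memory.writeReg (s : Memory) (i v : ℕ) : Memory :=
  { s with reg := Function.update s.reg i v }

/-- Write a cell of a word array. -/
def Memory.writeArr (s : Memory) (a i v : ℕ) : Memory :=
  { s with arr := Function.update s.arr a (Function.update (s.arr a) i v) }

/-- Write a real register. -/
def Memory.writeRReg (s : Memory) (i : ℕ) (x : ℝ) : Memory :=
  { s with rreg := Function.update s.rreg i x }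

/-- Write a cell of a real array. -/
def Memory.writeRArr (s : Memory) (a i : ℕ) (x : ℝ) : Memory :=
  { s with rarr := Function.update s.rarr a (Function.update (s.rarr a) i x) }

/-- `Exec B p s s' t`: the program `p`, started with memory `s` on a machine with word bound `B`,
halts after exactly `t` time units with memory `s'`. Here `loop c p` is "while `c` do `p`". -/
inductive Exec (B : ℕ) : Program → Memory → Memory → ℕ → Prop
  | skip (s : Memory) : Exec B .skip s s 1
  | setReg (s : Memory) (i : ℕ) (e : Expr) (hv : e.eval s ≤ B) :
      Exec B (.setReg i e) s (s.writeReg i (e.eval s)) (e.cost + 1)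
  | setArr (s : Memory) (a : ℕ) (addr e : Expr) (ha : addr.eval s ≤ B) (hv : e.eval s ≤ B) :
      Exec B (.setArr a addr e) s (s.writeArr a (addr.eval s) (e.eval s))
        (addr.cost + e.cost + 1)
  | setRReg (s : Memory) (i : ℕ) (x : RExpr) :
      Exec B (.setRReg i x) s (s.writeRReg i (x.eval s)) (x.cost + 1)
  | setRArr (s : Memory) (a : ℕ) (addr : Expr) (x : RExpr) (ha : addr.eval s ≤ B) :
      Exec B (.setRArr a addr x) s (s.writeRArr a (addr.eval s) (x.eval s))
        (addr.cost + x.cost + 1)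
  | seq {p q : Program} {s s' s'' : Memory} {t t' : ℕ}
      (hp : Exec B p s s' t) (hq : Exec B q s' s'' t') :
      Exec B (.seq p q) s s'' (t + t')
  | ite_true {c : Test} {p q : Program} {s s' : Memory} {t : ℕ}
      (hc : c.holds s) (hp : Exec B p s s' t) :
      Exec B (.ite c p q) s s' (c.cost + 1 + t)
  | ite_false {c : Test} {p q : Program} {s s' : Memory} {t : ℕ}
      (hc : ¬ c.holds s) (hq : Exec B q s s' t) :
      Exec B (.ite c p q) s s' (c.cost + 1 + t)
  | loop_exit {c : Test} {p : Program} {s : Memory} (hc : ¬ c.holds s) :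
      Exec B (.loop c p) s s (c.cost + 1)
  | loop_step {c : Test} {p : Program} {s s' s'' : Memory} {t t' : ℕ}
      (hc : c.holds s) (hp : Exec B p s s' t) (hl : Exec B (.loop c p) s' s'' t') :
      Exec B (.loop c p) s s'' (c.cost + 1 + t + t')

open Classical in
/-- Initial memory for a graph `G` on the vertices `0, …, n - 1` with vertex costs `c`: word
register 0 holds `n`, word array 0 holds the adjacency matrix of `G` row by row, real array 0 holds
the costs, and everything else is 0. -/
noncomputable def input {n : ℕ} (G : SimpleGraph (Fin n)) (c : Fin n → ℝ≥0) : Memory where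
  reg i := if i = 0 then n else 0
  arr a j := if a = 0 ∧ ∃ u v : Fin n, G.Adj u v ∧ j = u * n + v then 1 else 0
  rreg _ := 0
  rarr a j := if h : a = 0 ∧ j < n then (c ⟨j, h.2⟩ : ℝ) else 0

/-- The `i`-th vertex set in the output: row `i` of the matrix with `n` columns stored row by row in
word array 1, read as a characteristic vector. -/
def outputSet (n : ℕ) (s : Memory) (i : ℕ) : Finset (Fin n) :=
  Finset.univ.filter fun v : Fin n => s.arr 1 (i * n + v) = 1

/-- The memory lists the family `F` of vertex sets without repetition: word register 1 holds the
number `m` of sets, and the first `m` output sets are the members of `F`, each occurring once. -/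
def Lists (n : ℕ) (s : Memory) (F : Set (Finset (Fin n))) : Prop :=
  Set.BijOn (outputSet n s) (Set.Iio (s.reg 1)) F

end RAM

/-- `S` is an optimal solution of the weighted connected dominating set problem on `(G, c)`. -/
def IsMinimumCostCDS {V : Type*} (G : SimpleGraph V) (c : V → ℝ≥0) (S : Finset V) : Prop :=
  IsConnectedDominatingSet G S ∧
    ∀ T : Finset V, IsConnectedDominatingSet G T → ∑ v ∈ S, c v ≤ ∑ v ∈ T, c v

/-!
Call a set of vertices a *blocker* if it meets every connected dominating set. The blockers are the
set of all vertices and the sets that contain a cutset (`IsBlocker.eq_univ_or_exists_separates`),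
and the minimal connected dominating sets are the minimal sets that meet every minimal blocker
(`isMinimalCDS_iff`). So the theorem is about dualizing a family of cutsets, and two facts make this
cheap.

*There are at most `n` minimal blockers.* A chordal graph can be dismantled by deleting simplicial
vertices one after the other (`IsChordalGraph.exists_simplicial`). When a simplicial vertex `v` is
deleted, the only minimal cutset that can get lost is the set of its remaining neighbours
(`minimal_separates_erase`). Hence the `n` sets `elimCut`, together with the set of all vertices,
which the last step contributes, contain all minimal blockers.

*Blockers are a threshold property.* The weights of a connected-domishold graph order the vertices
by strength: in a blocker, a vertex may be replaced by a stronger one. Let `j` be the weakest vertex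
of a minimal connected dominating set `D`. Some minimal blocker `E` meets `D` in `j` only, and the
exchange property forces `D` to consist of `j` and of the stronger vertices outside `E`
(`exists_eq_transversal`). So `D` is determined by `E` and `j`, which gives the bound `n ^ 2`.

For the algorithm, the pairs `(E, j)` that occur are those at which `E` *branches*: no minimal
blocker that agrees with `E` on the vertices stronger than `j` avoids `j`
(`minimal_transversal_of_branches`). Branching is read off from the strongest vertex in which two
minimal blockers differ, so all pairs are tested in time `O(n ^ 3)`. The weights are not known, but
a linear order compatible with strength is found by comparing, lexicographically, the numbers of
minimal blockers of size 1, 2, … that contain a vertex (Winder's theorem,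
`stronger_of_winderCount`). Simplicial vertices are found by maintaining, for each vertex, the
number of non-adjacent pairs of remaining neighbours (`deficiency_erase`).

Except for the output, the program consists of tables with `n` rows and columns each of whose
entries is computed by one loop of length `n` (`RAM.runs_row`, `RAM.runs_table`). Truth values are
computed by truncated arithmetic, so the value of an entry is a formula, which
`Enumeration.Correct.bijOn` interprets. For nonnegative costs some minimal connected dominating set
is optimal, so the third part evaluates the list of the second.
-/

/-! ### Chordal graphs and simplicial vertices -/

section Chordal

variable {V : Type*} {G : SimpleGraph V}

/-- In a chordal graph, two neighbours of `x` that are joined by a walk avoiding the closed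
neighbourhood of `x` in between are adjacent: a shortest such walk would close up with `x` to an
induced cycle. -/
theorem IsChordalGraph.adj_of_walk (hG : IsChordalGraph G) {x a b : V} (hxa : G.Adj x a)
    (hxb : G.Adj x b) (hab : a ≠ b) (w₀ : G.Walk a b)
    (hw₀ : ∀ u ∈ w₀.support, u = a ∨ u = b ∨ (u ≠ x ∧ ¬ G.Adj x u)) : G.Adj a b := by
  classical
  by_contra hnadj
  have hex : ∃ l : ℕ, ∃ w : G.Walk a b, w.length = l ∧
      ∀ u ∈ w.support, u = a ∨ u = b ∨ (u ≠ x ∧ ¬ G.Adj x u) := ⟨_, w₀, rfl, hw₀⟩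
  obtain ⟨w, hwl, hws⟩ := Nat.find_spec hex
  have hmin : ∀ w' : G.Walk a b, (∀ u ∈ w'.support, u ∈ w.support) → w.length ≤ w'.length := by
    intro w' h'
    rw [hwl]
    exact Nat.find_min' hex ⟨w', rfl, fun u hu => hws u (h' u hu)⟩
  set l := w.length with hl
  have htake : ∀ i, ∀ u ∈ (w.take i).support, u ∈ w.support := by
    intro i u hu
    rw [SimpleGraph.Walk.mem_support_iff_exists_getVert] at hu
    obtain ⟨m, rfl, -⟩ := hu
    rw [SimpleGraph.Walk.take_getVert]
    exact w.getVert_mem_support _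
  have hdrop : ∀ i, ∀ u ∈ (w.drop i).support, u ∈ w.support := by
    intro i u hu
    rw [SimpleGraph.Walk.mem_support_iff_exists_getVert] at hu
    obtain ⟨m, rfl, -⟩ := hu
    rw [SimpleGraph.Walk.drop_getVert]
    exact w.getVert_mem_support _
  have hne : ∀ i j, i < j → j ≤ l → w.getVert i ≠ w.getVert j := by
    intro i j hij hj h
    have := hmin ((w.take i).append ((w.drop j).copy h.symm rfl)) (by
      intro u hu
      rw [SimpleGraph.Walk.mem_support_append_iff, SimpleGraph.Walk.support_copy] at hu
      exact hu.elim (htake i u) (hdrop j u))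
    rw [SimpleGraph.Walk.length_append, SimpleGraph.Walk.length_copy,
      SimpleGraph.Walk.take_length, SimpleGraph.Walk.drop_length] at this
    omega
  have hadj : ∀ i j, i < j → j ≤ l → G.Adj (w.getVert i) (w.getVert j) → j = i + 1 := by
    intro i j hij hj h
    have := hmin ((w.take i).append (.cons h (w.drop j))) (by
      intro u hu
      rw [SimpleGraph.Walk.mem_support_append_iff, SimpleGraph.Walk.support_cons,
        List.mem_cons] at hu
      rcases hu with hu | rfl | hu
      · exact htake i u hu
      · exact w.getVert_mem_support _
      · exact hdrop j u hu)
    rw [SimpleGraph.Walk.length_append, SimpleGraph.Walk.length_cons,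
      SimpleGraph.Walk.take_length, SimpleGraph.Walk.drop_length] at this
    omega
  have h0 : w.getVert 0 = a := w.getVert_zero
  have hL : w.getVert l = b := w.getVert_length
  have hl0 : l ≠ 0 := fun h => hab (h0.symm.trans ((congrArg w.getVert h.symm).trans hL))
  have hl1 : l ≠ 1 := by
    intro h
    have := w.adj_getVert_succ (i := 0) (by omega)
    rw [zero_add, ← h, h0, hL] at this
    exact hnadj this
  have hxend : ∀ i, i ≤ l → (G.Adj x (w.getVert i) ↔ i = 0 ∨ i = l) := by
    intro i hi
    constructor
    · intro h
      by_contra hcon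
      push Not at hcon
      rcases hws _ (w.getVert_mem_support i) with h1 | h1 | h1
      · exact hne 0 i (by omega) hi (h0.trans h1.symm)
      · exact hne i l (by omega) le_rfl (h1.trans hL.symm)
      · exact h1.2 h
    · rintro (rfl | rfl)
      · rwa [h0]
      · rwa [hL]
  have hxne : ∀ i, i ≤ l → w.getVert i ≠ x := by
    intro i hi h
    rcases hws _ (w.getVert_mem_support i) with h1 | h1 | h1
    · exact hxa.ne (h.symm.trans h1)
    · exact hxb.ne (h.symm.trans h1)
    · exact h1.1 h
  -- the shortest walk followed by `x` is an induced cycle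
  let φ : Fin (l + 2) → V := fun i => if (i : ℕ) ≤ l then w.getVert i else x
  have hφ : ∀ i : Fin (l + 2), (i : ℕ) ≤ l → φ i = w.getVert i := fun i hi => if_pos hi
  have hφx : ∀ i : Fin (l + 2), ¬ (i : ℕ) ≤ l → φ i = x := fun i hi => if_neg hi
  have hsub : ∀ i j : Fin (l + 2), i < j →
      (((i - j : Fin (l + 2)) : ℕ) = 1 ∨ ((j - i : Fin (l + 2)) : ℕ) = 1 ↔
        (j : ℕ) = i + 1 ∨ (i : ℕ) = 0 ∧ (j : ℕ) = l + 1) := by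
    intro i j hij
    have h1 := Fin.coe_sub_iff_le.2 hij.le
    have h2 := Fin.coe_sub_iff_lt.2 hij
    have h3 : (i : ℕ) < j := hij
    have := i.2
    have := j.2
    omega
  have hkey : ∀ i j : Fin (l + 2), i < j →
      φ i ≠ φ j ∧ (G.Adj (φ i) (φ j) ↔ (SimpleGraph.cycleGraph (l + 2)).Adj i j) := by
    intro i j hij
    rw [SimpleGraph.cycleGraph_adj', hsub i j hij]
    have h3 : (i : ℕ) < j := hij
    have hi2 := i.2
    have hj2 := j.2
    rw [hφ i (by omega)]
    by_cases hj : (j : ℕ) ≤ l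
    · rw [hφ j hj]
      refine ⟨hne _ _ h3 hj, fun h => Or.inl (hadj _ _ h3 hj h), ?_⟩
      rintro (h | h)
      · rw [h]
        exact w.adj_getVert_succ (by omega)
      · omega
    · rw [hφx j hj]
      refine ⟨hxne _ (by omega), ?_⟩
      rw [G.adj_comm, hxend _ (by omega)]
      omega
  have hinj : Function.Injective φ := by
    intro i j h
    rcases lt_trichotomy i j with h1 | h1 | h1
    · exact absurd h (hkey i j h1).1
    · exact h1
    · exact absurd h.symm (hkey j i h1).1
  refine (hG (l + 2) (by omega)).false ⟨⟨φ, hinj⟩, ?_⟩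
  intro i j
  change G.Adj (φ i) (φ j) ↔ _
  rcases lt_trichotomy i j with h1 | h1 | h1
  · exact (hkey i j h1).2
  · subst h1
    simp
  · rw [G.adj_comm, (hkey j i h1).2, SimpleGraph.adj_comm]

/-- `v` is a simplicial vertex of the subgraph of `G` induced by `R`: its neighbours in `R` form a
clique. -/
def IsSimplicialIn (G : SimpleGraph V) (R : Finset V) (v : V) : Prop :=
  v ∈ R ∧ ∀ a ∈ R, ∀ b ∈ R, G.Adj v a → G.Adj v b → a ≠ b → G.Adj a b

/-- Dirac's theorem in the form that carries the induction: a vertex that has a non-neighbour has a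
simplicial non-neighbour. The simplicial vertex is found in a component `K` of the subgraph on the
non-neighbours of `x`, whose attachment `T` is a clique by `IsChordalGraph.adj_of_walk`. -/
theorem IsChordalGraph.exists_simplicial_nonadj [DecidableEq V] (hG : IsChordalGraph G) :
    ∀ (m : ℕ) (R : Finset V), R.card = m → ∀ x ∈ R, (∃ z ∈ R, z ≠ x ∧ ¬ G.Adj x z) →
      ∃ y, IsSimplicialIn G R y ∧ y ≠ x ∧ ¬ G.Adj x y := by
  classical
  intro m
  induction m using Nat.strong_induction_on with
  | _ m ih =>
  rintro R hR x hx ⟨z, hz, hzx, hxz⟩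
  let W : V → Prop := fun u => u ∈ R ∧ u ≠ x ∧ ¬ G.Adj x u
  let K : Finset V := R.filter fun c => ∃ w : G.Walk z c, ∀ u ∈ w.support, W u
  have hzW : W z := ⟨hz, hzx, hxz⟩
  have hKW : ∀ c ∈ K, W c := by
    intro c hc
    obtain ⟨-, w, hw⟩ := Finset.mem_filter.1 hc
    exact hw c w.end_mem_support
  have hzK : z ∈ K := Finset.mem_filter.2 ⟨hz, .nil, by simpa using hzW⟩
  have hKstep : ∀ c ∈ K, ∀ d, W d → G.Adj c d → d ∈ K := by
    intro c hc d hd hcd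
    obtain ⟨-, w, hw⟩ := Finset.mem_filter.1 hc
    refine Finset.mem_filter.2 ⟨hd.1, w.concat hcd, ?_⟩
    intro u hu
    rw [SimpleGraph.Walk.support_concat, List.mem_append,
      List.mem_singleton] at hu
    rcases hu with hu | rfl
    · exact hw u hu
    · exact hd
  let T : Finset V := R.filter fun t => t ∉ K ∧ ∃ c ∈ K, G.Adj c t
  have hTx : ∀ t ∈ T, t ≠ x → G.Adj x t := by
    intro t ht htx
    obtain ⟨htR, htK, c, hc, hct⟩ := Finset.mem_filter.1 ht
    by_contra hcon
    exact htK (hKstep c hc t ⟨htR, htx, hcon⟩ hct)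
  have hxT : x ∉ T := by
    intro h
    obtain ⟨-, -, c, hc, hcx⟩ := Finset.mem_filter.1 h
    exact (hKW c hc).2.2 hcx.symm
  have hTx' : ∀ t ∈ T, G.Adj x t := fun t ht => hTx t ht (fun h => hxT (h ▸ ht))
  have hTclique : ∀ s ∈ T, ∀ t ∈ T, s ≠ t → G.Adj s t := by
    intro s hs t ht hst
    obtain ⟨-, -, c, hc, hcs⟩ := Finset.mem_filter.1 hs
    obtain ⟨-, -, d, hd, hdt⟩ := Finset.mem_filter.1 ht
    obtain ⟨-, w, hw⟩ := Finset.mem_filter.1 hc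
    obtain ⟨-, w', hw'⟩ := Finset.mem_filter.1 hd
    refine hG.adj_of_walk (hTx' s hs) (hTx' t ht) hst
      (.cons hcs.symm ((w.reverse.append w').concat hdt)) ?_
    intro u hu
    rw [SimpleGraph.Walk.support_cons, List.mem_cons, SimpleGraph.Walk.support_concat,
      List.mem_append, List.mem_singleton,
      SimpleGraph.Walk.mem_support_append_iff, SimpleGraph.Walk.support_reverse,
      List.mem_reverse] at hu
    rcases hu with rfl | (hu | hu) | rfl
    · exact Or.inl rfl
    · exact Or.inr (Or.inr (hw u hu).2)
    · exact Or.inr (Or.inr (hw' u hu).2)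
    · exact Or.inr (Or.inl rfl)
  let R' := K ∪ T
  have hR'R : R' ⊆ R := by
    intro u hu
    rcases Finset.mem_union.1 hu with h | h <;> exact (Finset.mem_filter.1 h).1
  have hxR' : x ∉ R' := by
    intro h
    rcases Finset.mem_union.1 h with h | h
    · exact (hKW x h).2.1 rfl
    · exact hxT h
  have hcard : R'.card < m := by
    rw [← hR]
    exact Finset.card_lt_card ⟨hR'R, fun h => hxR' (h hx)⟩
  -- a vertex of `K` has all its neighbours in `R'`
  have hlift : ∀ y ∈ K, (∀ a ∈ R', ∀ b ∈ R', G.Adj y a → G.Adj y b → a ≠ b → G.Adj a b) →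
      ∃ y, IsSimplicialIn G R y ∧ y ≠ x ∧ ¬ G.Adj x y := by
    intro y hy h
    have hnb : ∀ a ∈ R, G.Adj y a → a ∈ R' := by
      intro a ha hya
      by_cases haK : a ∈ K
      · exact Finset.mem_union_left _ haK
      · exact Finset.mem_union_right _ (Finset.mem_filter.2 ⟨ha, haK, y, hy, hya⟩)
    exact ⟨y, ⟨(hKW y hy).1, fun a ha b hb hya hyb hab =>
      h a (hnb a ha hya) b (hnb b hb hyb) hya hyb hab⟩, (hKW y hy).2⟩
  by_cases hT : ∃ t ∈ T, ∃ u ∈ R', u ≠ t ∧ ¬ G.Adj t u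
  · obtain ⟨t, ht, hu⟩ := hT
    obtain ⟨y, ⟨hyR, hy⟩, hyt, hty⟩ := ih _ hcard R' rfl t (Finset.mem_union_right _ ht) hu
    rcases Finset.mem_union.1 hyR with hyK | hyT
    · exact hlift y hyK hy
    · exact absurd (hTclique t ht y hyT hyt.symm) hty
  · push Not at hT
    by_cases hK : ∃ c ∈ K, ∃ u ∈ R', u ≠ c ∧ ¬ G.Adj c u
    · obtain ⟨c, hc, hu⟩ := hK
      obtain ⟨y, ⟨hyR, hy⟩, hyc, hcy⟩ := ih _ hcard R' rfl c (Finset.mem_union_left _ hc) hu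
      rcases Finset.mem_union.1 hyR with hyK | hyT
      · exact hlift y hyK hy
      · exact absurd (hT y hyT c (Finset.mem_union_left _ hc) hyc.symm).symm hcy
    · push Not at hK
      refine hlift z hzK ?_
      intro a ha b hb _ _ hab
      rcases Finset.mem_union.1 ha with h | h
      · exact hK a h b hb hab.symm
      · exact hT a h b hb hab.symm

/-- Every nonempty induced subgraph of a chordal graph has a simplicial vertex. -/
theorem IsChordalGraph.exists_simplicial (hG : IsChordalGraph G) {R : Finset V}
    (hR : R.Nonempty) : ∃ v, IsSimplicialIn G R v := by
  classical
  obtain ⟨x, hx⟩ := hR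
  by_cases h : ∃ x ∈ R, ∃ z ∈ R, z ≠ x ∧ ¬ G.Adj x z
  · obtain ⟨x, hx, hz⟩ := h
    obtain ⟨y, hy, -⟩ := hG.exists_simplicial_nonadj _ R rfl x hx hz
    exact ⟨y, hy⟩
  · push Not at h
    exact ⟨x, hx, fun a ha b hb _ _ hab => h a ha b hb hab.symm⟩

/-! ### Cutsets of chordal graphs -/

/-- The neighbours of `v` in `R`. -/
noncomputable def neighborsIn (G : SimpleGraph V) (R : Finset V) (v : V) : Finset V := by
  classical exact R.filter fun u => G.Adj v u

theorem mem_neighborsIn {R : Finset V} {u v : V} :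
    u ∈ neighborsIn G R v ↔ u ∈ R ∧ G.Adj v u := by
  classical
  simp [neighborsIn]

variable [DecidableEq V]

/-- `S ⊆ R` separates the subgraph induced by `R`: the rest of `R` splits into two nonempty parts
without edges between them. -/
def Separates (G : SimpleGraph V) (R S : Finset V) : Prop :=
  S ⊆ R ∧ ∃ A B : Finset V, A.Nonempty ∧ B.Nonempty ∧ Disjoint A B ∧ A ∪ B = R \ S ∧
    ∀ a ∈ A, ∀ b ∈ B, ¬ G.Adj a b

theorem Separates.of_erase {R S : Finset V} {v : V} (hv : IsSimplicialIn G R v)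
    (h : Separates G (R.erase v) S) : Separates G R S := by
  obtain ⟨hS, A, B, hA, hB, hAB, hun, hno⟩ := h
  have hAR : ∀ a ∈ A, a ∈ R ∧ a ≠ v ∧ a ∉ S := by
    intro a ha
    have := Finset.mem_sdiff.1 (hun ▸ Finset.mem_union_left B ha)
    exact ⟨Finset.mem_of_mem_erase this.1, Finset.ne_of_mem_erase this.1, this.2⟩
  have hBR : ∀ a ∈ B, a ∈ R ∧ a ≠ v ∧ a ∉ S := by
    intro a ha
    have := Finset.mem_sdiff.1 (hun ▸ Finset.mem_union_right A ha)
    exact ⟨Finset.mem_of_mem_erase this.1, Finset.ne_of_mem_erase this.1, this.2⟩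
  have hvS : v ∉ S := fun h => Finset.ne_of_mem_erase (hS h) rfl
  have hmem : ∀ u, u ∈ A ∨ u ∈ B ↔ (u ≠ v ∧ u ∈ R) ∧ u ∉ S := by
    intro u
    rw [← Finset.mem_union, hun, Finset.mem_sdiff, Finset.mem_erase]
  refine ⟨hS.trans (Finset.erase_subset _ _), ?_⟩
  by_cases hva : ∃ a ∈ A, G.Adj v a
  · obtain ⟨a, ha, hva⟩ := hva
    refine ⟨insert v A, B, ⟨v, Finset.mem_insert_self _ _⟩, hB, ?_, ?_, ?_⟩
    · rw [Finset.disjoint_insert_left]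
      exact ⟨fun h => (hBR v h).2.1 rfl, hAB⟩
    · ext u
      have := hmem u
      have := hv.1
      by_cases huv : u = v
      · subst huv; simp [hvS, hv.1]
      · simp only [Finset.mem_union, Finset.mem_insert, Finset.mem_sdiff, huv, false_or]
        tauto
    · intro c hc b hb hcb
      rcases Finset.mem_insert.1 hc with rfl | hc
      · exact hno a ha b hb (hv.2 a (hAR a ha).1 b (hBR b hb).1 hva hcb
          (fun h => Finset.disjoint_left.1 hAB ha (h ▸ hb)))
      · exact hno c hc b hb hcb
  · push Not at hva
    refine ⟨A, insert v B, hA, ⟨v, Finset.mem_insert_self _ _⟩, ?_, ?_, ?_⟩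
    · rw [Finset.disjoint_insert_right]
      exact ⟨fun h => (hAR v h).2.1 rfl, hAB⟩
    · ext u
      have := hmem u
      by_cases huv : u = v
      · subst huv; simp [hvS, hv.1]
      · simp only [Finset.mem_union, Finset.mem_insert, Finset.mem_sdiff, huv, false_or]
        tauto
    · intro c hc b hb hcb
      rcases Finset.mem_insert.1 hb with rfl | hb
      · exact hva c hc hcb.symm
      · exact hno c hc b hb hcb

theorem separates_neighborsIn {R : Finset V} {v : V} (hv : v ∈ R)
    (h : ∃ u ∈ R, u ≠ v ∧ ¬ G.Adj v u) : Separates G R (neighborsIn G R v) := by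
  obtain ⟨u, hu, huv, hvu⟩ := h
  refine ⟨fun a ha => (mem_neighborsIn.1 ha).1, {v}, (R \ neighborsIn G R v).erase v,
    Finset.singleton_nonempty v, ⟨u, ?_⟩, ?_, ?_, ?_⟩
  · simp [mem_neighborsIn, hu, huv, hvu]
  · simp
  · ext a
    by_cases hav : a = v
    · subst hav; simp [mem_neighborsIn, hv]
    · simp [mem_neighborsIn, hav]
  · intro a ha b hb hab
    rw [Finset.mem_singleton] at ha
    subst ha
    simp only [Finset.mem_erase, Finset.mem_sdiff, mem_neighborsIn, not_and] at hb
    exact hb.2.2 hb.2.1 hab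

/-- Deleting a simplicial vertex `v` loses at most one minimal cutset, the neighbourhood of `v`:
each vertex of a minimal cutset has neighbours on both sides, so `v` lies on one of the sides. -/
theorem minimal_separates_erase {R S : Finset V} {v : V} (hv : IsSimplicialIn G R v)
    (h : Minimal (Separates G R) S) :
    (S = neighborsIn G R v ∧ ∃ u ∈ R, u ≠ v ∧ ¬ G.Adj v u) ∨
      Minimal (Separates G (R.erase v)) S := by
  obtain ⟨⟨hS, A, B, hA, hB, hAB, hun, hno⟩, hmin⟩ := h
  -- each vertex of `S` has a neighbour on each side
  have hfull : ∀ A B : Finset V, A.Nonempty → B.Nonempty → Disjoint A B → A ∪ B = R \ S →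
      (∀ a ∈ A, ∀ b ∈ B, ¬ G.Adj a b) → ∀ s ∈ S, ∃ a ∈ A, G.Adj s a := by
    intro A B hA hB hAB hun hno s hs
    by_contra hcon
    push Not at hcon
    have hsAB : s ∉ A ∪ B := by rw [hun]; simp [hs]
    have hsep : Separates G R (S.erase s) := by
      refine ⟨(Finset.erase_subset _ _).trans hS, A, insert s B, hA,
        ⟨s, Finset.mem_insert_self _ _⟩, ?_, ?_, ?_⟩
      · rw [Finset.disjoint_insert_right]
        exact ⟨fun h => hsAB (Finset.mem_union_left _ h), hAB⟩
      · rw [Finset.union_insert, hun]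
        ext u
        by_cases hus : u = s
        · subst hus; simp [hS hs]
        · simp [hus]
      · intro a ha b hb hab
        rcases Finset.mem_insert.1 hb with rfl | hb
        · exact hcon a ha hab.symm
        · exact hno a ha b hb hab
    exact Finset.notMem_erase s S (hmin hsep (Finset.erase_subset _ _) hs)
  have hmem : ∀ u, u ∈ A ∨ u ∈ B ↔ u ∈ R ∧ u ∉ S := by
    intro u
    rw [← Finset.mem_union, hun, Finset.mem_sdiff]
  have hno' : ∀ b ∈ B, ∀ a ∈ A, ¬ G.Adj b a := fun b hb a ha h => hno a ha b hb h.symm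
  have hun' : B ∪ A = R \ S := by rw [Finset.union_comm, hun]
  have hvS : v ∉ S := by
    intro hvS
    obtain ⟨a, ha, hva⟩ := hfull A B hA hB hAB hun hno v hvS
    obtain ⟨b, hb, hvb⟩ := hfull B A hB hA hAB.symm hun' hno' v hvS
    exact hno a ha b hb (hv.2 a ((hmem a).1 (Or.inl ha)).1 b ((hmem b).1 (Or.inr hb)).1 hva hvb
      (fun h => Finset.disjoint_left.1 hAB ha (h ▸ hb)))
  have key : ∀ A B : Finset V, A.Nonempty → B.Nonempty → Disjoint A B → A ∪ B = R \ S →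
      (∀ a ∈ A, ∀ b ∈ B, ¬ G.Adj a b) → v ∈ A →
      (S = neighborsIn G R v ∧ ∃ u ∈ R, u ≠ v ∧ ¬ G.Adj v u) ∨
      Minimal (Separates G (R.erase v)) S := by
    intro A B hA hB hAB hun hno hvA
    have hmem : ∀ u, u ∈ A ∨ u ∈ B ↔ u ∈ R ∧ u ∉ S := by
      intro u
      rw [← Finset.mem_union, hun, Finset.mem_sdiff]
    by_cases hAv : A = {v}
    · left
      obtain ⟨b, hb⟩ := hB
      refine ⟨?_, b, ((hmem b).1 (Or.inr hb)).1,
        fun h => Finset.disjoint_left.1 hAB hvA (h ▸ hb), hno v hvA b hb⟩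
      ext s
      rw [mem_neighborsIn]
      constructor
      · intro hs
        obtain ⟨a, ha, hsa⟩ := hfull A B hA ⟨b, hb⟩ hAB hun hno s hs
        rw [hAv, Finset.mem_singleton] at ha
        subst ha
        exact ⟨hS hs, hsa.symm⟩
      · rintro ⟨hsR, hvs⟩
        by_contra hsS
        rcases (hmem s).2 ⟨hsR, hsS⟩ with h | h
        · rw [hAv, Finset.mem_singleton] at h
          exact hvs.ne h.symm
        · exact hno v hvA s h hvs
    · right
      refine ⟨⟨fun s hs => Finset.mem_erase.2 ⟨fun h => hvS (h ▸ hs), hS hs⟩, A.erase v, B,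
        ?_, hB, hAB.mono_left (Finset.erase_subset _ _), ?_, ?_⟩, ?_⟩
      · by_contra hne
        rw [Finset.not_nonempty_iff_eq_empty] at hne
        refine hAv (Finset.Subset.antisymm (fun a ha => ?_) (by simpa using hvA))
        by_contra hav
        have : a ∈ A.erase v := Finset.mem_erase.2 ⟨by simpa using hav, ha⟩
        rw [hne] at this
        simp at this
      · ext u
        have := hmem u
        by_cases huv : u = v
        · subst huv
          have := Finset.disjoint_left.1 hAB hvA
          simp [this]
        · simp only [Finset.mem_union, Finset.mem_erase, Finset.mem_sdiff]
          tauto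
      · exact fun a ha b hb => hno a (Finset.mem_of_mem_erase ha) b hb
      · exact fun S' hS' hle => hmin (hS'.of_erase hv) hle
  rcases (hmem v).2 ⟨hv.1, hvS⟩ with h | h
  · exact key A B hA hB hAB hun hno h
  · exact key B A hB hA hAB.symm hun' hno' h

/-- The vertices that remain after `i` steps of deleting, again and again, the vertex that the rule
`pick` selects among the remaining ones. -/
def elimSet [Fintype V] (pick : Finset V → V) : ℕ → Finset V
  | 0 => Finset.univ
  | i + 1 => (elimSet pick i).erase (pick (elimSet pick i))

open Classical in
/-- The candidate cutset of step `i` of the elimination: the remaining neighbours of the vertex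
deleted in that step, or the set of all vertices if these neighbours are all the other remaining
vertices. -/
noncomputable def elimCut [Fintype V] (G : SimpleGraph V) (pick : Finset V → V) (i : ℕ) :
    Finset V :=
  if ∃ u ∈ elimSet pick i, u ≠ pick (elimSet pick i) ∧ ¬ G.Adj (pick (elimSet pick i)) u then
    neighborsIn G (elimSet pick i) (pick (elimSet pick i))
  else Finset.univ

theorem card_elimSet [Fintype V] {pick : Finset V → V}
    (hpick : ∀ R : Finset V, R.Nonempty → IsSimplicialIn G R (pick R)) :
    ∀ i ≤ Fintype.card V, (elimSet pick i).card = Fintype.card V - i := by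
  intro i
  induction i with
  | zero => intro _; simp [elimSet]
  | succ i ih =>
    intro hi
    have h := ih (by omega)
    have hne : (elimSet pick i).Nonempty := by
      rw [← Finset.card_pos]; omega
    rw [elimSet, Finset.card_erase_of_mem (hpick _ hne).1]
    omega

theorem elimSet_nonempty [Fintype V] {pick : Finset V → V}
    (hpick : ∀ R : Finset V, R.Nonempty → IsSimplicialIn G R (pick R)) {i : ℕ}
    (hi : i < Fintype.card V) : (elimSet pick i).Nonempty := by
  rw [← Finset.card_pos, card_elimSet hpick i hi.le]
  omega

theorem separates_of_separates_elimSet [Fintype V] {pick : Finset V → V}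
    (hpick : ∀ R : Finset V, R.Nonempty → IsSimplicialIn G R (pick R)) {S : Finset V} :
    ∀ i ≤ Fintype.card V, Separates G (elimSet pick i) S → Separates G Finset.univ S := by
  intro i
  induction i with
  | zero => exact fun _ h => h
  | succ i ih =>
    intro hi h
    exact ih (by omega) (h.of_erase (hpick _ (elimSet_nonempty hpick (by omega))))

theorem elimCut_eq_univ_or_separates [Fintype V] {pick : Finset V → V}
    (hpick : ∀ R : Finset V, R.Nonempty → IsSimplicialIn G R (pick R)) {i : ℕ}
    (hi : i < Fintype.card V) :
    elimCut G pick i = Finset.univ ∨ Separates G Finset.univ (elimCut G pick i) := by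
  unfold elimCut
  split_ifs with h
  · exact Or.inr (separates_of_separates_elimSet hpick i hi.le
      (separates_neighborsIn (hpick _ (elimSet_nonempty hpick hi)).1 h))
  · exact Or.inl rfl

/-- Every minimal cutset of a chordal graph is a candidate of the elimination. -/
theorem exists_elimCut_eq_of_minimal [Fintype V] {pick : Finset V → V}
    (hpick : ∀ R : Finset V, R.Nonempty → IsSimplicialIn G R (pick R)) {S : Finset V}
    (hS : Minimal (Separates G Finset.univ) S) : ∃ i < Fintype.card V, elimCut G pick i = S := by
  by_contra hcon
  push Not at hcon
  have hall : ∀ i ≤ Fintype.card V, Minimal (Separates G (elimSet pick i)) S := by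
    intro i
    induction i with
    | zero => exact fun _ => hS
    | succ i ih =>
      intro hi
      rcases minimal_separates_erase (hpick _ (elimSet_nonempty hpick (by omega)))
        (ih (by omega)) with h | h
      · refine absurd ?_ (hcon i (by omega))
        rw [elimCut, if_pos h.2, h.1]
      · exact h
  obtain ⟨⟨-, A, B, ⟨a, ha⟩, -, -, hun, -⟩, -⟩ := hall _ le_rfl
  have : a ∈ elimSet pick (Fintype.card V) \ S := hun ▸ Finset.mem_union_left _ ha
  have hcard := card_elimSet hpick _ le_rfl
  rw [Nat.sub_self, Finset.card_eq_zero] at hcard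
  rw [hcard] at this
  simp at this

/-- The last step of the elimination contributes the set of all vertices. -/
theorem exists_elimCut_eq_univ [Fintype V] {pick : Finset V → V}
    (hpick : ∀ R : Finset V, R.Nonempty → IsSimplicialIn G R (pick R))
    (hV : 0 < Fintype.card V) : ∃ i < Fintype.card V, elimCut G pick i = Finset.univ := by
  refine ⟨Fintype.card V - 1, by omega, ?_⟩
  rw [elimCut, if_neg]
  rintro ⟨u, hu, hne, -⟩
  have hcard := card_elimSet hpick (Fintype.card V - 1) (by omega)
  have h1 : (elimSet pick (Fintype.card V - 1)).card ≤ 1 := by omega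
  exact hne (Finset.card_le_one.1 h1 u hu _
    (hpick _ (elimSet_nonempty hpick (by omega))).1)

/-! ### Blockers of connected dominating sets -/

/-- `B` meets every connected dominating set. Since supersets of connected dominating sets are
connected dominating sets, this means that the complement of `B` is not one of them. -/
def IsBlocker [Fintype V] (G : SimpleGraph V) (B : Finset V) : Prop :=
  ¬ IsConnectedDominatingSet G Bᶜ

theorem Separates.isBlocker [Fintype V] {S : Finset V} (h : Separates G Finset.univ S) :
    IsBlocker G S := by
  rintro ⟨-, hconn⟩
  obtain ⟨-, A, B, ⟨a, ha⟩, ⟨b, hb⟩, hAB, hun, hno⟩ := h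
  have hmem : ∀ u, u ∈ A ∨ u ∈ B ↔ u ∉ S := by
    intro u
    rw [← Finset.mem_union, hun]
    simp
  have haS : a ∈ ((Sᶜ : Finset V) : Set V) := by simpa using (hmem a).1 (Or.inl ha)
  have hbS : b ∈ ((Sᶜ : Finset V) : Set V) := by simpa using (hmem b).1 (Or.inr hb)
  obtain ⟨w⟩ := hconn.preconnected ⟨a, haS⟩ ⟨b, hbS⟩
  have hstay : ∀ (x y : ((Sᶜ : Finset V) : Set V))
      (_ : (G.induce ((Sᶜ : Finset V) : Set V)).Walk x y), x.1 ∈ A → y.1 ∈ A := by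
    intro x y w
    induction w with
    | nil => exact id
    | @cons x y z h w ih =>
      intro hx
      apply ih
      have hy : y.1 ∉ S := by simpa using y.2
      rcases (hmem y.1).2 hy with h' | h'
      · exact h'
      · exact absurd h (hno x.1 hx y.1 h')
  exact Finset.disjoint_left.1 hAB (hstay _ _ w ha) hb

theorem isBlocker_univ [Fintype V] : IsBlocker G (Finset.univ : Finset V) := by
  rintro ⟨-, hconn⟩
  obtain ⟨⟨x, hx⟩⟩ := hconn.nonempty
  simp at hx

/-- A set that meets every connected dominating set consists of all vertices or contains a
cutset. -/
theorem IsBlocker.eq_univ_or_exists_separates [Fintype V] {B : Finset V} (h : IsBlocker G B) :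
    B = Finset.univ ∨ ∃ S ⊆ B, Separates G Finset.univ S := by
  classical
  rw [or_iff_not_imp_left]
  intro hB
  have hne : (Bᶜ).Nonempty := by
    rwa [Finset.nonempty_iff_ne_empty, Ne, Finset.compl_eq_empty_iff]
  by_cases hdom : ∀ v, v ∉ Bᶜ → ∃ u ∈ Bᶜ, G.Adj v u
  · have hnc : ¬ (G.induce ((Bᶜ : Finset V) : Set V)).Connected := fun hc => h ⟨hdom, hc⟩
    rw [SimpleGraph.connected_iff, not_and_or] at hnc
    have hnc' : ¬ (G.induce ((Bᶜ : Finset V) : Set V)).Preconnected := by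
      rcases hnc with h | h
      · exact h
      · obtain ⟨x, hx⟩ := hne
        exact absurd ⟨⟨x, hx⟩⟩ h
    unfold SimpleGraph.Preconnected at hnc'
    push Not at hnc'
    obtain ⟨x, y, hxy⟩ := hnc'
    let A : Finset V := Finset.univ.filter fun u =>
      ∃ h : u ∈ ((Bᶜ : Finset V) : Set V), (G.induce ((Bᶜ : Finset V) : Set V)).Reachable x ⟨u, h⟩
    have hA : ∀ u, u ∈ A ↔ ∃ h : u ∈ ((Bᶜ : Finset V) : Set V),
        (G.induce ((Bᶜ : Finset V) : Set V)).Reachable x ⟨u, h⟩ := fun u => by simp [A]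
    refine ⟨B, subset_rfl, Finset.subset_univ _, A, Bᶜ \ A, ⟨x, (hA _).2 ⟨x.2, .rfl⟩⟩,
      ⟨y, ?_⟩, Finset.disjoint_sdiff, ?_, ?_⟩
    · rw [Finset.mem_sdiff, hA]
      exact ⟨y.2, fun ⟨_, h⟩ => hxy h⟩
    · rw [Finset.union_sdiff_of_subset]
      · rw [Finset.compl_eq_univ_sdiff]
      · intro u hu
        obtain ⟨h, -⟩ := (hA u).1 hu
        simpa using h
    · intro a ha b hb hab
      obtain ⟨haB, hreach⟩ := (hA a).1 ha
      rw [Finset.mem_sdiff, hA] at hb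
      have hbB : b ∈ ((Bᶜ : Finset V) : Set V) := by simpa using hb.1
      exact hb.2 ⟨hbB, hreach.trans (SimpleGraph.Adj.reachable
        (G := G.induce ((Bᶜ : Finset V) : Set V)) (u := ⟨a, haB⟩) (v := ⟨b, hbB⟩) hab)⟩
  · push Not at hdom
    obtain ⟨v, hv, hno⟩ := hdom
    refine ⟨B.erase v, Finset.erase_subset _ _, Finset.subset_univ _, {v}, Bᶜ,
      Finset.singleton_nonempty v, hne, Finset.disjoint_singleton_left.2 hv, ?_, ?_⟩
    · ext u
      have : v ∈ B := by simpa using hv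
      simp only [Finset.mem_union, Finset.mem_singleton, Finset.mem_compl, Finset.mem_sdiff,
        Finset.mem_univ, true_and, Finset.mem_erase]
      tauto
    · intro a ha b hb
      rw [Finset.mem_singleton] at ha
      subst ha
      exact hno b hb

theorem isBlocker_elimCut [Fintype V] {pick : Finset V → V}
    (hpick : ∀ R : Finset V, R.Nonempty → IsSimplicialIn G R (pick R)) {i : ℕ}
    (hi : i < Fintype.card V) : IsBlocker G (elimCut G pick i) := by
  rcases elimCut_eq_univ_or_separates hpick hi with h | h
  · rw [h]; exact isBlocker_univ
  · exact h.isBlocker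

/-- Every minimal blocker is a candidate of the elimination. -/
theorem exists_elimCut_eq_of_minimal_isBlocker [Fintype V] {pick : Finset V → V}
    (hpick : ∀ R : Finset V, R.Nonempty → IsSimplicialIn G R (pick R))
    (hV : 0 < Fintype.card V) {B : Finset V} (hB : Minimal (IsBlocker G) B) :
    ∃ i < Fintype.card V, elimCut G pick i = B := by
  by_cases hun : B = Finset.univ
  · rw [hun]; exact exists_elimCut_eq_univ hpick hV
  · rcases hB.prop.eq_univ_or_exists_separates with h | ⟨S, hSB, hS⟩
    · exact absurd h hun
    · have hBS : B = S := Finset.Subset.antisymm (hB.2 hS.isBlocker hSB) hSB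
      refine exists_elimCut_eq_of_minimal hpick ⟨hBS ▸ hS, ?_⟩
      exact fun S' hS' hle => hB.2 hS'.isBlocker hle

end Chordal

/-! ### Dualization of threshold functions -/

section Dualization

variable {V : Type*}

theorem exists_minimal_subset {f : Finset V → Prop} {B : Finset V} (hB : f B) :
    ∃ E ⊆ B, Minimal f E := by
  obtain ⟨E, hE, hmin⟩ := exists_minimal_le_of_wellFoundedLT f B hB
  exact ⟨E, hE, hmin⟩

variable [DecidableEq V]

/-- The strength preorder of a set function `f`: replacing `y` by `x` in a set that satisfies `f`
gives a set that satisfies `f`. -/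
def Stronger (f : Finset V → Prop) (x y : V) : Prop :=
  ∀ B, f B → y ∈ B → x ∉ B → f (insert x (B.erase y))

open Classical in
/-- The number of minimal true points of `f` that have size `s` and contain `x`. -/
noncomputable def winderCount [Fintype V] (f : Finset V → Prop) (s : ℕ) (x : V) : ℕ :=
  (Finset.univ.filter fun E : Finset V => Minimal f E ∧ E.card = s ∧ x ∈ E).card

theorem swap_swap {x y : V} {E : Finset V} (hx : x ∈ E) (hy : y ∉ E) :
    insert x ((insert y (E.erase x)).erase y) = E := by
  ext u
  by_cases hux : u = x
  · subst hux; simp [hx]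
  · by_cases huy : u = y
    · subst huy; simp [hy, hux]
    · simp [hux, huy]

theorem card_swap {x y : V} {E : Finset V} (hx : x ∈ E) (hy : y ∉ E) :
    (insert y (E.erase x)).card = E.card := by
  rw [Finset.card_insert_of_notMem (fun h => hy (Finset.mem_of_mem_erase h)),
    Finset.card_erase_add_one hx]

variable [Fintype V] {f : Finset V → Prop}

open Classical in
theorem winderCount_eq_add (s : ℕ) (x y : V) :
    winderCount f s x =
      (Finset.univ.filter fun E : Finset V =>
        Minimal f E ∧ E.card = s ∧ x ∈ E ∧ y ∈ E).card +
      (Finset.univ.filter fun E : Finset V =>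
        Minimal f E ∧ E.card = s ∧ x ∈ E ∧ y ∉ E).card := by
  rw [winderCount, ← Finset.card_filter_add_card_filter_not (fun E : Finset V => y ∈ E),
    Finset.filter_filter, Finset.filter_filter]
  congr 2 <;> · ext E; simp [and_assoc]

/-- If `y` is stronger than `x`, exchanging `x` for `y` embeds the minimal true points of size `s`
that contain `x` and not `y` into those that contain `y` and not `x`, as long as the counts agree
for smaller sizes; if they agree for `s` as well, the exchange can be reversed. -/
theorem Stronger.swap_minimal {x y : V} (hyx : Stronger f y x) :
    ∀ s, (∀ s' < s, winderCount f s' x = winderCount f s' y) →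
      (∀ E, Minimal f E → E.card = s → x ∈ E → y ∉ E → Minimal f (insert y (E.erase x))) ∧
      winderCount f s x ≤ winderCount f s y ∧
      (winderCount f s x = winderCount f s y →
        ∀ E, Minimal f E → E.card = s → y ∈ E → x ∉ E → Minimal f (insert x (E.erase y))) := by
  classical
  intro s
  induction s using Nat.strong_induction_on with
  | _ s ih =>
  intro heq
  have hmap : ∀ E, Minimal f E → E.card = s → x ∈ E → y ∉ E →
      Minimal f (insert y (E.erase x)) := by
    intro E hE hEs hx hy
    obtain ⟨F, hFsub, hF⟩ := exists_minimal_subset (hyx E hE.prop hx hy)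
    by_cases hFE : F = insert y (E.erase x)
    · rwa [← hFE]
    exfalso
    have hFcard : F.card < s := by
      rw [← hEs, ← card_swap hx hy]
      exact Finset.card_lt_card (hFsub.ssubset_of_ne hFE)
    have hyF : y ∈ F := by
      by_contra hyF
      have hFE' : F ⊆ E.erase x := fun u hu =>
        (Finset.mem_insert.1 (hFsub hu)).resolve_left (fun h => hyF (h ▸ hu))
      exact Finset.notMem_erase x E (hFE' (hE.2 hF.prop (hFE'.trans (Finset.erase_subset _ _)) hx))
    have hxy : x ≠ y := fun h => hy (h ▸ hx)
    have hxF : x ∉ F := fun h => by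
      have := hFsub h
      simp [hxy] at this
    have hF' := (ih _ hFcard (fun s' hs' => heq s' (hs'.trans hFcard))).2.2 (heq _ hFcard) F hF
      rfl hyF hxF
    have hF'E : insert x (F.erase y) ⊆ E := by
      intro u hu
      rcases Finset.mem_insert.1 hu with rfl | hu
      · exact hx
      · have h1 := hFsub (Finset.mem_of_mem_erase hu)
        exact Finset.mem_of_mem_erase
          ((Finset.mem_insert.1 h1).resolve_left (Finset.ne_of_mem_erase hu))
    have hcard := Finset.card_le_card (hE.2 hF'.prop hF'E)
    rw [card_swap hyF hxF] at hcard
    omega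
  have hinj : ∀ E ∈ (Finset.univ.filter fun E : Finset V =>
      Minimal f E ∧ E.card = s ∧ x ∈ E ∧ y ∉ E), insert y (E.erase x) ∈
      (Finset.univ.filter fun E : Finset V => Minimal f E ∧ E.card = s ∧ y ∈ E ∧ x ∉ E) := by
    intro E hE
    simp only [Finset.mem_filter, Finset.mem_univ, true_and] at hE ⊢
    obtain ⟨hE, hEs, hx, hy⟩ := hE
    refine ⟨hmap E hE hEs hx hy, by rw [card_swap hx hy, hEs], Finset.mem_insert_self _ _, ?_⟩
    have hxy : x ≠ y := fun h => hy (h ▸ hx)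
    simp [hxy]
  have hinj' : Set.InjOn (fun E : Finset V => insert y (E.erase x))
      (Finset.univ.filter fun E : Finset V => Minimal f E ∧ E.card = s ∧ x ∈ E ∧ y ∉ E) := by
    intro E hE E' hE' h
    simp only [Finset.coe_filter, Finset.mem_univ, true_and, Set.mem_ofPred_eq] at hE hE'
    rw [← swap_swap hE.2.2.1 hE.2.2.2, ← swap_swap hE'.2.2.1 hE'.2.2.2]
    exact congrArg (fun X : Finset V => insert x (X.erase y)) h
  have hboth : (Finset.univ.filter fun E : Finset V =>
      Minimal f E ∧ E.card = s ∧ x ∈ E ∧ y ∈ E) = (Finset.univ.filter fun E : Finset V =>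
      Minimal f E ∧ E.card = s ∧ y ∈ E ∧ x ∈ E) := by
    ext E
    simp only [Finset.mem_filter]
    tauto
  have hle := Finset.card_le_card_of_injOn _ hinj hinj'
  refine ⟨hmap, ?_, ?_⟩
  · rw [winderCount_eq_add s x y, winderCount_eq_add s y x, hboth]
    omega
  · intro hcount E hE hEs hy hx
    rw [winderCount_eq_add s x y, winderCount_eq_add s y x, hboth] at hcount
    have hsurj := Finset.surjOn_of_injOn_of_card_le _ hinj hinj' (by omega)
    obtain ⟨E', hE', rfl⟩ := hsurj (show E ∈ _ by simpa using ⟨hE, hEs, hy, hx⟩)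
    simp only [Finset.coe_filter, Finset.mem_univ, true_and, Set.mem_ofPred_eq] at hE'
    change Minimal f (insert x ((insert y (E'.erase x)).erase y))
    rw [swap_swap hE'.2.2.1 hE'.2.2.2]
    exact hE'.1

/-- Winder's theorem: if the strength preorder is total, it is refined by the lexicographic order of
the counts of minimal true points, where small sizes come first. -/
theorem stronger_of_winderCount (hmono : ∀ A B, f A → A ⊆ B → f B) {x y : V}
    (htot : Stronger f x y ∨ Stronger f y x)
    (h : (∀ s, winderCount f s x = winderCount f s y) ∨
      ∃ s, winderCount f s y < winderCount f s x ∧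
        ∀ s' < s, winderCount f s' x = winderCount f s' y) : Stronger f x y := by
  rcases htot with hxy | hyx
  · exact hxy
  rcases h with h | ⟨s, hs, hlt⟩
  · intro B hB hy hx
    obtain ⟨E, hEB, hE⟩ := exists_minimal_subset hB
    by_cases hyE : y ∈ E
    · refine hmono _ _ ((hyx.swap_minimal E.card (fun s' _ => h s')).2.2 (h _) E hE rfl hyE
        (fun h => hx (hEB h))).prop ?_
      exact Finset.insert_subset_insert _ (Finset.erase_subset_erase _ hEB)
    · refine hmono _ _ hE.prop fun u hu => Finset.mem_insert_of_mem
        (Finset.mem_erase.2 ⟨fun h => hyE (h ▸ hu), hEB hu⟩)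
  · have := (hyx.swap_minimal s hlt).2.1
    omega

/-- The set determined by `E` and `j`: besides `j`, the vertices outside `E` that `pos` ranks at
least as high as `j`. -/
def transversal {α : Type*} [LinearOrder α] (pos : V → α) (E : Finset V) (j : V) : Finset V :=
  Finset.univ.filter fun u => u = j ∨ pos j ≤ pos u ∧ u ∉ E

theorem mem_transversal {α : Type*} [LinearOrder α] {pos : V → α} {E : Finset V} {j u : V} :
    u ∈ transversal pos E j ↔ u = j ∨ pos j ≤ pos u ∧ u ∉ E := by
  simp [transversal]

/-- The minimal sets that meet all true points come from the minimal true points: if `j` is the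
weakest element of such a set `D`, some minimal true point `E` meets `D` in `j` only, and `E`
contains every vertex outside `D` that is stronger than `j`, because such a vertex could replace
`j`. -/
theorem exists_eq_transversal {α : Type*} [LinearOrder α] {pos : V → α}
    (hmono : ∀ A B, f A → A ⊆ B → f B) (huniv : f Finset.univ)
    (hpos : ∀ x y, pos y ≤ pos x → Stronger f x y) {D : Finset V}
    (hD : Minimal (fun D => ¬ f Dᶜ) D) :
    ∃ E, Minimal f E ∧ ∃ j ∈ E, D = transversal pos E j := by
  have hne : D.Nonempty := by
    rw [Finset.nonempty_iff_ne_empty]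
    rintro rfl
    exact hD.prop (by simpa using huniv)
  obtain ⟨j, hj, hjmin⟩ := D.exists_min_image pos hne
  have hf : f (D.erase j)ᶜ := by
    by_contra hcon
    exact Finset.notMem_erase j D (hD.2 hcon (Finset.erase_subset _ _) hj)
  obtain ⟨E, hE, hEmin⟩ := exists_minimal_subset hf
  have hED : ∀ u ∈ E, u ∈ D → u = j := by
    intro u hu huD
    by_contra huj
    have := hE hu
    simp [huj, huD] at this
  have hjE : j ∈ E := by
    by_contra hjE
    refine hD.prop (hmono _ _ hEmin.prop fun u hu => ?_)
    rw [Finset.mem_compl]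
    exact fun huD => hjE (hED u hu huD ▸ hu)
  refine ⟨E, hEmin, j, hjE, ?_⟩
  ext u
  rw [mem_transversal]
  constructor
  · intro hu
    by_cases huj : u = j
    · exact Or.inl huj
    · exact Or.inr ⟨hjmin u hu, fun huE => huj (hED u huE hu)⟩
  · rintro (rfl | ⟨hju, huE⟩)
    · exact hj
    · by_contra huD
      refine hD.prop (hmono _ _ (hpos u j hju E hEmin.prop hjE huE) fun v hv => ?_)
      rw [Finset.mem_compl]
      rcases Finset.mem_insert.1 hv with rfl | hv
      · exact huD
      · exact fun hvD => Finset.ne_of_mem_erase hv (hED v (Finset.mem_of_mem_erase hv) hvD)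

/-- Among the minimal true points, `E` branches at `j ∈ E`: no minimal true point that agrees with
`E` on the vertices stronger than `j` avoids `j`. -/
def Branches {α : Type*} [LinearOrder α] (f : Finset V → Prop) (pos : V → α) (E : Finset V)
    (j : V) : Prop :=
  j ∈ E ∧ ∀ E', Minimal f E' → (∀ u, pos j < pos u → (u ∈ E' ↔ u ∈ E)) → j ∈ E'

theorem branches_of_minimal_transversal {α : Type*} [LinearOrder α] {pos : V → α}
    (hinj : Function.Injective pos) (hmono : ∀ A B, f A → A ⊆ B → f B) {E : Finset V} {j : V}
    (hj : j ∈ E) (hD : ¬ f (transversal pos E j)ᶜ) : Branches f pos E j := by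
  refine ⟨hj, fun E' hE' hagree => ?_⟩
  by_contra hjE'
  refine hD (hmono _ _ hE'.prop fun u hu => ?_)
  rw [Finset.mem_compl, mem_transversal]
  rintro (rfl | ⟨hju, huE⟩)
  · exact hjE' hu
  · rcases hju.lt_or_eq with h | h
    · exact huE ((hagree u h).1 hu)
    · exact hjE' (hinj h ▸ hu)

/-- If the complement of the transversal contained a true point, exchanges for stronger vertices
would turn it into a minimal true point that agrees with `E` above `j` and avoids `j`. -/
theorem minimal_transversal_of_branches {α : Type*} [LinearOrder α] {pos : V → α}
    (hinj : Function.Injective pos) (hmono : ∀ A B, f A → A ⊆ B → f B)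
    (hpos : ∀ x y, pos y ≤ pos x → Stronger f x y) {E : Finset V} (hE : Minimal f E) {j : V}
    (hb : Branches f pos E j) : Minimal (fun D => ¬ f Dᶜ) (transversal pos E j) := by
  obtain ⟨hj, hb⟩ := hb
  set D := transversal pos E j with hD
  have hjD : j ∈ D := mem_transversal.2 (Or.inl rfl)
  let P : Finset V := E.filter fun u => pos j < pos u
  have hP : ∀ u, u ∈ P ↔ u ∈ E ∧ pos j < pos u := fun u => Finset.mem_filter
  have hPD : ∀ u ∈ P, u ∈ Dᶜ := by
    intro u hu
    rw [Finset.mem_compl, hD, mem_transversal]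
    rintro (rfl | h)
    · exact ((hP u).1 hu).2.ne rfl
    · exact h.2 ((hP u).1 hu).1
  have hDP : ∀ u ∈ Dᶜ, pos j ≤ pos u → u ∈ P := by
    intro u hu hju
    rw [Finset.mem_compl, hD, mem_transversal, not_or] at hu
    refine (hP u).2 ⟨?_, hju.lt_of_ne fun h => hu.1 (hinj h).symm⟩
    by_contra huE
    exact hu.2 ⟨hju, huE⟩
  have hkey : ∀ (m : ℕ) (X : Finset V), (X \ P).card = m → f X → X ⊆ Dᶜ →
      ∃ E', Minimal f E' ∧ P ⊆ E' ∧ E' ⊆ Dᶜ := by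
    intro m
    induction m using Nat.strong_induction_on with
    | _ m ih =>
    intro X hXm hX hXD
    obtain ⟨E₁, hE₁X, hE₁⟩ := exists_minimal_subset hX
    by_cases hPE : P ⊆ E₁
    · exact ⟨E₁, hE₁, hPE, hE₁X.trans hXD⟩
    obtain ⟨i, hiP, hiE₁⟩ := Finset.not_subset.1 hPE
    have hnsub : ¬ E₁ ⊆ P := fun h =>
      ((hP j).1 (h (hE.2 hE₁.prop (fun u hu => ((hP u).1 (h hu)).1) hj))).2.ne rfl
    obtain ⟨u, huE₁, huP⟩ := Finset.not_subset.1 hnsub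
    have huj : pos u < pos j := by
      by_contra hcon
      exact huP (hDP u (hXD (hE₁X huE₁)) (not_lt.1 hcon))
    refine ih _ ?_ (insert i (E₁.erase u)) rfl
      (hpos i u (huj.trans ((hP i).1 hiP).2).le E₁ hE₁.prop huE₁ hiE₁) ?_
    · rw [← hXm]
      refine Finset.card_lt_card ⟨fun v hv => ?_, fun h => ?_⟩
      · rw [Finset.mem_sdiff, Finset.mem_insert, Finset.mem_erase] at hv
        rcases hv with ⟨rfl | hv, hvP⟩
        · exact absurd hiP hvP
        · exact Finset.mem_sdiff.2 ⟨hE₁X hv.2, hvP⟩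
      · have := h (Finset.mem_sdiff.2 ⟨hE₁X huE₁, huP⟩)
        rw [Finset.mem_sdiff, Finset.mem_insert, Finset.mem_erase] at this
        rcases this.1 with rfl | h
        · exact huP hiP
        · exact h.1 rfl
    · intro v hv
      rcases Finset.mem_insert.1 hv with rfl | hv
      · exact hPD v hiP
      · exact hXD (hE₁X (Finset.mem_of_mem_erase hv))
  refine ⟨fun hf => ?_, fun D' hD' hle i hi => ?_⟩
  · obtain ⟨E', hE', hPE', hE'D⟩ := hkey _ Dᶜ rfl hf subset_rfl
    have hjE' : j ∈ E' := by
      refine hb E' hE' fun u hu => ⟨fun huE' => ?_, fun huE => hPE' ((hP u).2 ⟨huE, hu⟩)⟩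
      exact ((hP u).1 (hDP u (hE'D huE') hu.le)).1
    exact Finset.mem_compl.1 (hE'D hjE') hjD
  · by_contra hiD'
    refine hD' ?_
    by_cases hij : i = j
    · subst hij
      refine hmono _ _ hE.prop fun u hu => Finset.mem_compl.2 fun huD' => ?_
      rcases mem_transversal.1 (hle huD') with rfl | h
      · exact hiD' huD'
      · exact h.2 hu
    · obtain ⟨hji, hiE⟩ := (mem_transversal.1 hi).resolve_left hij
      refine hmono _ _ (hpos i j hji E hE.prop hj hiE) fun u hu =>
        Finset.mem_compl.2 fun huD' => ?_
      rcases Finset.mem_insert.1 hu with rfl | hu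
      · exact hiD' huD'
      · rcases mem_transversal.1 (hle huD') with rfl | h
        · exact Finset.ne_of_mem_erase hu rfl
        · exact h.2 (Finset.mem_of_mem_erase hu)

theorem transversal_eq_transversal_iff {α : Type*} [LinearOrder α] {pos : V → α}
    (hinj : Function.Injective pos) {E E' : Finset V} {j j' : V} :
    transversal pos E j = transversal pos E' j' ↔
      j = j' ∧ ∀ u, pos j < pos u → (u ∈ E ↔ u ∈ E') := by
  have hle : ∀ {E : Finset V} {j u : V}, u ∈ transversal pos E j → pos j ≤ pos u := by
    intro E j u hu
    rcases mem_transversal.1 hu with rfl | h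
    · exact le_rfl
    · exact h.1
  constructor
  · intro h
    have h1 : pos j' ≤ pos j := hle (E := E') (h ▸ mem_transversal.2 (Or.inl rfl))
    have h2 : pos j ≤ pos j' := hle (E := E) (h.symm ▸ mem_transversal.2 (Or.inl rfl))
    have hjj : j = j' := hinj (le_antisymm h2 h1)
    subst hjj
    refine ⟨rfl, fun u hu => ?_⟩
    have := Finset.ext_iff.1 h u
    rw [mem_transversal, mem_transversal] at this
    have hne : u ≠ j := fun h => hu.ne (h ▸ rfl)
    simp only [hne, hu.le, true_and, false_or] at this
    exact not_iff_not.1 this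
  · rintro ⟨rfl, h⟩
    ext u
    rw [mem_transversal, mem_transversal]
    by_cases hne : u = j
    · simp [hne]
    · simp only [hne, false_or]
      refine and_congr_right fun hju => ?_
      rw [h u (hju.lt_of_ne fun h => hne (hinj h).symm)]

end Dualization

/-! ### Connected-domishold graphs -/

section Domishold

variable {V : Type*} [DecidableEq V] [Fintype V] {G : SimpleGraph V}

theorem isMinimalCDS_iff {D : Finset V} :
    IsMinimalCDS G D ↔ Minimal (fun D => ¬ IsBlocker G Dᶜ) D := by
  unfold IsMinimalCDS IsBlocker
  simp only [compl_compl, not_not]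

/-- In a connected-domishold graph, blockers are the sets whose complement has small weight; so
larger weight means greater strength. -/
theorem IsConnectedDomishold.exists_weight (h : IsConnectedDomishold G) :
    (∀ A B, IsBlocker G A → A ⊆ B → IsBlocker G B) ∧
      ∃ w : V → ℝ≥0, ∀ x y, w y ≤ w x → Stronger (IsBlocker G) x y := by
  obtain ⟨w, t, hw⟩ := h
  refine ⟨fun A B hA hAB hB => hA ?_, w, fun x y hxy B hB hy hx hB' => hB ?_⟩
  · rw [← hw] at hB ⊢
    exact hB.trans (Finset.sum_le_sum_of_subset (Finset.compl_subset_compl.2 hAB))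
  · rw [← hw] at hB' ⊢
    refine hB'.trans ?_
    have hxy' : x ≠ y := fun h => hx (h ▸ hy)
    have hc : (insert x (B.erase y))ᶜ = insert y (Bᶜ.erase x) := by
      ext u
      by_cases hux : u = x
      · subst hux; simp [hxy']
      · by_cases huy : u = y
        · subst huy; simp [hux]
        · simp [hux, huy]
    have h1 : x ∈ Bᶜ := Finset.mem_compl.2 hx
    have h2 : y ∉ Bᶜ.erase x := fun h => Finset.mem_compl.1 (Finset.mem_of_mem_erase h) hy
    rw [hc, Finset.sum_insert h2, ← Finset.add_sum_erase _ _ h1]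
    exact add_le_add_left hxy _

/-- Minimal connected dominating sets are determined by a candidate cutset and a vertex. -/
theorem IsConnectedDomishold.ncard_isMinimalCDS_le (h : IsConnectedDomishold G)
    (hG : IsChordalGraph G) :
    {D : Finset V | IsMinimalCDS G D}.ncard ≤ Fintype.card V ^ 2 := by
  classical
  rcases Nat.eq_zero_or_pos (Fintype.card V) with hV | hV
  · have : {D : Finset V | IsMinimalCDS G D} = ∅ := by
      ext D
      simp only [Set.mem_ofPred_eq, Set.mem_empty_iff_false, iff_false]
      intro hD
      obtain ⟨⟨x, -⟩⟩ := hD.prop.2.nonempty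
      exact (Fintype.card_eq_zero_iff.1 hV).false x
    simp [this]
  obtain ⟨v₀⟩ := Fintype.card_pos_iff.1 hV
  let pick : Finset V → V := fun R =>
    if hR : R.Nonempty then (hG.exists_simplicial hR).choose else v₀
  have hpick : ∀ R : Finset V, R.Nonempty → IsSimplicialIn G R (pick R) := by
    intro R hR
    simp only [pick, dif_pos hR]
    exact (hG.exists_simplicial hR).choose_spec
  obtain ⟨hmono, w, hw⟩ := h.exists_weight
  let F : Fin (Fintype.card V) × V → Finset V := fun p => transversal w (elimCut G pick p.1) p.2
  have hsub : {D : Finset V | IsMinimalCDS G D} ⊆ Set.range F := by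
    intro D hD
    obtain ⟨E, hE, j, -, rfl⟩ :=
      exists_eq_transversal hmono isBlocker_univ hw (isMinimalCDS_iff.1 hD)
    obtain ⟨i, hi, rfl⟩ := exists_elimCut_eq_of_minimal_isBlocker hpick hV hE
    exact ⟨(⟨i, hi⟩, j), rfl⟩
  refine (Set.ncard_le_ncard hsub (Set.finite_range F)).trans ?_
  rw [← Set.image_univ]
  refine (Set.ncard_image_le Set.finite_univ).trans ?_
  rw [Set.ncard_univ, Nat.card_eq_fintype_card, Fintype.card_prod, Fintype.card_fin, sq]

end Domishold

/-! ### Reasoning about programs -/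

namespace RAM

/-- Started with memory `s` and word bound `B`, the program `p` halts within time `T` with a memory
that satisfies `Q`. -/
def Runs (B : ℕ) (p : Program) (s : Memory) (T : ℕ) (Q : Memory → Prop) : Prop :=
  ∃ s' t, Exec B p s s' t ∧ t ≤ T ∧ Q s'

variable {B : ℕ}

theorem Runs.mono {p : Program} {s : Memory} {T T' : ℕ} {Q Q' : Memory → Prop}
    (h : Runs B p s T Q) (hT : T ≤ T') (hQ : ∀ s', Q s' → Q' s') : Runs B p s T' Q' := by
  obtain ⟨s', t, he, ht, hq⟩ := h
  exact ⟨s', t, he, ht.trans hT, hQ s' hq⟩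

theorem Runs.seq {p q : Program} {s : Memory} {T T' : ℕ} {Q R : Memory → Prop}
    (hp : Runs B p s T Q) (hq : ∀ s', Q s' → Runs B q s' T' R) :
    Runs B (.seq p q) s (T + T') R := by
  obtain ⟨s', t, he, ht, h⟩ := hp
  obtain ⟨s'', t', he', ht', h'⟩ := hq s' h
  exact ⟨s'', t + t', .seq he he', add_le_add ht ht', h'⟩

theorem runs_setReg {s : Memory} {i : ℕ} {e : Expr} {Q : Memory → Prop} (hv : e.eval s ≤ B)
    (h : Q (s.writeReg i (e.eval s))) : Runs B (.setReg i e) s (e.cost + 1) Q :=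
  ⟨_, _, .setReg s i e hv, le_rfl, h⟩

theorem runs_setArr {s : Memory} {a : ℕ} {d e : Expr} {Q : Memory → Prop} (hd : d.eval s ≤ B)
    (hv : e.eval s ≤ B) (h : Q (s.writeArr a (d.eval s) (e.eval s))) :
    Runs B (.setArr a d e) s (d.cost + e.cost + 1) Q :=
  ⟨_, _, .setArr s a d e hd hv, le_rfl, h⟩

theorem runs_setRReg {s : Memory} {i : ℕ} {x : RExpr} {Q : Memory → Prop}
    (h : Q (s.writeRReg i (x.eval s))) : Runs B (.setRReg i x) s (x.cost + 1) Q :=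
  ⟨_, _, .setRReg s i x, le_rfl, h⟩

theorem runs_skip {s : Memory} {Q : Memory → Prop} (h : Q s) : Runs B .skip s 1 Q :=
  ⟨_, _, .skip s, le_rfl, h⟩

theorem runs_ite {c : Test} {p q : Program} {s : Memory} {T : ℕ} {Q : Memory → Prop}
    (hp : c.holds s → Runs B p s T Q) (hq : ¬ c.holds s → Runs B q s T Q) :
    Runs B (.ite c p q) s (c.cost + 1 + T) Q := by
  by_cases hc : c.holds s
  · obtain ⟨s', t, he, ht, h⟩ := hp hc
    exact ⟨s', _, .ite_true hc he, by omega, h⟩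
  · obtain ⟨s', t, he, ht, h⟩ := hq hc
    exact ⟨s', _, .ite_false hc he, by omega, h⟩

/-- The loop "for register `r` from 0 up to the content of register `b`, exclusively, do `p`". -/
def forLoop (r b : ℕ) (p : Program) : Program :=
  .seq (.setReg r (.const 0))
    (.loop (.lt (.reg r) (.reg b)) (.seq p (.setReg r (.add (.reg r) (.const 1)))))

theorem runs_forLoop {r b : ℕ} {p : Program} {n T : ℕ} (I : ℕ → Memory → Prop) {s : Memory}
    (hrb : r ≠ b) (hb : s.reg b = n) (hn : n ≤ B) (h0 : I 0 (s.writeReg r 0))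
    (hstep : ∀ k < n, ∀ s, I k s → s.reg r = k → s.reg b = n →
      Runs B p s T fun s' => s'.reg r = k ∧ s'.reg b = n ∧ I (k + 1) (s'.writeReg r (k + 1))) :
    Runs B (forLoop r b p) s ((n + 1) * (T + 10)) (I n) := by
  have hloop : ∀ m k, m + k = n → ∀ s, I k s → s.reg r = k → s.reg b = n →
      Runs B (.loop (.lt (.reg r) (.reg b)) (.seq p (.setReg r (.add (.reg r) (.const 1))))) s
        (m * (T + 10) + 4) (I n) := by
    intro m
    induction m with
    | zero =>
      intro k hk s hI hr hbs
      have hkn : k = n := by omega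
      subst hkn
      exact ⟨s, _, .loop_exit (by simp [Test.holds, Expr.eval, hr, hbs]),
        by simp [Test.cost, Expr.cost], hI⟩
    | succ m ih =>
      intro k hk s hI hr hbs
      obtain ⟨s', t, he, ht, hr', hb', hI'⟩ := hstep k (by omega) s hI hr hbs
      have hb'' : (s'.writeReg r (k + 1)).reg b = n := by
        simp [Memory.writeReg, Function.update_of_ne hrb.symm, hb']
      obtain ⟨s'', t', he', ht', hI''⟩ := ih (k + 1) (by omega) (s'.writeReg r (k + 1)) hI'
        (by simp [Memory.writeReg]) hb''
      have hinc := Exec.setReg (B := B) s' r (.add (.reg r) (.const 1))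
        (by simp only [Expr.eval, hr']; omega)
      simp only [Expr.eval, hr'] at hinc
      refine ⟨s'', _, .loop_step (by simp only [Test.holds, Expr.eval, hr, hbs]; omega)
        (.seq he hinc) he', ?_, hI''⟩
      simp only [Test.cost, Expr.cost]
      rw [Nat.add_mul]
      omega
  refine (Runs.seq (T' := n * (T + 10) + 4) (runs_setReg (B := B)
    (Q := fun s' => s' = s.writeReg r 0) (by simp [Expr.eval]) (by simp [Expr.eval])) ?_).mono
    ?_ (fun _ h => h)
  · rintro s' rfl
    exact hloop n 0 (by omega) _ h0 (by simp [Memory.writeReg])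
      (by simp [Memory.writeReg, Function.update_of_ne hrb.symm, hb])
  · simp only [Expr.cost]
    rw [Nat.add_mul]
    omega

/-- The expression with value 1 if `x < y` and 0 otherwise. -/
def Expr.ltE (x y : Expr) : Expr := .sub (.const 1) (.sub (.const 1) (.sub y x))

/-- The expression with value 1 if `x = y` and 0 otherwise. -/
def Expr.eqE (x y : Expr) : Expr := .sub (.const 1) (.add (.sub x y) (.sub y x))

/-- The expression `1 - x`, the negation of a truth value. -/
def Expr.notE (x : Expr) : Expr := .sub (.const 1) x

@[simp] theorem Expr.eval_ltE (s : Memory) (x y : Expr) :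
    (Expr.ltE x y).eval s = if x.eval s < y.eval s then 1 else 0 := by
  simp only [Expr.ltE, Expr.eval]
  split_ifs <;> omega

@[simp] theorem Expr.eval_eqE (s : Memory) (x y : Expr) :
    (Expr.eqE x y).eval s = if x.eval s = y.eval s then 1 else 0 := by
  simp only [Expr.eqE, Expr.eval]
  split_ifs <;> omega

@[simp] theorem Expr.eval_notE (s : Memory) (x : Expr) :
    (Expr.notE x).eval s = 1 - x.eval s := rfl

/-- Computes one row of a table with columns `j = 0, …, n - 1`, where register 0 holds `n`: the cell
of array `a` with address `off + j` receives the final value of register 4 in the computation that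
starts with `init` and performs the update `e` for `k = 0, …, n - 1`. The expressions find `j` in
register 3 and `k` in register 5. -/
def row (a : ℕ) (off init e : Expr) : Program :=
  forLoop 3 0 (.seq (.setReg 4 init) (.seq (forLoop 5 0 (.setReg 4 e))
    (.setArr a (.add off (.reg 3)) (.reg 4))))

/-- `s` agrees with `s₀` except for the word registers from 3 on, the real registers, and the cells of
array `a` with addresses in `[o, o + n)`. -/
structure AgreeOff (a o n : ℕ) (s₀ s : Memory) : Prop where
  reg : ∀ r < 3, s.reg r = s₀.reg r
  rarr : s.rarr = s₀.rarr
  arr : ∀ a' ≠ a, s.arr a' = s₀.arr a'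
  cell : ∀ x, x < o ∨ o + n ≤ x → s.arr a x = s₀.arr a x

theorem AgreeOff.refl (a o n : ℕ) (s : Memory) : AgreeOff a o n s s :=
  ⟨fun _ _ => rfl, rfl, fun _ _ => rfl, fun _ _ => rfl⟩

theorem AgreeOff.writeReg {a o n : ℕ} {s₀ s : Memory} (h : AgreeOff a o n s₀ s) {r : ℕ}
    (hr : 3 ≤ r) (v : ℕ) : AgreeOff a o n s₀ (s.writeReg r v) := by
  refine ⟨fun r' hr' => ?_, h.rarr, h.arr, h.cell⟩
  simp only [Memory.writeReg]
  rw [Function.update_of_ne (by omega)]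
  exact h.reg r' hr'

theorem AgreeOff.writeArr {a o n : ℕ} {s₀ s : Memory} (h : AgreeOff a o n s₀ s) {j : ℕ}
    (hj : j < n) (v : ℕ) : AgreeOff a o n s₀ (s.writeArr a (o + j) v) := by
  refine ⟨h.reg, h.rarr, fun a' ha' => ?_, fun x hx => ?_⟩
  · simp only [Memory.writeArr]
    rw [Function.update_of_ne ha']
    exact h.arr a' ha'
  · simp only [Memory.writeArr, Function.update_self]
    rw [Function.update_of_ne (by omega)]
    exact h.cell x hx

theorem runs_row {a : ℕ} {off init e : Expr} {n o : ℕ} {s₀ : Memory} (acc : ℕ → ℕ → ℕ)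
    (hreg : s₀.reg 0 = n) (hoff : ∀ s, AgreeOff a o n s₀ s → off.eval s = o)
    (hinit : ∀ j < n, ∀ s, AgreeOff a o n s₀ s → s.reg 3 = j → init.eval s = acc j 0)
    (hstep : ∀ j < n, ∀ k < n, ∀ s, AgreeOff a o n s₀ s → s.reg 3 = j → s.reg 5 = k →
      s.reg 4 = acc j k → e.eval s = acc j (k + 1))
    (hB : ∀ j < n, ∀ k ≤ n, acc j k ≤ B) (ho : o + n ≤ B) :
    Runs B (row a off init e) s₀ ((init.cost + off.cost + e.cost + 40) * (n + 1) ^ 2)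
      fun s => AgreeOff a o n s₀ s ∧ ∀ j < n, s.arr a (o + j) = acc j n := by
  have hinner : ∀ j < n, ∀ s, AgreeOff a o n s₀ s → (∀ j' < j, s.arr a (o + j') = acc j' n) →
      s.reg 3 = j →
      Runs B (.seq (.setReg 4 init) (.seq (forLoop 5 0 (.setReg 4 e))
        (.setArr a (.add off (.reg 3)) (.reg 4)))) s
        (init.cost + 1 + ((n + 1) * (e.cost + 1 + 10) + (off.cost + 4))) fun s' =>
          AgreeOff a o n s₀ s' ∧ (∀ j' < j + 1, s'.arr a (o + j') = acc j' n) ∧ s'.reg 3 = j := by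
    intro j hj s hs hdone h3
    have hinit' := hinit j hj s hs h3
    refine Runs.seq (Q := fun s' => AgreeOff a o n s₀ s' ∧
      (∀ j' < j, s'.arr a (o + j') = acc j' n) ∧ s'.reg 3 = j ∧ s'.reg 4 = acc j 0)
      (runs_setReg (by rw [hinit']; exact hB j hj 0 (Nat.zero_le _)) ?_) ?_
    · refine ⟨hs.writeReg (by omega) _, hdone, ?_, ?_⟩
      · simp [Memory.writeReg, h3]
      · simp [Memory.writeReg, hinit']
    rintro s ⟨hs, hdone, h3, h4⟩
    refine Runs.seq (Q := fun s' => AgreeOff a o n s₀ s' ∧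
      (∀ j' < j, s'.arr a (o + j') = acc j' n) ∧ s'.reg 3 = j ∧ s'.reg 4 = acc j n)
      (runs_forLoop (n := n) (fun k s' => AgreeOff a o n s₀ s' ∧
        (∀ j' < j, s'.arr a (o + j') = acc j' n) ∧ s'.reg 3 = j ∧ s'.reg 4 = acc j k)
        (by omega) ?_ (by omega) ?_ ?_) ?_
    · rw [hs.reg 0 (by omega), hreg]
    · exact ⟨hs.writeReg (by omega) _, hdone, by simp [Memory.writeReg, h3],
        by simp [Memory.writeReg, h4]⟩
    · rintro k hk s ⟨hs, hdone, h3, h4⟩ h5 h0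
      have hstep' := hstep j hj k hk s hs h3 h5 h4
      refine runs_setReg (by rw [hstep']; exact hB j hj _ hk) ⟨?_, ?_, ?_, hdone, ?_, ?_⟩
      · simp [Memory.writeReg, h5]
      · simp [Memory.writeReg, h0]
      · exact (hs.writeReg (by omega) _).writeReg (by omega) _
      · simp [Memory.writeReg, h3]
      · simp [Memory.writeReg, hstep']
    · rintro s ⟨hs, hdone, h3, h4⟩
      have haddr : (Expr.add off (.reg 3)).eval s = o + j := by
        simp only [Expr.eval, hoff s hs, h3]
      have hval : (Expr.reg 4).eval s = acc j n := by simp only [Expr.eval, h4]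
      refine (runs_setArr (by rw [haddr]; omega) (by rw [hval]; exact hB j hj n le_rfl)
        ?_).mono (by simp only [Expr.cost]; omega) (fun _ h => h)
      rw [haddr, hval]
      refine ⟨hs.writeArr hj _, fun j' hj' => ?_, h3⟩
      simp only [Memory.writeArr, Function.update_self]
      rcases Nat.lt_succ_iff_lt_or_eq.1 hj' with h | rfl
      · rw [Function.update_of_ne (by omega)]
        exact hdone j' h
      · rw [Function.update_self]
  refine (runs_forLoop (n := n) (fun j s => AgreeOff a o n s₀ s ∧
    ∀ j' < j, s.arr a (o + j') = acc j' n) (by omega) hreg (by omega)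
    ⟨(AgreeOff.refl a o n s₀).writeReg (by omega) _, fun j' hj' => absurd hj' (by omega)⟩
    fun j hj s hI h3 h0 => (hinner j hj s hI.1 hI.2 h3).mono le_rfl ?_).mono ?_ fun _ h => h
  · rintro s' ⟨hs, hdone, h3'⟩
    refine ⟨h3', ?_, hs.writeReg (by omega) _, hdone⟩
    rw [hs.reg 0 (by omega), hreg]
  · rw [sq]
    have : (init.cost + 1 + ((n + 1) * (e.cost + 1 + 10) + (off.cost + 4))) + 10 ≤
        (init.cost + off.cost + e.cost + 40) * (n + 1) := by nlinarith
    calc _ ≤ (n + 1) * ((init.cost + off.cost + e.cost + 40) * (n + 1)) :=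
          Nat.mul_le_mul_left _ this
      _ = _ := by ring

/-- Computes a table with `n` rows and columns, row `i` while register 2 holds `i`. -/
def table (a : ℕ) (init e : Expr) : Program :=
  forLoop 2 0 (row a (.mul (.reg 2) (.reg 0)) init e)

/-- `s` agrees with `s₀` except for the word registers from 2 on, the real registers, and array `a`. -/
structure AgreeArr (a : ℕ) (s₀ s : Memory) : Prop where
  reg : ∀ r < 2, s.reg r = s₀.reg r
  rarr : s.rarr = s₀.rarr
  arr : ∀ a' ≠ a, s.arr a' = s₀.arr a'

theorem runs_table {a : ℕ} {init e : Expr} {n : ℕ} {s₀ : Memory} (acc : ℕ → ℕ → ℕ → ℕ)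
    (hreg : s₀.reg 0 = n)
    (hinit : ∀ i < n, ∀ j < n, ∀ s, AgreeArr a s₀ s → s.reg 2 = i → s.reg 3 = j →
      init.eval s = acc i j 0)
    (hstep : ∀ i < n, ∀ j < n, ∀ k < n, ∀ s, AgreeArr a s₀ s → s.reg 2 = i → s.reg 3 = j →
      s.reg 5 = k → s.reg 4 = acc i j k → e.eval s = acc i j (k + 1))
    (hB : ∀ i < n, ∀ j < n, ∀ k ≤ n, acc i j k ≤ B) (ho : n * n + n ≤ B) :
    Runs B (table a init e) s₀ ((init.cost + e.cost + 60) * (n + 1) ^ 3)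
      fun s => AgreeArr a s₀ s ∧ ∀ i < n, ∀ j < n, s.arr a (i * n + j) = acc i j n := by
  refine (runs_forLoop (n := n) (T := (init.cost + 3 + e.cost + 40) * (n + 1) ^ 2)
    (fun i s => AgreeArr a s₀ s ∧
    ∀ i' < i, ∀ j < n, s.arr a (i' * n + j) = acc i' j n) (by omega) hreg (by omega) ?_ ?_).mono
    ?_ fun _ h => h
  · refine ⟨⟨fun r hr => ?_, rfl, fun _ _ => rfl⟩, fun i' hi' => absurd hi' (by omega)⟩
    simp only [Memory.writeReg]
    rw [Function.update_of_ne (by omega)]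
  · rintro i hi s ⟨hs, hdone⟩ h2 h0
    have hag : ∀ s', AgreeOff a (i * n) n s s' → AgreeArr a s₀ s' := fun s' h =>
      ⟨fun r hr => (h.reg r (by omega)).trans (hs.reg r hr), h.rarr.trans hs.rarr,
        fun a' ha' => (h.arr a' ha').trans (hs.arr a' ha')⟩
    have hin : i * n + n ≤ n * n := by nlinarith
    refine (runs_row (o := i * n) (acc i) h0 ?_ ?_ ?_ (hB i hi) (by omega)).mono le_rfl ?_
    · intro s' h
      simp only [Expr.eval, h.reg 2 (by omega), h.reg 0 (by omega), h2, h0]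
    · intro j hj s' h h3
      exact hinit i hi j hj s' (hag s' h) (by rw [h.reg 2 (by omega), h2]) h3
    · intro j hj k hk s' h h3 h5 h4
      exact hstep i hi j hj k hk s' (hag s' h) (by rw [h.reg 2 (by omega), h2]) h3 h5 h4
    · rintro s' ⟨h, hrow⟩
      refine ⟨by rw [h.reg 2 (by omega), h2], by rw [h.reg 0 (by omega), h0],
        ⟨fun r hr => ?_, (hag s' h).rarr, (hag s' h).arr⟩, fun i' hi' j hj => ?_⟩
      · simp only [Memory.writeReg]
        rw [Function.update_of_ne (by omega)]
        exact (hag s' h).reg r hr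
      · simp only [Memory.writeReg]
        rcases Nat.lt_succ_iff_lt_or_eq.1 hi' with h' | rfl
        · rw [h.cell _ (Or.inl (by nlinarith))]
          exact hdone i' h' j hj
        · exact hrow j hj
  · have : (init.cost + 3 + e.cost + 40) * (n + 1) ^ 2 + 10 ≤
        (init.cost + e.cost + 60) * (n + 1) ^ 2 := by
      have : 1 ≤ (n + 1) ^ 2 := Nat.one_le_pow _ _ (by omega)
      nlinarith
    calc _ ≤ (n + 1) * ((init.cost + e.cost + 60) * (n + 1) ^ 2) := Nat.mul_le_mul_left _ this
      _ = _ := by ring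

/-- Array `a` holds the table `f` with `n` rows and columns, row by row. -/
def TableIs (n : ℕ) (s : Memory) (a : ℕ) (f : ℕ → ℕ → ℕ) : Prop :=
  ∀ i < n, ∀ j < n, s.arr a (i * n + j) = f i j

theorem AgreeArr.tableIs {a a' n : ℕ} {s₀ s : Memory} {f : ℕ → ℕ → ℕ} (h : AgreeArr a s₀ s)
    (ht : TableIs n s₀ a' f) (ha : a' ≠ a) : TableIs n s a' f := by
  intro i hi j hj
  rw [h.arr a' ha]
  exact ht i hi j hj

/-- Computes the table of the sums over `k < n` of the expression `e`. -/
def sumTable (a : ℕ) (e : Expr) : Program := table a (.const 0) (.add (.reg 4) e)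

theorem runs_sumTable {a : ℕ} {e : Expr} {n : ℕ} {s₀ : Memory} (t : ℕ → ℕ → ℕ → ℕ) (M : ℕ)
    (hreg : s₀.reg 0 = n)
    (hterm : ∀ i < n, ∀ j < n, ∀ k < n, ∀ s, AgreeArr a s₀ s → s.reg 0 = n → s.reg 2 = i →
      s.reg 3 = j → s.reg 5 = k → e.eval s = t i j k)
    (hM : ∀ i < n, ∀ j < n, ∀ k < n, t i j k ≤ M) (hB : n * M ≤ B) (ho : n * n + n ≤ B) :
    Runs B (sumTable a e) s₀ ((e.cost + 70) * (n + 1) ^ 3)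
      fun s => AgreeArr a s₀ s ∧ TableIs n s a fun i j => ∑ k ∈ Finset.range n, t i j k := by
  refine (runs_table (fun i j k => ∑ k ∈ Finset.range k, t i j k) hreg ?_ ?_ ?_ ho).mono
    ?_ fun _ h => h
  · intro i hi j hj s _ _ _
    simp [Expr.eval]
  · intro i hi j hj k hk s hs h2 h3 h5 h4
    rw [Finset.sum_range_succ]
    simp only [Expr.eval, h4]
    rw [hterm i hi j hj k hk s hs ((hs.reg 0 (by omega)).trans hreg) h2 h3 h5]
  · intro i hi j hj k hk
    refine le_trans ?_ hB
    calc ∑ u ∈ Finset.range k, t i j u ≤ ∑ _u ∈ Finset.range k, M :=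
          Finset.sum_le_sum fun u hu => hM i hi j hj u
            ((Finset.mem_range.1 hu).trans_le hk)
      _ = k * M := by simp
      _ ≤ n * M := Nat.mul_le_mul_right _ hk
  · refine Nat.mul_le_mul_right _ ?_
    simp only [Expr.cost]
    omega

end RAM

/-! ### Enumeration of the minimal transversals -/

/-- The characteristic function of a set of vertices, extended by 0. -/
def indicator {n : ℕ} (S : Finset (Fin n)) (u : ℕ) : ℕ :=
  if h : u < n then if ⟨u, h⟩ ∈ S then 1 else 0 else 0

theorem indicator_coe {n : ℕ} (S : Finset (Fin n)) (u : Fin n) :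
    indicator S u = if u ∈ S then 1 else 0 := by
  simp [indicator]

theorem indicator_le_one {n : ℕ} (S : Finset (Fin n)) (u : ℕ) : indicator S u ≤ 1 := by
  unfold indicator
  split_ifs <;> simp

namespace Enumeration

variable {n : ℕ} (E : ℕ → Finset (Fin n))

/-- The size of `E i \ E k`. -/
def excess (i k : ℕ) : ℕ :=
  ∑ u ∈ Finset.range n, indicator (E i) u * (1 - indicator (E k) u)

/-- The number of reasons to discard `E i`: another set of the family is smaller, or it is the same
and comes earlier. -/
def discard (i : ℕ) : ℕ :=
  ∑ k ∈ Finset.range n, (if excess E k i = 0 then 1 else 0) *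
    ((if 0 < excess E i k then 1 else 0) + if k < i then 1 else 0)

/-- The number of vertices outside `E i`. -/
def cosize (i : ℕ) : ℕ := ∑ u ∈ Finset.range n, (1 - indicator (E i) u)

/-- The number of sets of the family without discarded sets that contain `x` and miss exactly `k`
vertices. -/
def count (k x : ℕ) : ℕ :=
  ∑ i ∈ Finset.range n, (1 - discard E i) * (if cosize E i = k then 1 else 0) *
    indicator (E i) x

/-- Lexicographic comparison of `x` and `y` by the counts, where the smallest sets among those that
miss less than `m` vertices come first and ties are broken by the labels: 1 if `x` precedes `y`, and
0 otherwise. -/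
def lexi (x y : ℕ) : ℕ → ℕ
  | 0 => if x < y then 1 else 0
  | m + 1 => (if count E m y < count E m x then 1 else 0) +
      (if count E m x = count E m y then 1 else 0) * lexi x y m

/-- The rank of `x`: the number of vertices that `x` precedes. -/
def rank (x : ℕ) : ℕ := ∑ y ∈ Finset.range n, lexi E x y n

/-- One more than the largest rank of a vertex `u < m` in the symmetric difference of `E i` and
`E k`, or 0 if there is no such vertex. -/
def topDiff (i k : ℕ) : ℕ → ℕ
  | 0 => 0
  | m + 1 => topDiff i k m +
      ((1 - if indicator (E i) m = indicator (E k) m then 1 else 0) * (rank E m + 1) -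
        topDiff i k m)

/-- The number of reasons to skip the pair `(E i, j)`: a set that first differs from `E i` in `j`,
or an earlier set that agrees with `E i` up to `j`. -/
def skip (i j : ℕ) : ℕ :=
  ∑ k ∈ Finset.range n, (1 - discard E k) *
    ((if topDiff E i k n = rank E j + 1 then 1 else 0) +
      (if k < i then 1 else 0) * if topDiff E i k n < rank E j + 1 then 1 else 0)

/-- 1 if the pair `(E i, j)` is used for the output, and 0 otherwise. -/
def valid (i j : ℕ) : ℕ := (1 - discard E i) * indicator (E i) j * (1 - skip E i j)

theorem excess_eq_zero_iff {i k : ℕ} : excess E i k = 0 ↔ E i ⊆ E k := by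
  rw [excess, Finset.sum_range, Finset.sum_eq_zero_iff]
  simp only [Finset.mem_univ, true_imp_iff, indicator_coe]
  refine ⟨fun h u hu => ?_, fun h u => ?_⟩
  · by_contra hk
    have := h u
    simp [hu, hk] at this
  · by_cases hu : u ∈ E i
    · simp [hu, h hu]
    · simp [hu]

theorem discard_eq_zero_iff {i : ℕ} :
    discard E i = 0 ↔ ∀ k < n, E k ⊆ E i → E i ⊆ E k ∧ i ≤ k := by
  rw [discard, Finset.sum_eq_zero_iff]
  simp only [Finset.mem_range]
  refine forall₂_congr fun k _ => ?_
  have h1 := excess_eq_zero_iff E (i := i) (k := k)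
  have h2 := excess_eq_zero_iff E (i := k) (k := i)
  by_cases hki : E k ⊆ E i
  · rw [if_pos (h2.2 hki), ← h1, one_mul]
    simp only [hki, true_imp_iff]
    split_ifs <;> constructor <;> intro h <;> first | exact h.elim | omega
  · rw [if_neg fun h => hki (h2.1 h)]
    simp [hki]

theorem cosize_eq (i : ℕ) : cosize E i = n - (E i).card := by
  rw [cosize, Finset.sum_range]
  have : ∀ u : Fin n, 1 - indicator (E i) u = if u ∈ (E i)ᶜ then 1 else 0 := by
    intro u
    rw [indicator_coe]
    by_cases h : u ∈ E i <;> simp [h]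
  simp only [this, Finset.sum_boole, Finset.filter_mem_eq_inter, Finset.univ_inter, Nat.cast_id,
    Finset.card_compl, Fintype.card_fin]

/-- The relation computed by `lexi`. -/
def Precedes (x y : ℕ) : ℕ → Prop
  | 0 => x < y
  | m + 1 => count E m y < count E m x ∨ count E m x = count E m y ∧ Precedes x y m

open Classical in
theorem lexi_eq (x y m : ℕ) : lexi E x y m = if Precedes E x y m then 1 else 0 := by
  induction m with
  | zero => by_cases h : x < y <;> simp [lexi, Precedes, h]
  | succ m ih =>
    rw [lexi, ih]
    simp only [Precedes]
    by_cases h1 : count E m y < count E m x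
    · simp [h1, h1.ne']
    · by_cases h2 : count E m x = count E m y
      · simp [h2]
      · simp [h1, h2]

theorem Precedes.irrefl (x m : ℕ) : ¬ Precedes E x x m := by
  induction m with
  | zero => simp [Precedes]
  | succ m ih => simp [Precedes, ih]

theorem Precedes.trans {x y z m : ℕ} (h : Precedes E x y m) (h' : Precedes E y z m) :
    Precedes E x z m := by
  induction m with
  | zero => exact lt_trans h h'
  | succ m ih =>
    simp only [Precedes] at h h' ⊢
    rcases h with h | ⟨h, hp⟩ <;> rcases h' with h' | ⟨h', hp'⟩
    · exact Or.inl (h'.trans h)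
    · exact Or.inl (h' ▸ h)
    · exact Or.inl (h ▸ h')
    · exact Or.inr ⟨h.trans h', ih hp hp'⟩

theorem Precedes.total {x y m : ℕ} (hxy : x ≠ y) : Precedes E x y m ∨ Precedes E y x m := by
  induction m with
  | zero => exact lt_or_gt_of_ne hxy
  | succ m ih =>
    simp only [Precedes]
    rcases lt_trichotomy (count E m x) (count E m y) with h | h | h
    · exact Or.inr (Or.inl h)
    · rcases ih with h' | h'
      · exact Or.inl (Or.inr ⟨h, h'⟩)
      · exact Or.inr (Or.inr ⟨h.symm, h'⟩)
    · exact Or.inl (Or.inl h)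

theorem Precedes.exists_count {x y m : ℕ} (h : Precedes E x y m) :
    (∀ k < m, count E k x = count E k y) ∨ ∃ k < m, count E k y < count E k x ∧
      ∀ k', k < k' → k' < m → count E k' x = count E k' y := by
  induction m with
  | zero => exact Or.inl fun k hk => absurd hk (by omega)
  | succ m ih =>
    rcases h with h | ⟨h, hp⟩
    · exact Or.inr ⟨m, by omega, h, fun k' h1 h2 => absurd h1 (by omega)⟩
    · rcases ih hp with h' | ⟨k, hk, hlt, h'⟩
      · refine Or.inl fun k hk => ?_
        rcases Nat.lt_succ_iff_lt_or_eq.1 hk with h1 | rfl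
        · exact h' k h1
        · exact h
      · refine Or.inr ⟨k, by omega, hlt, fun k' h1 h2 => ?_⟩
        rcases Nat.lt_succ_iff_lt_or_eq.1 h2 with h3 | rfl
        · exact h' k' h1 h3
        · exact h

open Classical in
theorem rank_eq (x : ℕ) :
    rank E x = (Finset.univ.filter fun y : Fin n => Precedes E x y n).card := by
  rw [rank, Finset.sum_range]
  simp only [lexi_eq, Finset.sum_boole, Nat.cast_id]

theorem rank_lt_of_precedes {x y : Fin n} (h : Precedes E x y n) : rank E y < rank E x := by
  classical
  rw [rank_eq, rank_eq]
  refine Finset.card_lt_card ⟨fun z hz => ?_, fun hsub => ?_⟩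
  · simp only [Finset.mem_filter, Finset.mem_univ, true_and] at hz ⊢
    exact h.trans E hz
  · have := hsub (Finset.mem_filter.2 ⟨Finset.mem_univ y, h⟩)
    exact Precedes.irrefl E _ _ (Finset.mem_filter.1 this).2

theorem rank_lt_iff {x y : Fin n} : rank E y < rank E x ↔ Precedes E x y n := by
  refine ⟨fun h => ?_, rank_lt_of_precedes E⟩
  have hxy : (x : ℕ) ≠ y := fun hxy => h.ne (by rw [hxy])
  exact (Precedes.total E hxy).resolve_right fun h' => lt_asymm h (rank_lt_of_precedes E h')

theorem rank_injective : Function.Injective fun x : Fin n => rank E x := by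
  intro x y hxy
  by_contra hne
  rcases Precedes.total E (m := n) (fun h => hne (Fin.ext h)) with h | h
  · exact (rank_lt_of_precedes E h).ne' hxy
  · exact (rank_lt_of_precedes E h).ne hxy

theorem topDiff_le_iff {i k m D : ℕ} : topDiff E i k m ≤ D ↔
    ∀ u < m, indicator (E i) u ≠ indicator (E k) u → rank E u + 1 ≤ D := by
  induction m with
  | zero => simp [topDiff]
  | succ m ih =>
    have hsplit : (∀ u < m + 1, indicator (E i) u ≠ indicator (E k) u → rank E u + 1 ≤ D) ↔
        (∀ u < m, indicator (E i) u ≠ indicator (E k) u → rank E u + 1 ≤ D) ∧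
          (indicator (E i) m ≠ indicator (E k) m → rank E m + 1 ≤ D) := by
      refine ⟨fun h => ⟨fun u hu => h u (by omega), h m (by omega)⟩, fun h u hu => ?_⟩
      rcases Nat.lt_succ_iff_lt_or_eq.1 hu with h1 | rfl
      · exact h.1 u h1
      · exact h.2
    rw [hsplit, ← ih, topDiff]
    by_cases h : indicator (E i) m = indicator (E k) m
    · simp [h]
    · rw [if_neg h]
      simp only [Nat.sub_zero, one_mul, ne_eq, h, not_false_eq_true, true_imp_iff]
      omega

theorem topDiff_le_iff' {i k D : ℕ} : topDiff E i k n ≤ D ↔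
    ∀ u : Fin n, D ≤ rank E u → (u ∈ E i ↔ u ∈ E k) := by
  have hind : ∀ u : Fin n,
      indicator (E i) u = indicator (E k) u ↔ (u ∈ E i ↔ u ∈ E k) := by
    intro u
    rw [indicator_coe, indicator_coe]
    by_cases h1 : u ∈ E i <;> by_cases h2 : u ∈ E k <;> simp [h1, h2]
  rw [topDiff_le_iff]
  constructor
  · intro h u hu
    by_contra hcon
    have := h u u.2 (fun h => hcon ((hind u).1 h))
    omega
  · intro h u hu hne
    by_contra hcon
    exact hne ((hind ⟨u, hu⟩).2 (h ⟨u, hu⟩ (by simp only; omega)))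

theorem topDiff_eq_iff {i k : ℕ} {j : Fin n} (hj : j ∈ E i) : topDiff E i k n = rank E j + 1 ↔
    j ∉ E k ∧ ∀ u : Fin n, rank E j < rank E u → (u ∈ E k ↔ u ∈ E i) := by
  have h1 := topDiff_le_iff' E (i := i) (k := k) (D := rank E j + 1)
  have h2 := topDiff_le_iff' E (i := i) (k := k) (D := rank E j)
  constructor
  · intro h
    have h1' := h1.1 h.le
    refine ⟨fun hjk => ?_, fun u hu => (h1' u hu).symm⟩
    have := h2.2 fun u hu => by
      rcases hu.lt_or_eq with h3 | h3
      · exact h1' u h3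
      · have : j = u := rank_injective E h3
        subst this
        exact ⟨fun _ => hjk, fun _ => hj⟩
    omega
  · rintro ⟨hjk, h⟩
    have h3 := h1.2 fun u hu => (h u hu).symm
    have h4 : ¬ topDiff E i k n ≤ rank E j := fun h4 => hjk ((h2.1 h4 j le_rfl).1 hj)
    omega

variable {f : Finset (Fin n) → Prop}

/-- The hypotheses under which the enumeration is correct: `f` is monotone with total strength
preorder, and `E` lists true points, among them all the minimal ones. -/
structure Correct (f : Finset (Fin n) → Prop) : Prop where
  mono : ∀ A B, f A → A ⊆ B → f B
  univ : f Finset.univ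
  total : ∀ x y, Stronger f x y ∨ Stronger f y x
  true_point : ∀ i < n, f (E i)
  exists_eq : ∀ F, Minimal f F → ∃ i < n, E i = F

variable {E}

theorem Correct.minimal (h : Correct E f) {i : ℕ} (hi : i < n) (hk : discard E i = 0) :
    Minimal f (E i) := by
  refine ⟨h.true_point i hi, fun F hF hle => ?_⟩
  obtain ⟨F', hF'F, hF'⟩ := exists_minimal_subset hF
  obtain ⟨k, hkn, rfl⟩ := h.exists_eq F' hF'
  exact ((discard_eq_zero_iff E).1 hk k hkn (hF'F.trans hle)).1.trans hF'F

theorem Correct.exists_kept (h : Correct E f) {F : Finset (Fin n)} (hF : Minimal f F) :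
    ∃ i < n, discard E i = 0 ∧ E i = F := by
  have hex := h.exists_eq F hF
  classical
  obtain ⟨hi, hiF⟩ := Nat.find_spec hex
  refine ⟨Nat.find hex, hi, (discard_eq_zero_iff E).2 fun k hk hsub => ?_, hiF⟩
  rw [hiF] at hsub ⊢
  have hle := hF.2 (h.true_point k hk) hsub
  exact ⟨hle, Nat.find_min' hex ⟨hk, Finset.Subset.antisymm hsub hle⟩⟩

theorem eq_of_kept {i k : ℕ} (hi : i < n) (hk : k < n) (hi' : discard E i = 0)
    (hk' : discard E k = 0) (heq : E i = E k) : i = k := by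
  have h1 := ((discard_eq_zero_iff E).1 hi' k hk heq.ge).2
  have h2 := ((discard_eq_zero_iff E).1 hk' i hi heq.le).2
  omega

theorem Correct.count_eq (h : Correct E f) {k : ℕ} (hk : k < n) (x : Fin n) :
    count E k x = winderCount f (n - k) x := by
  classical
  have hterm : ∀ i : Fin n, (1 - discard E i) * (if cosize E i = k then 1 else 0) *
      indicator (E i) x =
      if discard E i = 0 ∧ (E i).card = n - k ∧ x ∈ E i then 1 else 0 := by
    intro i
    have hc : cosize E i = k ↔ (E i).card = n - k := by
      have := Finset.card_le_univ (E i)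
      rw [Fintype.card_fin] at this
      rw [cosize_eq]
      omega
    rw [indicator_coe]
    by_cases h1 : discard E i = 0
    · by_cases h2 : cosize E i = k <;> by_cases h3 : x ∈ E i <;> simp [h1, h2, h3, ← hc]
    · have : 1 - discard E i = 0 := by omega
      simp [h1, this]
  rw [count, Finset.sum_range]
  simp only [hterm, Finset.sum_boole, Nat.cast_id]
  refine Finset.card_bij (fun i _ => E i) ?_ ?_ ?_
  · intro i hi
    simp only [Finset.mem_filter, Finset.mem_univ, true_and] at hi ⊢
    exact ⟨h.minimal i.2 hi.1, hi.2⟩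
  · intro i hi i' hi' heq
    simp only [Finset.mem_filter, Finset.mem_univ, true_and] at hi hi'
    exact Fin.ext (eq_of_kept i.2 i'.2 hi.1 hi'.1 heq)
  · intro F hF
    simp only [Finset.mem_filter, Finset.mem_univ, true_and] at hF
    obtain ⟨i, hi, hi', rfl⟩ := h.exists_kept hF.1
    exact ⟨⟨i, hi⟩, by simpa using ⟨hi', hF.2⟩, rfl⟩

theorem Correct.stronger (h : Correct E f) (x y : Fin n) (hxy : rank E y ≤ rank E x) :
    Stronger f x y := by
  rcases hxy.lt_or_eq with hlt | heq
  swap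
  · have : y = x := rank_injective E heq
    subst this
    exact fun B _ h1 h2 => absurd h1 h2
  have hprec := (rank_lt_iff E).1 hlt
  have hzero : ∀ s, ¬ (0 < s ∧ s ≤ n) → ∀ x, winderCount f s x = 0 := by
    classical
    intro s hs x
    rw [winderCount, Finset.card_eq_zero, Finset.filter_eq_empty_iff]
    rintro F - ⟨-, hcard, hx⟩
    have h1 := Finset.card_le_univ F
    rw [Fintype.card_fin] at h1
    have h2 := Finset.card_pos.2 ⟨x, hx⟩
    omega
  have heq : ∀ s, (0 < s → s ≤ n → count E (n - s) x = count E (n - s) y) →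
      winderCount f s x = winderCount f s y := by
    intro s hs
    by_cases h1 : 0 < s ∧ s ≤ n
    · have := hs h1.1 h1.2
      rw [h.count_eq (by omega), h.count_eq (by omega)] at this
      rwa [show n - (n - s) = s by omega] at this
    · rw [hzero s h1, hzero s h1]
  refine stronger_of_winderCount h.mono (h.total x y) ?_
  rcases hprec.exists_count E with hall | ⟨k, hk, hcount, hall⟩
  · exact Or.inl fun s => heq s fun h1 h2 => hall _ (by omega)
  · refine Or.inr ⟨n - k, ?_, fun s hs => heq s fun h1 h2 => hall _ (by omega) (by omega)⟩
    rwa [h.count_eq hk, h.count_eq hk] at hcount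

theorem skip_eq_zero_iff {i : ℕ} {j : Fin n} (hj : j ∈ E i) :
    skip E i j = 0 ↔ ∀ k < n, discard E k = 0 →
      (j ∉ E k → ¬ ∀ u : Fin n, rank E j < rank E u → (u ∈ E k ↔ u ∈ E i)) ∧
      (k < i → ¬ ∀ u : Fin n, rank E j ≤ rank E u → (u ∈ E i ↔ u ∈ E k)) := by
  rw [skip, Finset.sum_eq_zero_iff]
  simp only [Finset.mem_range]
  refine forall₂_congr fun k _ => ?_
  rw [← topDiff_le_iff' E, ← not_and, ← topDiff_eq_iff E hj]
  by_cases h1 : discard E k = 0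
  · simp only [h1, Nat.sub_zero, one_mul, true_imp_iff]
    split_ifs <;> constructor <;> intro h <;> first | exact h.elim | omega
  · have : 1 - discard E k = 0 := by omega
    simp [this, h1]

theorem valid_eq_zero_or_one (i j : ℕ) : valid E i j = 0 ∨ valid E i j = 1 := by
  have h1 := indicator_le_one (E i) j
  unfold valid
  rcases Nat.le_one_iff_eq_zero_or_eq_one.1 (show 1 - discard E i ≤ 1 by omega) with h2 | h2 <;>
  rcases Nat.le_one_iff_eq_zero_or_eq_one.1 h1 with h3 | h3 <;>
  rcases Nat.le_one_iff_eq_zero_or_eq_one.1 (show 1 - skip E i j ≤ 1 by omega) with h4 | h4 <;>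
  simp [h2, h3, h4]

theorem valid_eq_one_iff {i : ℕ} {j : Fin n} :
    valid E i j = 1 ↔ discard E i = 0 ∧ j ∈ E i ∧ skip E i j = 0 := by
  rw [valid, mul_eq_one, mul_eq_one, indicator_coe]
  by_cases h : j ∈ E i
  · simp only [h, if_true, true_and, and_true]
    omega
  · simp [h]

/-- The pairs selected by `valid` enumerate the minimal sets that meet all true points, each
once. -/
theorem Correct.bijOn (h : Correct E f) :
    Set.BijOn (fun p : Fin n × Fin n => transversal (fun x : Fin n => rank E x) (E p.1) p.2)
      {p | valid E p.1 p.2 = 1} {D | Minimal (fun D => ¬ f Dᶜ) D} := by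
  have hinj := rank_injective E
  refine ⟨?_, ?_, ?_⟩
  · rintro ⟨i, j⟩ hp
    obtain ⟨hi, hj, hs⟩ := valid_eq_one_iff.1 hp
    refine minimal_transversal_of_branches hinj h.mono h.stronger (h.minimal i.2 hi)
      ⟨hj, fun F hF hagree => ?_⟩
    obtain ⟨k, hk, hk', rfl⟩ := h.exists_kept hF
    by_contra hjk
    exact ((skip_eq_zero_iff hj).1 hs k hk hk').1 hjk hagree
  · rintro ⟨i, j⟩ hp ⟨i', j'⟩ hp' heq
    obtain ⟨hi, hj, hs⟩ := valid_eq_one_iff.1 hp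
    obtain ⟨hi', hj', hs'⟩ := valid_eq_one_iff.1 hp'
    obtain ⟨hjj, hagree⟩ := (transversal_eq_transversal_iff hinj).1 heq
    simp only at hi hj hs hi' hj' hs' hjj hagree
    subst hjj
    have hagree' : ∀ u : Fin n, rank E j ≤ rank E u → (u ∈ E i ↔ u ∈ E i') := by
      intro u hu
      rcases hu.lt_or_eq with h1 | h1
      · exact hagree u h1
      · have : j = u := hinj h1
        subst this
        exact ⟨fun _ => hj', fun _ => hj⟩
    rcases lt_trichotomy i i' with h1 | h1 | h1
    · exact absurd (fun u hu => (hagree' u hu).symm)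
        (((skip_eq_zero_iff hj').1 hs' i i.2 hi).2 h1)
    · rw [h1]
    · exact absurd hagree' (((skip_eq_zero_iff hj).1 hs i' i'.2 hi').2 h1)
  · intro D hD
    replace hD : Minimal (fun D => ¬ f Dᶜ) D := hD
    obtain ⟨F, hF, j, hjF, rfl⟩ := exists_eq_transversal h.mono h.univ h.stronger hD
    -- the first set that agrees with `F` down to `j`
    have hex : ∃ i, i < n ∧ discard E i = 0 ∧
        ∀ u : Fin n, rank E j ≤ rank E u → (u ∈ E i ↔ u ∈ F) := by
      obtain ⟨i, hi, hi', rfl⟩ := h.exists_kept hF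
      exact ⟨i, hi, hi', fun _ _ => Iff.rfl⟩
    classical
    obtain ⟨hi, hi', hagree⟩ := Nat.find_spec hex
    have hmin := fun k => Nat.find_min' hex (m := k)
    generalize Nat.find hex = i at *
    have hj : j ∈ E i := (hagree j le_rfl).2 hjF
    have heq : transversal (fun x : Fin n => rank E x) (E i) j =
        transversal (fun x : Fin n => rank E x) F j :=
      (transversal_eq_transversal_iff hinj).2 ⟨rfl, fun u hu => hagree u hu.le⟩
    refine ⟨(⟨i, hi⟩, j), valid_eq_one_iff.2 ⟨hi', hj, ?_⟩, heq⟩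
    rw [skip_eq_zero_iff hj]
    refine fun k hk hk' => ⟨fun hjk hag => hjk ?_, fun hki hag => ?_⟩
    · have hbr := branches_of_minimal_transversal hinj h.mono hj (heq ▸ hD.prop)
      exact hbr.2 _ (h.minimal hk hk') hag
    · have := hmin k ⟨hk, hk', fun u hu => (hag u hu).symm.trans (hagree u hu)⟩
      omega

end Enumeration

/-! ### Elimination by deficiencies -/

section Elimination

variable {n : ℕ}

open Classical in
/-- The adjacency matrix of `G`, extended by 0. -/
noncomputable def adjNat (G : SimpleGraph (Fin n)) (u v : ℕ) : ℕ :=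
  if ∃ (hu : u < n) (hv : v < n), G.Adj ⟨u, hu⟩ ⟨v, hv⟩ then 1 else 0

open Classical in
theorem adjNat_coe (G : SimpleGraph (Fin n)) (u v : Fin n) :
    adjNat G u v = if G.Adj u v then 1 else 0 := by
  simp [adjNat]

theorem adjNat_le_one (G : SimpleGraph (Fin n)) (u v : ℕ) : adjNat G u v ≤ 1 := by
  unfold adjNat
  split_ifs <;> simp

theorem adjNat_comm (G : SimpleGraph (Fin n)) (u v : ℕ) : adjNat G u v = adjNat G v u := by
  classical
  unfold adjNat
  refine if_congr ?_ rfl rfl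
  exact ⟨fun ⟨hu, hv, h⟩ => ⟨hv, hu, h.symm⟩, fun ⟨hu, hv, h⟩ => ⟨hv, hu, h.symm⟩⟩

/-- 1 if `a` and `c` are distinct non-adjacent neighbours of `u`, and 0 otherwise. -/
noncomputable def openPair (G : SimpleGraph (Fin n)) (u a c : ℕ) : ℕ :=
  adjNat G u a * adjNat G u c * (1 - adjNat G a c) * (1 - if a = c then 1 else 0)

theorem openPair_le_one (G : SimpleGraph (Fin n)) (u a c : ℕ) : openPair G u a c ≤ 1 := by
  have h1 := adjNat_le_one G u a
  have h2 := adjNat_le_one G u c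
  unfold openPair
  calc _ ≤ 1 * 1 * 1 * 1 := by
        gcongr
        · omega
        · omega
    _ = 1 := by norm_num

theorem openPair_comm (G : SimpleGraph (Fin n)) (u a c : ℕ) :
    openPair G u a c = openPair G u c a := by
  unfold openPair
  rw [adjNat_comm G a c, mul_comm (adjNat G u a)]
  simp only [eq_comm]

theorem openPair_self (G : SimpleGraph (Fin n)) (u a : ℕ) : openPair G u a a = 0 := by
  simp [openPair]

/-- The number of ordered pairs of distinct non-adjacent neighbours of `u` in `R`. -/
noncomputable def deficiency (G : SimpleGraph (Fin n)) (R : Finset (Fin n)) (u : ℕ) : ℕ :=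
  ∑ a ∈ Finset.range n, ∑ c ∈ Finset.range n,
    indicator R a * indicator R c * openPair G u a c

theorem deficiency_univ (G : SimpleGraph (Fin n)) (u : ℕ) : deficiency G Finset.univ u =
    ∑ a ∈ Finset.range n, ∑ c ∈ Finset.range n, openPair G u a c := by
  have hone : ∀ a ∈ Finset.range n, indicator (Finset.univ : Finset (Fin n)) a = 1 := by
    intro a ha
    simp [indicator, Finset.mem_range.1 ha]
  refine Finset.sum_congr rfl fun a ha => Finset.sum_congr rfl fun c hc => ?_
  rw [hone a ha, hone c hc, one_mul, one_mul]

theorem deficiency_le (G : SimpleGraph (Fin n)) (R : Finset (Fin n)) (u : ℕ) :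
    deficiency G R u ≤ n * n := by
  calc deficiency G R u ≤ ∑ _a ∈ Finset.range n, ∑ _c ∈ Finset.range n, 1 :=
        Finset.sum_le_sum fun a _ => Finset.sum_le_sum fun c _ =>
          (Nat.mul_le_mul (Nat.mul_le_mul (indicator_le_one R a) (indicator_le_one R c))
            (openPair_le_one G u a c)).trans (by norm_num)
    _ = n * n := by simp

theorem indicator_erase (R : Finset (Fin n)) {v : Fin n} (hv : v ∈ R) (u : ℕ) :
    indicator R u = indicator (R.erase v) u + if u = v then 1 else 0 := by
  unfold indicator
  by_cases hu : u < n
  · by_cases huv : u = v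
    · subst huv
      simp [hv]
    · have : (⟨u, hu⟩ : Fin n) ≠ v := fun h => huv (congrArg Fin.val h)
      simp [hu, huv, this]
  · have : u ≠ v := fun h => hu (h ▸ v.2)
    simp [hu, this]

theorem deficiency_erase (G : SimpleGraph (Fin n)) (R : Finset (Fin n)) {v : Fin n} (hv : v ∈ R)
    (u : ℕ) : deficiency G (R.erase v) u =
      deficiency G R u - ∑ c ∈ Finset.range n, 2 * (indicator R c * openPair G u v c) := by
  set x := indicator (R.erase v) with hx
  set p := openPair G u with hp
  have hvn := Finset.mem_range.2 v.2
  have hcross : ∑ c ∈ Finset.range n, indicator R c * p v c =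
      ∑ c ∈ Finset.range n, x c * p v c := by
    simp only [indicator_erase R hv, add_mul, Finset.sum_add_distrib, ite_mul, one_mul, zero_mul]
    rw [Finset.sum_ite_eq' (Finset.range n) (v : ℕ), if_pos hvn, hp, openPair_self, add_zero]
  have hsplit : deficiency G R u = deficiency G (R.erase v) u +
      ∑ c ∈ Finset.range n, x c * p v c + ∑ a ∈ Finset.range n, x a * p a v := by
    have hin : ∀ a, ∑ c ∈ Finset.range n, indicator R a * indicator R c * p a c =
        indicator R a * (∑ c ∈ Finset.range n, x c * p a c + p a v) := by
      intro a
      simp only [mul_assoc]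
      rw [← Finset.mul_sum]
      simp only [indicator_erase R hv, add_mul, Finset.sum_add_distrib, ite_mul, one_mul, zero_mul]
      rw [Finset.sum_ite_eq' (Finset.range n) (v : ℕ), if_pos hvn]
    rw [deficiency, Finset.sum_congr rfl fun a _ => hin a]
    simp only [indicator_erase R hv, add_mul, Finset.sum_add_distrib, ite_mul, one_mul, zero_mul]
    rw [Finset.sum_ite_eq' (Finset.range n) (v : ℕ), if_pos hvn]
    have hvv : p v v = 0 := openPair_self G u v
    simp only [deficiency, mul_add, Finset.sum_add_distrib, Finset.mul_sum, mul_assoc, hvv,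
      ← hx, ← hp]
    omega
  have hsym : ∑ a ∈ Finset.range n, x a * p a v = ∑ c ∈ Finset.range n, x c * p v c :=
    Finset.sum_congr rfl fun a _ => by rw [hp, openPair_comm]
  rw [← Finset.mul_sum, hcross, hsplit, hsym]
  omega

theorem isSimplicialIn_iff_deficiency (G : SimpleGraph (Fin n)) (R : Finset (Fin n)) {u : Fin n}
    (hu : u ∈ R) : IsSimplicialIn G R u ↔ deficiency G R u = 0 := by
  classical
  rw [deficiency, Finset.sum_range, Finset.sum_eq_zero_iff]
  simp only [Finset.mem_univ, true_imp_iff, IsSimplicialIn, hu, true_and]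
  refine forall_congr' fun a => ?_
  rw [Finset.sum_range, Finset.sum_eq_zero_iff]
  simp only [Finset.mem_univ, true_imp_iff]
  rw [← forall_comm]
  refine forall_congr' fun c => ?_
  simp only [openPair, indicator_coe, adjNat_coe, Fin.val_inj]
  by_cases h1 : a ∈ R <;> by_cases h2 : c ∈ R <;> by_cases h3 : G.Adj u a <;>
    by_cases h4 : G.Adj u c <;> by_cases h5 : a = c <;> by_cases h6 : G.Adj a c <;>
    simp [h1, h2, h3, h4, h5, h6]

/-- The largest `u < k` in `R` of deficiency 0, or 0 if there is none. -/
noncomputable def pickIndex (G : SimpleGraph (Fin n)) (R : Finset (Fin n)) : ℕ → ℕ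
  | 0 => 0
  | k + 1 => (indicator R k * if deficiency G R k = 0 then 1 else 0) * k +
      (1 - indicator R k * if deficiency G R k = 0 then 1 else 0) * pickIndex G R k

theorem pickIndex_eq (G : SimpleGraph (Fin n)) (R : Finset (Fin n)) (k : ℕ) :
    pickIndex G R (k + 1) =
      if indicator R k = 1 ∧ deficiency G R k = 0 then k else pickIndex G R k := by
  rw [pickIndex]
  rcases Nat.le_one_iff_eq_zero_or_eq_one.1 (indicator_le_one R k) with h | h <;>
    by_cases hd : deficiency G R k = 0 <;> simp [h, hd]

theorem pickIndex_lt (G : SimpleGraph (Fin n)) (R : Finset (Fin n)) (hn : 0 < n) {k : ℕ}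
    (hk : k ≤ n) : pickIndex G R k < n := by
  induction k with
  | zero => exact hn
  | succ k ih =>
    rw [pickIndex_eq]
    split_ifs
    · omega
    · exact ih (by omega)

theorem pickIndex_spec (G : SimpleGraph (Fin n)) (R : Finset (Fin n)) {k u : ℕ} (hu : u < k)
    (h1 : indicator R u = 1) (h2 : deficiency G R u = 0) :
    indicator R (pickIndex G R k) = 1 ∧ deficiency G R (pickIndex G R k) = 0 := by
  induction k with
  | zero => omega
  | succ k ih =>
    rw [pickIndex_eq]
    split_ifs with h
    · exact h
    · rcases Nat.lt_succ_iff_lt_or_eq.1 hu with h' | rfl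
      · exact ih h'
      · exact absurd ⟨h1, h2⟩ h

/-- The vertex deleted by the algorithm when the vertices in `R` remain. -/
noncomputable def pickVertex (G : SimpleGraph (Fin n)) (hn : 0 < n) (R : Finset (Fin n)) : Fin n :=
  ⟨pickIndex G R n, pickIndex_lt G R hn le_rfl⟩

theorem isSimplicialIn_pickVertex {G : SimpleGraph (Fin n)} (hG : IsChordalGraph G) (hn : 0 < n)
    (R : Finset (Fin n)) (hR : R.Nonempty) : IsSimplicialIn G R (pickVertex G hn R) := by
  obtain ⟨u, hu⟩ := hG.exists_simplicial hR
  have h := pickIndex_spec G R (k := n) u.2 (by simp [indicator_coe, hu.1])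
    ((isSimplicialIn_iff_deficiency G R hu.1).1 hu)
  have hmem : pickVertex G hn R ∈ R := by
    have h1 : indicator R (pickVertex G hn R) = 1 := h.1
    by_contra hcon
    rw [indicator_coe, if_neg hcon] at h1
    omega
  exact (isSimplicialIn_iff_deficiency G R hmem).2 h.2

/-- The remaining vertices that are not adjacent to the deleted vertex `v`, among them `v` itself,
decide which candidate cutset the elimination produces. -/
theorem indicator_elimCut {G : SimpleGraph (Fin n)} {pick : Finset (Fin n) → Fin n} {i : ℕ}
    (hv : pick (elimSet pick i) ∈ elimSet pick i) (j : Fin n) {b : ℕ}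
    (hb : b = 1 - (∑ u ∈ Finset.range n,
      indicator (elimSet pick i) u * (1 - adjNat G (pick (elimSet pick i)) u) - 1)) :
    indicator (elimSet pick i) j * adjNat G (pick (elimSet pick i)) j * (1 - b) + b =
      indicator (elimCut G pick i) j := by
  classical
  generalize hR : elimSet pick i = R at *
  generalize hw : pick R = v at *
  have hcount : ∑ u ∈ Finset.range n, indicator R u * (1 - adjNat G v u) =
      (R.filter fun u => ¬ G.Adj v u).card := by
    rw [Finset.sum_range, ← Finset.filter_univ_mem R, Finset.filter_filter, Finset.card_filter]
    refine Finset.sum_congr rfl fun u _ => ?_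
    rw [indicator_coe, adjNat_coe]
    by_cases h1 : u ∈ R <;> by_cases h2 : G.Adj v u <;> simp [h1, h2]
  have hvmem : v ∈ R.filter fun u => ¬ G.Adj v u := by simp [hv]
  rw [hcount] at hb
  rw [indicator_coe, indicator_coe, adjNat_coe, elimCut, hR, hw]
  by_cases h : ∃ u ∈ R, u ≠ v ∧ ¬ G.Adj v u
  · have hcard : 1 < (R.filter fun u => ¬ G.Adj v u).card := by
      obtain ⟨u, hu, huv, hvu⟩ := h
      exact Finset.one_lt_card.2 ⟨u, by simp [hu, hvu], v, hvmem, huv⟩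
    have hb0 : b = 0 := by omega
    rw [if_pos h, hb0]
    simp only [mem_neighborsIn]
    by_cases h1 : j ∈ R <;> by_cases h2 : G.Adj v j <;> simp [h1, h2]
  · have hcard : (R.filter fun u => ¬ G.Adj v u).card ≤ 1 := by
      rw [Finset.card_le_one]
      intro a ha c hc
      push Not at h
      rw [Finset.mem_filter] at ha hc
      have h1 : a = v := by
        by_contra hav
        exact ha.2 (h a ha.1 hav)
      have h2 : c = v := by
        by_contra hav
        exact hc.2 (h c hc.1 hav)
      rw [h1, h2]
    have hb1 : b = 1 := by omega
    rw [if_neg h, hb1]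
    simp

end Elimination

/-! ### The enumeration program -/

namespace RAM

/-- The cell in row `x` and column `y` of array `a`. -/
def cell (a : ℕ) (x y : Expr) : Expr := .arr a (.add (.mul x (.reg 0)) y)

@[simp] theorem eval_cell (s : Memory) (a : ℕ) (x y : Expr) :
    (cell a x y).eval s = s.arr a (x.eval s * s.reg 0 + y.eval s) := rfl

/-- The row index of a table. -/
abbrev regI : Expr := .reg 2

/-- The column index of a table. -/
abbrev regJ : Expr := .reg 3

/-- The accumulator of a row computation. -/
abbrev regAcc : Expr := .reg 4

/-- The running index of a row computation. -/
abbrev regK : Expr := .reg 5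

/-- The table of the numbers of non-adjacent pairs of neighbours of `i` that contain `j`. -/
def openPairTable : Program :=
  sumTable 7 (.mul (.mul (.mul (cell 0 regI regJ) (cell 0 regI regK))
    (.notE (cell 0 regJ regK))) (.notE (.eqE regJ regK)))

/-- Marks all vertices as remaining. -/
def initAlive : Program := row 2 (.const 0) (.const 1) regAcc

/-- The deficiencies before the elimination. -/
def initDeficiency : Program :=
  row 3 (.const 0) (.const 0) (.add regAcc (cell 7 regJ regK))

/-- Fills row `i` of array 4 with the vertex deleted in step `i`. -/
def pickRow : Program :=
  row 4 (.mul regI (.reg 0)) (.const 0)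
    (.add (.mul (.mul (cell 2 regI regK) (.eqE (cell 3 regI regK) (.const 0))) regK)
      (.mul (.notE (.mul (cell 2 regI regK) (.eqE (cell 3 regI regK) (.const 0)))) regAcc))

/-- Counts the remaining vertices that are not adjacent to the deleted one. -/
def othersRow : Program :=
  row 5 (.mul regI (.reg 0)) (.const 0)
    (.add regAcc (.mul (cell 2 regI regK) (.notE (cell 0 (cell 4 regI regJ) regK))))

/-- The candidate cutset of step `i`. -/
def cutRow : Program :=
  row 6 (.mul regI (.reg 0))
    (.add (.mul (.mul (cell 2 regI regJ) (cell 0 (cell 4 regI regJ) regJ))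
      (.notE (.notE (.sub (cell 5 regI regJ) (.const 1)))))
      (.notE (.sub (cell 5 regI regJ) (.const 1)))) regAcc

/-- The vertices that remain after step `i`. -/
def aliveRow : Program :=
  row 2 (.mul (.add regI (.const 1)) (.reg 0))
    (.sub (cell 2 regI regJ) (.eqE regJ (cell 4 regI regJ))) regAcc

/-- The deficiencies after step `i`. -/
def deficiencyRow : Program :=
  row 3 (.mul (.add regI (.const 1)) (.reg 0)) (cell 3 regI regJ)
    (.sub regAcc (.mul (.const 2) (.mul (cell 2 regI regK)
      (.mul (.mul (.mul (cell 0 regJ (cell 4 regI regJ)) (cell 0 regJ regK))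
        (.notE (cell 0 (cell 4 regI regJ) regK))) (.notE (.eqE (cell 4 regI regJ) regK))))))

/-- One step of the elimination. -/
def elimStep : Program :=
  .seq pickRow (.seq othersRow (.seq cutRow (.seq deficiencyRow aliveRow)))

/-- The table of `Enumeration.excess`. -/
def excessTable : Program := sumTable 8 (.mul (cell 6 regI regK) (.notE (cell 6 regJ regK)))

/-- The table of `Enumeration.discard`. -/
def discardTable : Program :=
  sumTable 9 (.mul (.eqE (cell 8 regK regI) (.const 0))
    (.add (.ltE (.const 0) (cell 8 regI regK)) (.ltE regK regI)))

/-- The table of `Enumeration.cosize`. -/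
def cosizeTable : Program := sumTable 10 (.notE (cell 6 regI regK))

/-- The table of `Enumeration.count`. -/
def countTable : Program :=
  sumTable 11 (.mul (.mul (.notE (cell 9 regK (.const 0))) (.eqE (cell 10 regK (.const 0)) regI))
    (cell 6 regK regJ))

/-- The table of `Enumeration.lexi`. -/
def lexiTable : Program :=
  table 12 (.ltE regI regJ) (.add (.ltE (cell 11 regK regJ) (cell 11 regK regI))
    (.mul (.eqE (cell 11 regK regI) (cell 11 regK regJ)) regAcc))

/-- The table of `Enumeration.rank`. -/
def rankTable : Program := sumTable 13 (cell 12 regI regK)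

/-- The table of `Enumeration.topDiff`. -/
def topDiffTable : Program :=
  table 14 (.const 0) (.add regAcc (.sub
    (.mul (.notE (.eqE (cell 6 regI regK) (cell 6 regJ regK)))
      (.add (cell 13 regK (.const 0)) (.const 1))) regAcc))

/-- The table of `Enumeration.skip`. -/
def skipTable : Program :=
  sumTable 15 (.mul (.notE (cell 9 regK (.const 0)))
    (.add (.eqE (cell 14 regI regK) (.add (cell 13 regJ (.const 0)) (.const 1)))
      (.mul (.ltE regK regI)
        (.ltE (cell 14 regI regK) (.add (cell 13 regJ (.const 0)) (.const 1))))))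

/-- Writes the transversal of the pair `(i, j)` behind the output so far, and counts it if the pair
is valid; otherwise it is overwritten later. -/
def outputPair : Program :=
  .seq (forLoop 5 0 (.setArr 1 (.add (.mul (.reg 1) (.reg 0)) regK)
      (.add (.eqE regK regJ)
        (.mul (.notE (.ltE (cell 13 regK (.const 0)) (cell 13 regJ (.const 0))))
          (.notE (cell 6 regI regK))))))
    (.setReg 1 (.add (.reg 1) (.mul (.mul (.notE (cell 9 regI (.const 0))) (cell 6 regI regJ))
      (.notE (cell 15 regI regJ)))))

/-- Computes the tables of the enumeration from the sets in array 6, and continues with `p`. -/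
def enumerationTables (p : Program) : Program :=
  .seq excessTable (.seq discardTable (.seq cosizeTable (.seq countTable (.seq lexiTable
    (.seq rankTable (.seq topDiffTable (.seq skipTable p)))))))

/-- Lists the minimal connected dominating sets. -/
def enumerate : Program :=
  .seq openPairTable (.seq (.seq initAlive initDeficiency) (.seq (forLoop 2 0 elimStep)
    (enumerationTables (forLoop 2 0 (forLoop 3 0 outputPair)))))

variable {B n : ℕ}

theorem runs_openPairTable {G : SimpleGraph (Fin n)} {s : Memory} (h0 : s.reg 0 = n)
    (hB : n * n + n + n * 2 ≤ B) (hA : TableIs n s 0 (adjNat G)) :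
    Runs B openPairTable s (200 * (n + 1) ^ 3) fun s' => AgreeArr 7 s s' ∧
      TableIs n s' 7 fun i j => ∑ k ∈ Finset.range n, openPair G i j k := by
  refine (runs_sumTable (fun i j k => openPair G i j k) 1 h0 ?_
    (fun i _ j _ k _ => openPair_le_one G i j k) (by omega) (by omega)).mono
    (Nat.mul_le_mul_right _ (by decide)) fun _ h => h
  intro i hi j hj k hk s' hs r0 r2 r3 r5
  have hA' := hs.tableIs hA (by decide)
  simp only [Expr.eval, Expr.eval_notE, Expr.eval_eqE, eval_cell, r0, r2, r3, r5, hA' i hi j hj,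
    hA' i hi k hk, hA' j hj k hk, openPair]

theorem runs_excessTable {E : ℕ → Finset (Fin n)} {s : Memory} (h0 : s.reg 0 = n)
    (hB : n * n + n + n * 2 ≤ B) (h6 : TableIs n s 6 fun i => indicator (E i)) :
    Runs B excessTable s (200 * (n + 1) ^ 3) fun s' => AgreeArr 8 s s' ∧
      TableIs n s' 8 (Enumeration.excess E) := by
  refine (runs_sumTable (fun i j k => indicator (E i) k * (1 - indicator (E j) k)) 1 h0 ?_
    ?_ (by omega) (by omega)).mono (Nat.mul_le_mul_right _ (by decide)) fun _ h => h
  · intro i hi j hj k hk s' hs r0 r2 r3 r5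
    have h6' := hs.tableIs h6 (by decide)
    simp only [Expr.eval, Expr.eval_notE, eval_cell, r0, r2, r3, r5, h6' i hi k hk, h6' j hj k hk]
  · intro i _ j _ k _
    exact Nat.mul_le_mul (indicator_le_one _ _) (Nat.sub_le _ _)

theorem runs_discardTable {E : ℕ → Finset (Fin n)} {s : Memory} (h0 : s.reg 0 = n)
    (hB : n * n + n + n * 2 ≤ B) (h8 : TableIs n s 8 (Enumeration.excess E)) :
    Runs B discardTable s (200 * (n + 1) ^ 3) fun s' => AgreeArr 9 s s' ∧
      TableIs n s' 9 fun i _ => Enumeration.discard E i := by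
  refine (runs_sumTable (fun i _ k => (if Enumeration.excess E k i = 0 then 1 else 0) *
    ((if 0 < Enumeration.excess E i k then 1 else 0) + if k < i then 1 else 0)) 2 h0 ?_
    ?_ (by omega) (by omega)).mono (Nat.mul_le_mul_right _ (by decide)) fun _ h => h
  · intro i hi j hj k hk s' hs r0 r2 r3 r5
    have h8' := hs.tableIs h8 (by decide)
    simp only [Expr.eval, Expr.eval_eqE, Expr.eval_ltE, eval_cell, r0, r2, r5, h8' i hi k hk,
      h8' k hk i hi]
  · intro i _ j _ k _
    split_ifs <;> simp

theorem runs_cosizeTable {E : ℕ → Finset (Fin n)} {s : Memory} (h0 : s.reg 0 = n)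
    (hB : n * n + n + n * 2 ≤ B) (h6 : TableIs n s 6 fun i => indicator (E i)) :
    Runs B cosizeTable s (200 * (n + 1) ^ 3) fun s' => AgreeArr 10 s s' ∧
      TableIs n s' 10 fun i _ => Enumeration.cosize E i := by
  refine (runs_sumTable (fun i _ k => 1 - indicator (E i) k) 1 h0 ?_
    (fun i _ j _ k _ => Nat.sub_le _ _) (by omega) (by omega)).mono
    (Nat.mul_le_mul_right _ (by decide)) fun _ h => h
  intro i hi j hj k hk s' hs r0 r2 r3 r5
  have h6' := hs.tableIs h6 (by decide)
  simp only [Expr.eval, Expr.eval_notE, eval_cell, r0, r2, r5, h6' i hi k hk]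

theorem runs_countTable {E : ℕ → Finset (Fin n)} {s : Memory} (h0 : s.reg 0 = n)
    (hB : n * n + n + n * 2 ≤ B) (h6 : TableIs n s 6 fun i => indicator (E i))
    (h9 : TableIs n s 9 fun i _ => Enumeration.discard E i)
    (h10 : TableIs n s 10 fun i _ => Enumeration.cosize E i) :
    Runs B countTable s (200 * (n + 1) ^ 3) fun s' => AgreeArr 11 s s' ∧
      TableIs n s' 11 (Enumeration.count E) := by
  refine (runs_sumTable (fun i j k => (1 - Enumeration.discard E k) *
    (if Enumeration.cosize E k = i then 1 else 0) * indicator (E k) j) 1 h0 ?_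
    ?_ (by omega) (by omega)).mono (Nat.mul_le_mul_right _ (by decide)) fun _ h => h
  · intro i hi j hj k hk s' hs r0 r2 r3 r5
    have h6' := hs.tableIs h6 (by decide)
    have h9' := hs.tableIs h9 (by decide)
    have h10' := hs.tableIs h10 (by decide)
    simp only [Expr.eval, Expr.eval_notE, Expr.eval_eqE, eval_cell, r0, r2, r3, r5, h6' k hk j hj,
      h9' k hk 0 (by omega), h10' k hk 0 (by omega)]
  · intro i _ j _ k _
    exact Nat.mul_le_mul (Nat.mul_le_mul (Nat.sub_le 1 _) (show _ ≤ 1 by split_ifs <;> simp))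
      (indicator_le_one _ _)

theorem runs_lexiTable {E : ℕ → Finset (Fin n)} {s : Memory} (h0 : s.reg 0 = n)
    (hB : n * n + n + n * 2 ≤ B) (h11 : TableIs n s 11 (Enumeration.count E)) :
    Runs B lexiTable s (200 * (n + 1) ^ 3) fun s' => AgreeArr 12 s s' ∧
      TableIs n s' 12 fun x y => Enumeration.lexi E x y n := by
  refine (runs_table (fun i j k => Enumeration.lexi E i j k) h0 ?_ ?_ ?_ (by omega)).mono
    (Nat.mul_le_mul_right _ (by decide)) fun _ h => h
  · intro i hi j hj s' hs r2 r3
    simp only [Expr.eval_ltE, Expr.eval, r2, r3, Enumeration.lexi]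
  · intro i hi j hj k hk s' hs r2 r3 r5 r4
    have h11' := hs.tableIs h11 (by decide)
    have r0 := (hs.reg 0 (by omega)).trans h0
    simp only [Expr.eval, Expr.eval_eqE, Expr.eval_ltE, eval_cell, r0, r2, r3, r4, r5,
      h11' k hk i hi, h11' k hk j hj, Enumeration.lexi]
  · intro i hi j hj k hk
    classical
    rw [Enumeration.lexi_eq]
    split_ifs <;> omega

theorem runs_rankTable {E : ℕ → Finset (Fin n)} {s : Memory} (h0 : s.reg 0 = n)
    (hB : n * n + n + n * 2 ≤ B) (h12 : TableIs n s 12 fun x y => Enumeration.lexi E x y n) :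
    Runs B rankTable s (200 * (n + 1) ^ 3) fun s' => AgreeArr 13 s s' ∧
      TableIs n s' 13 fun x _ => Enumeration.rank E x := by
  refine (runs_sumTable (fun i _ k => Enumeration.lexi E i k n) 1 h0 ?_
    ?_ (by omega) (by omega)).mono (Nat.mul_le_mul_right _ (by decide)) fun _ h => h
  · intro i hi j hj k hk s' hs r0 r2 r3 r5
    have h12' := hs.tableIs h12 (by decide)
    simp only [Expr.eval, eval_cell, r0, r2, r5, h12' i hi k hk]
  · intro i _ j _ k _
    classical
    rw [Enumeration.lexi_eq]
    split_ifs <;> omega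

theorem rank_le (E : ℕ → Finset (Fin n)) (x : ℕ) : Enumeration.rank E x ≤ n := by
  classical
  rw [Enumeration.rank_eq]
  exact (Finset.card_le_univ _).trans (by simp)

theorem runs_topDiffTable {E : ℕ → Finset (Fin n)} {s : Memory} (h0 : s.reg 0 = n)
    (hB : n * n + n + n * 2 ≤ B) (h6 : TableIs n s 6 fun i => indicator (E i))
    (h13 : TableIs n s 13 fun x _ => Enumeration.rank E x) :
    Runs B topDiffTable s (200 * (n + 1) ^ 3) fun s' => AgreeArr 14 s s' ∧
      TableIs n s' 14 fun i k => Enumeration.topDiff E i k n := by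
  refine (runs_table (fun i j k => Enumeration.topDiff E i j k) h0 ?_ ?_ ?_ (by omega)).mono
    (Nat.mul_le_mul_right _ (by decide)) fun _ h => h
  · intro i hi j hj s' hs r2 r3
    rfl
  · intro i hi j hj k hk s' hs r2 r3 r5 r4
    have h6' := hs.tableIs h6 (by decide)
    have h13' := hs.tableIs h13 (by decide)
    have r0 := (hs.reg 0 (by omega)).trans h0
    simp only [Expr.eval, Expr.eval_eqE, Expr.eval_notE, eval_cell, r0, r2, r3, r4, r5,
      h6' i hi k hk, h6' j hj k hk, h13' k hk 0 (by omega), Enumeration.topDiff]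
  · intro i hi j hj k hk
    refine le_trans (b := n + 1) ?_ (by nlinarith)
    rw [Enumeration.topDiff_le_iff]
    intro u _ _
    have := rank_le E u
    omega

theorem runs_skipTable {E : ℕ → Finset (Fin n)} {s : Memory} (h0 : s.reg 0 = n)
    (hB : n * n + n + n * 2 ≤ B) (h9 : TableIs n s 9 fun i _ => Enumeration.discard E i)
    (h13 : TableIs n s 13 fun x _ => Enumeration.rank E x)
    (h14 : TableIs n s 14 fun i k => Enumeration.topDiff E i k n) :
    Runs B skipTable s (200 * (n + 1) ^ 3) fun s' => AgreeArr 15 s s' ∧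
      TableIs n s' 15 (Enumeration.skip E) := by
  refine (runs_sumTable (fun i j k => (1 - Enumeration.discard E k) *
    ((if Enumeration.topDiff E i k n = Enumeration.rank E j + 1 then 1 else 0) +
      (if k < i then 1 else 0) *
        if Enumeration.topDiff E i k n < Enumeration.rank E j + 1 then 1 else 0)) 2 h0 ?_
    ?_ (by omega) (by omega)).mono (Nat.mul_le_mul_right _ (by decide)) fun _ h => h
  · intro i hi j hj k hk s' hs r0 r2 r3 r5
    have h9' := hs.tableIs h9 (by decide)
    have h13' := hs.tableIs h13 (by decide)
    have h14' := hs.tableIs h14 (by decide)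
    simp only [Expr.eval, Expr.eval_notE, Expr.eval_eqE, Expr.eval_ltE, eval_cell, r0, r2, r3, r5,
      h9' k hk 0 (by omega), h13' j hj 0 (by omega), h14' i hi k hk]
  · intro i _ j _ k _
    exact (Nat.mul_le_mul (Nat.sub_le 1 _) (show _ ≤ 2 by split_ifs <;> simp)).trans
      (by norm_num)

/-- The state of the elimination before step `i`: row `i` of arrays 2 and 3 holds the remaining
vertices and the deficiencies, and the first `i` rows of array 6 hold the candidate cutsets. -/
structure ElimState (G : SimpleGraph (Fin n)) (pick : Finset (Fin n) → Fin n) (s₀ : Memory)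
    (i : ℕ) (s : Memory) : Prop where
  reg0 : s.reg 0 = n
  reg1 : s.reg 1 = s₀.reg 1
  rarr : s.rarr = s₀.rarr
  adj : TableIs n s 0 (adjNat G)
  alive : ∀ u < n, s.arr 2 (i * n + u) = indicator (elimSet pick i) u
  deficient : ∀ u < n, s.arr 3 (i * n + u) = deficiency G (elimSet pick i) u
  cut : ∀ i' < i, ∀ u < n, s.arr 6 (i' * n + u) = indicator (elimCut G pick i') u

theorem ElimState.writeReg {G : SimpleGraph (Fin n)} {pick : Finset (Fin n) → Fin n}
    {s₀ s : Memory} {i : ℕ} (h : ElimState G pick s₀ i s) {r : ℕ} (hr : 2 ≤ r) (v : ℕ) :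
    ElimState G pick s₀ i (s.writeReg r v) := by
  refine ⟨?_, ?_, h.rarr, h.adj, h.alive, h.deficient, h.cut⟩
  · simp only [Memory.writeReg]
    rw [Function.update_of_ne (by omega), h.reg0]
  · simp only [Memory.writeReg]
    rw [Function.update_of_ne (by omega), h.reg1]

theorem runs_row_mono {a : ℕ} {off init e : Expr} {s : Memory} {Q : Memory → Prop}
    (h : Runs B (row a off init e) s ((init.cost + off.cost + e.cost + 40) * (n + 1) ^ 2) Q)
    (hc : init.cost + off.cost + e.cost ≤ 100) :
    Runs B (row a off init e) s (140 * (n + 1) ^ 2) Q :=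
  h.mono (Nat.mul_le_mul_right _ (by omega)) fun _ h => h

theorem runs_elimInit {G : SimpleGraph (Fin n)} {pick : Finset (Fin n) → Fin n} {s : Memory}
    (h0 : s.reg 0 = n) (hn : 0 < n) (hB : n * n + n + n * 2 ≤ B)
    (hA : TableIs n s 0 (adjNat G))
    (h7 : TableIs n s 7 fun i j => ∑ k ∈ Finset.range n, openPair G i j k) :
    Runs B (.seq initAlive initDeficiency) s (280 * (n + 1) ^ 2) (ElimState G pick s 0) := by
  refine (Runs.seq (runs_row_mono (runs_row (e := regAcc) (o := 0) (fun _ _ => 1) h0 (fun _ _ => rfl)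
    (fun _ _ _ _ _ => rfl) (fun _ _ _ _ _ _ _ _ h => h) (fun _ _ _ _ => by omega) (by omega))
    (by decide)) (T' := 140 * (n + 1) ^ 2) ?_).mono (by omega) fun _ h => h
  rintro s₁ ⟨hs₁, h2⟩
  refine (runs_row_mono (runs_row (o := 0) (n := n) (fun j k => ∑ a ∈ Finset.range k,
    ∑ c ∈ Finset.range n, openPair G j a c) ((hs₁.reg 0 (by omega)).trans h0) (fun _ _ => rfl)
    ?_ ?_ ?_ (by omega)) (by decide)).mono le_rfl ?_
  · intro j _ s' _ _
    simp [Expr.eval]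
  · intro j hj k hk s' hs r3 r5 r4
    have r0 := (hs.reg 0 (by omega)).trans ((hs₁.reg 0 (by omega)).trans h0)
    rw [Finset.sum_range_succ]
    simp only [Expr.eval, eval_cell, r0, r3, r4, r5]
    rw [hs.arr 7 (by decide), hs₁.arr 7 (by decide), h7 j hj k hk]
  · intro j hj k hk
    refine le_trans (b := n * n) ?_ (by omega)
    calc _ ≤ ∑ _a ∈ Finset.range k, ∑ _c ∈ Finset.range n, 1 :=
          Finset.sum_le_sum fun a _ => Finset.sum_le_sum fun c _ => openPair_le_one G j a c
      _ = k * n := by simp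
      _ ≤ n * n := Nat.mul_le_mul_right _ hk
  · rintro s₂ ⟨hs₂, h3⟩
    refine ⟨?_, ?_, hs₂.rarr.trans hs₁.rarr, ?_, ?_, ?_, fun i' hi' => absurd hi' (by omega)⟩
    · rw [hs₂.reg 0 (by omega), hs₁.reg 0 (by omega), h0]
    · rw [hs₂.reg 1 (by omega), hs₁.reg 1 (by omega)]
    · intro i hi j hj
      rw [hs₂.arr 0 (by decide), hs₁.arr 0 (by decide), hA i hi j hj]
    · intro u hu
      rw [hs₂.arr 2 (by decide), zero_mul, h2 u hu]
      simp [elimSet, indicator, hu]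
    · intro u hu
      rw [zero_mul, h3 u hu, elimSet, deficiency_univ]

theorem runs_elimStep {G : SimpleGraph (Fin n)} (hn : 0 < n) {s₀ s : Memory} {i : ℕ}
    (hpick : pickVertex G hn (elimSet (pickVertex G hn) i) ∈ elimSet (pickVertex G hn) i)
    (h : ElimState G (pickVertex G hn) s₀ i s) (hi : i < n) (hB : n * n + n + n * 2 ≤ B)
    (h2 : s.reg 2 = i) :
    Runs B elimStep s (700 * (n + 1) ^ 2) fun s' => s'.reg 2 = i ∧
      ElimState G (pickVertex G hn) s₀ (i + 1) s' := by
  set pick := pickVertex G hn with hpickdef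
  set R := elimSet pick i with hR
  have hv : ((pick R : Fin n) : ℕ) = pickIndex G R n := rfl
  have hvn : ((pick R : Fin n) : ℕ) < n := (pick R).2
  have hin : i * n + n ≤ n * n := by nlinarith
  have hin' : (i + 1) * n + n ≤ B := by nlinarith
  have hsucc : (i + 1) * n = i * n + n := by ring
  refine (Runs.seq (T := 140 * (n + 1) ^ 2) (T' := 560 * (n + 1) ^ 2)
    (runs_row_mono (runs_row (o := i * n) (n := n) (fun _ k => pickIndex G R k) h.reg0 ?_ ?_ ?_ ?_
      (by omega)) (by decide)) ?_).mono (by omega) fun _ h => h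
  · intro s' hs
    simp only [Expr.eval, hs.reg 0 (by omega), hs.reg 2 (by omega), h.reg0, h2]
  · intro j _ s' _ _
    rfl
  · intro j hj k hk s' hs r3 r5 r4
    have r0 := (hs.reg 0 (by omega)).trans h.reg0
    have r2 := (hs.reg 2 (by omega)).trans h2
    simp only [Expr.eval, Expr.eval_notE, Expr.eval_eqE, eval_cell, r0, r2, r4, r5]
    rw [hs.arr 2 (by decide), hs.arr 3 (by decide), h.alive k hk, h.deficient k hk, pickIndex]
  · intro j hj k hk
    have := pickIndex_lt G R hn hk
    omega
  rintro s₁ ⟨hs₁, h4⟩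
  have r0₁ := (hs₁.reg 0 (by omega)).trans h.reg0
  have r2₁ := (hs₁.reg 2 (by omega)).trans h2
  refine (Runs.seq (T := 140 * (n + 1) ^ 2) (T' := 420 * (n + 1) ^ 2)
    (runs_row_mono (runs_row (o := i * n) (n := n) (fun _ k => ∑ u ∈ Finset.range k,
      indicator R u * (1 - adjNat G (pick R) u)) r0₁ ?_ ?_ ?_ ?_
      (by omega)) (by decide)) ?_).mono (by omega) fun _ h => h
  · intro s' hs
    simp only [Expr.eval, hs.reg 0 (by omega), hs.reg 2 (by omega), r0₁, r2₁]
  · intro j _ s' _ _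
    simp [Expr.eval]
  · intro j hj k hk s' hs r3 r5 r4
    have r0 := (hs.reg 0 (by omega)).trans r0₁
    have r2 := (hs.reg 2 (by omega)).trans r2₁
    rw [Finset.sum_range_succ]
    simp only [Expr.eval, Expr.eval_notE, eval_cell, r0, r2, r3, r4, r5]
    rw [hs.arr 2 (by decide), hs.arr 4 (by decide), hs.arr 0 (by decide), h4 j hj,
      hs₁.arr 2 (by decide), hs₁.arr 0 (by decide), h.alive k hk, ← hv, h.adj _ hvn k hk]
  · intro j hj k hk
    refine le_trans (b := n) ?_ (by omega)
    calc _ ≤ ∑ _u ∈ Finset.range k, 1 := Finset.sum_le_sum fun u _ =>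
          Nat.mul_le_mul (indicator_le_one R u) (Nat.sub_le 1 _)
      _ ≤ n := by simpa using hk
  rintro s₂ ⟨hs₂, h5⟩
  have r0₂ := (hs₂.reg 0 (by omega)).trans r0₁
  have r2₂ := (hs₂.reg 2 (by omega)).trans r2₁
  have h4₂ : ∀ j < n, s₂.arr 4 (i * n + j) = pick R := by
    intro j hj
    rw [hs₂.arr 4 (by decide), h4 j hj, hv]
  refine (Runs.seq (T := 140 * (n + 1) ^ 2) (T' := 280 * (n + 1) ^ 2)
    (runs_row_mono (runs_row (e := regAcc) (o := i * n) (n := n)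
      (fun j _ => indicator (elimCut G pick i) j)
      r0₂ ?_ ?_ (fun j _ k _ s' _ _ _ r4 => r4) (fun j _ k _ => ?_) (by omega)) (by decide))
      ?_).mono (by omega) fun _ h => h
  · intro s' hs
    simp only [Expr.eval, hs.reg 0 (by omega), hs.reg 2 (by omega), r0₂, r2₂]
  · intro j hj s' hs r3
    have r0 := (hs.reg 0 (by omega)).trans r0₂
    have r2 := (hs.reg 2 (by omega)).trans r2₂
    simp only [Expr.eval, Expr.eval_notE, eval_cell, r0, r2, r3]
    rw [hs.arr 2 (by decide), hs.arr 4 (by decide), hs.arr 0 (by decide), hs.arr 5 (by decide),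
      h4₂ j hj, h5 j hj, hs₂.arr 2 (by decide), hs₂.arr 0 (by decide), hs₁.arr 2 (by decide),
      hs₁.arr 0 (by decide), h.alive j hj, h.adj _ hvn j hj]
    exact indicator_elimCut hpick ⟨j, hj⟩ rfl
  · have := indicator_le_one (elimCut G pick i) j
    omega
  rintro s₃ ⟨hs₃, h6⟩
  have r0₃ := (hs₃.reg 0 (by omega)).trans r0₂
  have r2₃ := (hs₃.reg 2 (by omega)).trans r2₂
  have h4₃ : ∀ j < n, s₃.arr 4 (i * n + j) = pick R := by
    intro j hj
    rw [hs₃.arr 4 (by decide), h4₂ j hj]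
  have h2₃ : ∀ u < n, s₃.arr 2 (i * n + u) = indicator R u := by
    intro u hu
    rw [hs₃.arr 2 (by decide), hs₂.arr 2 (by decide), hs₁.arr 2 (by decide), h.alive u hu]
  have h3₃ : ∀ u < n, s₃.arr 3 (i * n + u) = deficiency G R u := by
    intro u hu
    rw [hs₃.arr 3 (by decide), hs₂.arr 3 (by decide), hs₁.arr 3 (by decide), h.deficient u hu]
  have hA₃ : TableIs n s₃ 0 (adjNat G) := by
    intro u hu v hv
    rw [hs₃.arr 0 (by decide), hs₂.arr 0 (by decide), hs₁.arr 0 (by decide), h.adj u hu v hv]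
  refine (Runs.seq (T := 140 * (n + 1) ^ 2) (T' := 140 * (n + 1) ^ 2)
    (runs_row_mono (runs_row (o := (i + 1) * n) (n := n) (fun j k => deficiency G R j -
      ∑ c ∈ Finset.range k, 2 * (indicator R c * openPair G j (pick R) c))
      r0₃ ?_ ?_ ?_ (fun j _ k _ => ?_) hin') (by decide))
      ?_).mono (by omega) fun _ h => h
  · intro s' hs
    simp only [Expr.eval, hs.reg 0 (by omega), hs.reg 2 (by omega), r0₃, r2₃]
  · intro j hj s' hs r3
    have r0 := (hs.reg 0 (by omega)).trans r0₃
    have r2 := (hs.reg 2 (by omega)).trans r2₃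
    simp only [Expr.eval, eval_cell, r0, r2, r3]
    rw [hs.cell _ (Or.inl (by omega)), h3₃ j hj]
    simp
  · intro j hj k hk s' hs r3 r5 r4
    have r0 := (hs.reg 0 (by omega)).trans r0₃
    have r2 := (hs.reg 2 (by omega)).trans r2₃
    rw [Finset.sum_range_succ, ← Nat.sub_sub]
    simp only [Expr.eval, Expr.eval_notE, Expr.eval_eqE, eval_cell, r0, r2, r3, r4, r5]
    rw [hs.arr 2 (by decide), hs.arr 4 (by decide), hs.arr 0 (by decide), h4₃ j hj, h2₃ k hk,
      hA₃ j hj _ hvn, hA₃ j hj k hk, hA₃ _ hvn k hk]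
    rfl
  · have := deficiency_le G R j
    omega
  rintro s₄ ⟨hs₄, h3⟩
  have r0₄ := (hs₄.reg 0 (by omega)).trans r0₃
  have r2₄ := (hs₄.reg 2 (by omega)).trans r2₃
  refine (runs_row_mono (runs_row (e := regAcc) (o := (i + 1) * n) (n := n)
      (fun j _ => indicator (R.erase (pick R)) j)
      r0₄ ?_ ?_ (fun j _ k _ s' _ _ _ r4 => r4) (fun j _ k _ => ?_) hin')
      (by decide)).mono le_rfl ?_
  · intro s' hs
    simp only [Expr.eval, hs.reg 0 (by omega), hs.reg 2 (by omega), r0₄, r2₄]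
  · intro j hj s' hs r3
    have r0 := (hs.reg 0 (by omega)).trans r0₄
    have r2 := (hs.reg 2 (by omega)).trans r2₄
    simp only [Expr.eval, Expr.eval_eqE, eval_cell, r0, r2, r3]
    rw [hs.cell _ (Or.inl (by omega)), hs.arr 4 (by decide), hs₄.arr 4 (by decide),
      hs₄.arr 2 (by decide), h4₃ j hj, h2₃ j hj, indicator_erase R hpick j]
    omega
  · have := indicator_le_one (R.erase (pick R)) j
    omega
  rintro s₅ ⟨hs₅, h2'⟩
  refine ⟨(hs₅.reg 2 (by omega)).trans r2₄, (hs₅.reg 0 (by omega)).trans r0₄, ?_, ?_, ?_, h2', ?_,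
    ?_⟩
  · rw [hs₅.reg 1 (by omega), hs₄.reg 1 (by omega), hs₃.reg 1 (by omega), hs₂.reg 1 (by omega),
      hs₁.reg 1 (by omega), h.reg1]
  · rw [hs₅.rarr, hs₄.rarr, hs₃.rarr, hs₂.rarr, hs₁.rarr, h.rarr]
  · intro u hu v hv
    rw [hs₅.arr 0 (by decide), hs₄.arr 0 (by decide), hA₃ u hu v hv]
  · intro u hu
    rw [hs₅.arr 3 (by decide), h3 u hu, elimSet, deficiency_erase G _ hpick u]
  · intro i' hi' u hu
    rw [hs₅.arr 6 (by decide), hs₄.arr 6 (by decide)]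
    rcases Nat.lt_succ_iff_lt_or_eq.1 hi' with h' | rfl
    · rw [hs₃.cell _ (Or.inl (by nlinarith)), hs₂.arr 6 (by decide), hs₁.arr 6 (by decide),
        h.cut i' h' u hu]
    · exact h6 u hu

end RAM

namespace RAM

variable {B n : ℕ}

theorem runs_elimLoop {G : SimpleGraph (Fin n)} (hG : IsChordalGraph G) (hn : 0 < n)
    {s₀ s : Memory} (h : ElimState G (pickVertex G hn) s₀ 0 s) (hB : n * n + n + n * 2 ≤ B) :
    Runs B (forLoop 2 0 elimStep) s (710 * (n + 1) ^ 3)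
      (ElimState G (pickVertex G hn) s₀ n) := by
  refine (runs_forLoop (n := n) (T := 700 * (n + 1) ^ 2)
    (fun i s => ElimState G (pickVertex G hn) s₀ i s) (by omega) h.reg0 (by omega)
    (h.writeReg le_rfl _) ?_).mono ?_ fun _ h => h
  · intro i hi s hs h2 _
    have hpick := isSimplicialIn_pickVertex hG hn
    have hne : (elimSet (pickVertex G hn) i).Nonempty :=
      elimSet_nonempty hpick (by rwa [Fintype.card_fin])
    exact (runs_elimStep hn (hpick _ hne).1 hs hi hB h2).mono le_rfl fun s' hs' =>
      ⟨hs'.1, hs'.2.reg0, hs'.2.writeReg le_rfl _⟩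
  · have : 1 ≤ (n + 1) ^ 2 := Nat.one_le_pow _ _ (by omega)
    calc (n + 1) * (700 * (n + 1) ^ 2 + 10) ≤ (n + 1) * (710 * (n + 1) ^ 2) :=
          Nat.mul_le_mul_left _ (by omega)
      _ = 710 * (n + 1) ^ 3 := by ring

/-- The tables that the output loop reads. -/
structure OutputTables (E : ℕ → Finset (Fin n)) (s₀ s : Memory) : Prop where
  reg0 : s.reg 0 = n
  rarr : s.rarr = s₀.rarr
  sets : TableIs n s 6 fun i => indicator (E i)
  discard : TableIs n s 9 fun i _ => Enumeration.discard E i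
  rank : TableIs n s 13 fun x _ => Enumeration.rank E x
  skip : TableIs n s 15 (Enumeration.skip E)

theorem runs_enumerationTables {E : ℕ → Finset (Fin n)} {s : Memory} {p : Program} {T : ℕ}
    {Q : Memory → Prop} (h0 : s.reg 0 = n) (hB : n * n + n + n * 2 ≤ B)
    (h6 : TableIs n s 6 fun i => indicator (E i))
    (hp : ∀ s', OutputTables E s s' → s'.reg 1 = s.reg 1 → Runs B p s' T Q) :
    Runs B (enumerationTables p) s (1600 * (n + 1) ^ 3 + T) Q := by
  refine Runs.mono (T := _) ((runs_excessTable h0 hB h6).seq (T' := 1400 * (n + 1) ^ 3 + T) ?_)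
    (by omega) fun _ h => h
  rintro s₁ ⟨a₁, h8⟩
  have r₁ := (a₁.reg 0 (by omega)).trans h0
  have h6₁ := a₁.tableIs h6 (by decide)
  refine Runs.mono (T := _) ((runs_discardTable r₁ hB h8).seq (T' := 1200 * (n + 1) ^ 3 + T) ?_)
    (by omega) fun _ h => h
  rintro s₂ ⟨a₂, h9⟩
  have r₂ := (a₂.reg 0 (by omega)).trans r₁
  have h6₂ := a₂.tableIs h6₁ (by decide)
  refine Runs.mono (T := _) ((runs_cosizeTable r₂ hB h6₂).seq (T' := 1000 * (n + 1) ^ 3 + T) ?_)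
    (by omega) fun _ h => h
  rintro s₃ ⟨a₃, h10⟩
  have r₃ := (a₃.reg 0 (by omega)).trans r₂
  have h6₃ := a₃.tableIs h6₂ (by decide)
  have h9₃ := a₃.tableIs h9 (by decide)
  refine Runs.mono (T := _) ((runs_countTable r₃ hB h6₃ h9₃ h10).seq
    (T' := 800 * (n + 1) ^ 3 + T) ?_) (by omega) fun _ h => h
  rintro s₄ ⟨a₄, h11⟩
  have r₄ := (a₄.reg 0 (by omega)).trans r₃
  refine Runs.mono (T := _) ((runs_lexiTable r₄ hB h11).seq (T' := 600 * (n + 1) ^ 3 + T) ?_)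
    (by omega) fun _ h => h
  rintro s₅ ⟨a₅, h12⟩
  have r₅ := (a₅.reg 0 (by omega)).trans r₄
  refine Runs.mono (T := _) ((runs_rankTable r₅ hB h12).seq (T' := 400 * (n + 1) ^ 3 + T) ?_)
    (by omega) fun _ h => h
  rintro s₆ ⟨a₆, h13⟩
  have r₆ := (a₆.reg 0 (by omega)).trans r₅
  have h6₆ := a₆.tableIs (a₅.tableIs (a₄.tableIs h6₃ (by decide)) (by decide)) (by decide)
  have h9₆ := a₆.tableIs (a₅.tableIs (a₄.tableIs h9₃ (by decide)) (by decide)) (by decide)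
  refine Runs.mono (T := _) ((runs_topDiffTable r₆ hB h6₆ h13).seq
    (T' := 200 * (n + 1) ^ 3 + T) ?_) (by omega) fun _ h => h
  rintro s₇ ⟨a₇, h14⟩
  have r₇ := (a₇.reg 0 (by omega)).trans r₆
  have h9₇ := a₇.tableIs h9₆ (by decide)
  have h13₇ := a₇.tableIs h13 (by decide)
  refine (runs_skipTable r₇ hB h9₇ h13₇ h14).seq ?_
  rintro s₈ ⟨a₈, h15⟩
  refine hp s₈ ⟨(a₈.reg 0 (by omega)).trans r₇, ?_,
    a₈.tableIs (a₇.tableIs h6₆ (by decide)) (by decide), a₈.tableIs h9₇ (by decide),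
    a₈.tableIs h13₇ (by decide), h15⟩ ?_
  · rw [a₈.rarr, a₇.rarr, a₆.rarr, a₅.rarr, a₄.rarr, a₃.rarr, a₂.rarr, a₁.rarr]
  · rw [a₈.reg 1 (by omega), a₇.reg 1 (by omega), a₆.reg 1 (by omega), a₅.reg 1 (by omega),
      a₄.reg 1 (by omega), a₃.reg 1 (by omega), a₂.reg 1 (by omega), a₁.reg 1 (by omega)]

/-- The set that the enumeration produces from the pair `(E i, j)`. -/
def pairSet (E : ℕ → Finset (Fin n)) (p : Fin n × Fin n) : Finset (Fin n) :=
  transversal (fun x : Fin n => Enumeration.rank E x) (E p.1) p.2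

/-- The valid pairs that precede `(i, j)` in lexicographic order. -/
def validBefore (E : ℕ → Finset (Fin n)) (i j : ℕ) : Set (Fin n × Fin n) :=
  {p | Enumeration.valid E p.1 p.2 = 1 ∧ ((p.1 : ℕ) < i ∨ (p.1 : ℕ) = i ∧ (p.2 : ℕ) < j)}

/-- The state of the output loop when the pairs that precede `(i, j)` have been processed. -/
structure OutputState (E : ℕ → Finset (Fin n)) (s₀ : Memory) (i j : ℕ) (s : Memory) : Prop where
  tables : OutputTables E s₀ s
  len : s.reg 1 ≤ i * n + j
  lists : Set.BijOn (outputSet n s) (Set.Iio (s.reg 1)) (pairSet E '' validBefore E i j)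

theorem OutputState.writeReg {E : ℕ → Finset (Fin n)} {s₀ s : Memory} {i j : ℕ}
    (h : OutputState E s₀ i j s) {r : ℕ} (hr : 2 ≤ r) (v : ℕ) :
    OutputState E s₀ i j (s.writeReg r v) := by
  have h1 : (s.writeReg r v).reg 1 = s.reg 1 := by
    simp only [Memory.writeReg]
    rw [Function.update_of_ne (by omega)]
  refine ⟨⟨?_, h.tables.rarr, h.tables.sets, h.tables.discard, h.tables.rank, h.tables.skip⟩,
    by rw [h1]; exact h.len, by rw [h1]; exact h.lists⟩
  simp only [Memory.writeReg]
  rw [Function.update_of_ne (by omega), h.tables.reg0]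

/-- Processing the pair `(i, j)` adds it if it is valid. -/
theorem validBefore_succ {E : ℕ → Finset (Fin n)} (i j : Fin n) :
    validBefore E i (j + 1) =
      if Enumeration.valid E i j = 1 then insert (i, j) (validBefore E i j)
      else validBefore E i j := by
  ext ⟨a, b⟩
  have hiff : ((a : ℕ) < i ∨ (a : ℕ) = i ∧ (b : ℕ) < j + 1) ↔
      (a = i ∧ b = j) ∨ ((a : ℕ) < i ∨ (a : ℕ) = i ∧ (b : ℕ) < j) := by
    rw [Fin.ext_iff, Fin.ext_iff]
    omega
  split_ifs with h
  · simp only [validBefore, Set.mem_ofPred_eq, Set.mem_insert_iff, Prod.mk.injEq, hiff]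
    constructor
    · tauto
    · rintro (⟨rfl, rfl⟩ | h')
      · exact ⟨h, Or.inl ⟨rfl, rfl⟩⟩
      · tauto
  · simp only [validBefore, Set.mem_ofPred_eq, hiff]
    constructor
    · rintro ⟨h1, ⟨rfl, rfl⟩ | h2⟩
      · exact absurd h1 h
      · exact ⟨h1, h2⟩
    · tauto

theorem validBefore_succ_zero {E : ℕ → Finset (Fin n)} (i : ℕ) :
    validBefore E (i + 1) 0 = validBefore E i n := by
  ext ⟨a, b⟩
  have := b.2
  simp only [validBefore, Set.mem_ofPred_eq]
  refine and_congr_right fun _ => ?_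
  omega

theorem outputSet_congr {s s' : Memory} {i : ℕ}
    (h : ∀ u < n, s'.arr 1 (i * n + u) = s.arr 1 (i * n + u)) :
    outputSet n s' i = outputSet n s i := by
  ext u
  simp only [outputSet, Finset.mem_filter, h u u.2]

/-- Row number `m` is scratch space while register 1 holds `m`, so an invalid pair leaves the listed
sets unchanged; a valid one adds a set that is new by injectivity. -/
theorem runs_outputPair {E : ℕ → Finset (Fin n)} {s₀ s : Memory} {i j : Fin n}
    (hinj : Set.InjOn (pairSet E) {p | Enumeration.valid E p.1 p.2 = 1})
    (h : OutputState E s₀ i j s) (hB : n * n * n + n * n + 3 * n ≤ B) (h2 : s.reg 2 = i)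
    (h3 : s.reg 3 = j) :
    Runs B outputPair s (200 * (n + 1)) fun s' => s'.reg 2 = i ∧ s'.reg 3 = j ∧
      OutputState E s₀ i (j + 1) s' := by
  have hi := i.2
  have hj := j.2
  set m := s.reg 1 with hm
  have hlen : m + 1 ≤ n * n := by
    have := h.len
    nlinarith
  have hmn : m * n + n ≤ n * n * n := by nlinarith
  let val : ℕ → ℕ := fun u => (if u = j then 1 else 0) +
    (1 - if Enumeration.rank E u < Enumeration.rank E j then 1 else 0) * (1 - indicator (E i) u)
  have hval : ∀ u, val u ≤ 2 := by
    intro u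
    have : (1 - if Enumeration.rank E u < Enumeration.rank E j then 1 else 0) *
        (1 - indicator (E i) u) ≤ 1 * 1 := Nat.mul_le_mul (Nat.sub_le _ _) (Nat.sub_le _ _)
    simp only [val]
    split_ifs at * <;> omega
  refine (Runs.seq (T := (n + 1) * 60) (T' := 40)
    (Q := fun s' => AgreeOff 1 (m * n) n s s' ∧ s'.reg 3 = j ∧
      ∀ u < n, s'.arr 1 (m * n + u) = val u)
    ((runs_forLoop (n := n) (T := 50) (fun k s' => AgreeOff 1 (m * n) n s s' ∧ s'.reg 3 = j ∧
      ∀ u < k, s'.arr 1 (m * n + u) = val u) (by omega) h.tables.reg0 (by nlinarith)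
      ⟨(AgreeOff.refl _ _ _ _).writeReg (by omega) _, by simp [Memory.writeReg, h3],
        fun u hu => absurd hu (by omega)⟩ ?_).mono le_rfl fun _ h => h) ?_).mono
    (by omega) fun _ h => h
  · rintro k hk s' ⟨hs, r3, hdone⟩ r5 r0
    have r1 := hs.reg 1 (by omega)
    have r2 := (hs.reg 2 (by omega)).trans h2
    have ha : (Expr.add (.mul (.reg 1) (.reg 0)) regK).eval s' = m * n + k := by
      simp only [Expr.eval, r1, r0, r5, hm]
    have he : (Expr.add (.eqE regK regJ)
        (.mul (.notE (.ltE (cell 13 regK (.const 0)) (cell 13 regJ (.const 0))))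
          (.notE (cell 6 regI regK)))).eval s' = val k := by
      simp only [Expr.eval, Expr.eval_notE, Expr.eval_eqE, Expr.eval_ltE, eval_cell, r0, r2, r3,
        r5]
      rw [hs.arr 13 (by decide), hs.arr 6 (by decide), h.tables.rank k hk 0 (by omega),
        h.tables.rank j hj 0 (by omega), h.tables.sets i hi k hk]
    refine (runs_setArr (by rw [ha]; omega) (by rw [he]; have := hval k; omega) ?_).mono
      (by decide) fun _ h => h
    rw [ha, he]
    refine ⟨r5, r0, (hs.writeArr hk _).writeReg (by omega) _, ?_, fun u hu => ?_⟩
    · simp [Memory.writeReg, Memory.writeArr, r3]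
    · simp only [Memory.writeReg, Memory.writeArr, Function.update_self]
      rcases Nat.lt_succ_iff_lt_or_eq.1 hu with h' | rfl
      · rw [Function.update_of_ne (by omega), hdone u h']
      · rw [Function.update_self]
  · rintro s' ⟨hs, r3, hrow⟩
    have r0 := (hs.reg 0 (by omega)).trans h.tables.reg0
    have r1 := hs.reg 1 (by omega)
    have r2 := (hs.reg 2 (by omega)).trans h2
    have he : (Expr.add (.reg 1) (.mul (.mul (.notE (cell 9 regI (.const 0))) (cell 6 regI regJ))
        (.notE (cell 15 regI regJ)))).eval s' = m + Enumeration.valid E i j := by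
      simp only [Expr.eval, Expr.eval_notE, eval_cell, r0, r1, r2, r3]
      rw [hs.arr 9 (by decide), hs.arr 6 (by decide), hs.arr 15 (by decide),
        h.tables.discard i hi 0 (by omega), h.tables.sets i hi j hj, h.tables.skip i hi j hj,
        Enumeration.valid]
    have hv1 := Enumeration.valid_eq_zero_or_one (E := E) i j
    refine (runs_setReg (by rw [he]; omega) ?_).mono (by decide) fun _ h => h
    rw [he]
    have hreg1 : (s'.writeReg 1 (m + Enumeration.valid E i j)).reg 1 =
        m + Enumeration.valid E i j := by simp [Memory.writeReg]
    have hold : ∀ q < m, outputSet n (s'.writeReg 1 (m + Enumeration.valid E i j)) q =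
        outputSet n s q := by
      intro q hq
      refine outputSet_congr fun u hu => hs.cell _ (Or.inl ?_)
      calc q * n + u < q * n + n := by omega
        _ = (q + 1) * n := by ring
        _ ≤ m * n := Nat.mul_le_mul_right _ hq
    refine ⟨by simp [Memory.writeReg, r2], by simp [Memory.writeReg, r3],
      ⟨by simp [Memory.writeReg, r0], hs.rarr.trans h.tables.rarr, ?_, ?_, ?_, ?_⟩, ?_, ?_⟩
    · exact fun a ha b hb => (congrFun (hs.arr 6 (by decide)) _).trans (h.tables.sets a ha b hb)
    · exact fun a ha b hb =>
        (congrFun (hs.arr 9 (by decide)) _).trans (h.tables.discard a ha b hb)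
    · exact fun a ha b hb => (congrFun (hs.arr 13 (by decide)) _).trans (h.tables.rank a ha b hb)
    · exact fun a ha b hb => (congrFun (hs.arr 15 (by decide)) _).trans (h.tables.skip a ha b hb)
    · rw [hreg1]
      have := h.len
      omega
    · rw [hreg1, validBefore_succ]
      rcases hv1 with hv | hv
      · rw [hv, if_neg (by omega), add_zero]
        exact h.lists.congr fun q hq => (hv ▸ hold q hq).symm
      · rw [hv, if_pos rfl, Set.image_insert_eq]
        rw [hv] at hold
        have hnew : outputSet n (s'.writeReg 1 (m + 1)) m = pairSet E (i, j) := by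
          ext u
          have hjE := (Enumeration.valid_eq_one_iff.1 hv).2.1
          have hu : (s'.writeReg 1 (m + 1)).arr 1 (m * n + u) = val u := hrow u u.2
          simp only [outputSet, Finset.mem_filter, Finset.mem_univ, true_and, hu, pairSet,
            mem_transversal, val, indicator_coe, Fin.val_inj]
          by_cases h1 : u = j
          · subst h1
            simp [hjE]
          · by_cases h2 : Enumeration.rank E u < Enumeration.rank E j
            · simp [h1, h2]
            · by_cases h3 : u ∈ E i
              · simp [h1, h2, h3]
              · simp [h1, h2, h3, not_lt.1 h2]
        have hnotin : pairSet E (i, j) ∉ pairSet E '' validBefore E i j := by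
          rintro ⟨p, hp, hpe⟩
          have : p = (i, j) := hinj hp.1 hv hpe
          subst this
          have := hp.2
          simp at this
        have hIio : Set.Iio (m + 1) = insert m (Set.Iio m) := by
          ext q
          simp only [Set.mem_Iio, Set.mem_insert_iff]
          omega
        have hb : Set.BijOn (outputSet n (s'.writeReg 1 (m + 1))) (Set.Iio m)
            (pairSet E '' validBefore E i j) := h.lists.congr fun q hq => (hold q hq).symm
        rw [hIio, ← hnew]
        refine hb.insert ?_
        rw [hnew]
        exact hnotin

theorem runs_outputLoop {E : ℕ → Finset (Fin n)} {s : Memory}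
    (hinj : Set.InjOn (pairSet E) {p | Enumeration.valid E p.1 p.2 = 1})
    (h : OutputTables E s s) (h1 : s.reg 1 = 0) (hB : n * n * n + n * n + 3 * n ≤ B) :
    Runs B (forLoop 2 0 (forLoop 3 0 outputPair)) s (220 * (n + 1) ^ 3) fun s' =>
      s'.reg 0 = n ∧ s'.reg 1 ≤ n * n ∧ s'.rarr = s.rarr ∧
        Lists n s' (pairSet E '' {p | Enumeration.valid E p.1 p.2 = 1}) := by
  have hinit : OutputState E s 0 0 s := by
    refine ⟨h, by rw [h1]; omega, ?_⟩
    have : validBefore E 0 0 = ∅ := by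
      ext p
      simp [validBefore]
    rw [h1, this, Set.image_empty]
    have h0 : Set.Iio 0 = (∅ : Set ℕ) := by
      ext q
      simp
    rw [h0]
    exact Set.bijOn_empty _
  refine (runs_forLoop (n := n) (T := 210 * (n + 1) ^ 2) (fun i s' => OutputState E s i 0 s')
    (by omega) h.reg0 (by nlinarith) (hinit.writeReg le_rfl _) ?_).mono ?_ ?_
  · intro i hi s₁ hs₁ h2 _
    refine (runs_forLoop (n := n) (T := 200 * (n + 1))
      (fun j s' => OutputState E s i j s' ∧ s'.reg 2 = i) (by omega) hs₁.tables.reg0 (by nlinarith)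
      ⟨hs₁.writeReg (by omega) _, by simp [Memory.writeReg, h2]⟩ ?_).mono ?_ ?_
    · rintro j hj s₂ ⟨hs₂, h2'⟩ h3 _
      refine (runs_outputPair (i := ⟨i, hi⟩) (j := ⟨j, hj⟩) hinj hs₂ hB h2' h3).mono le_rfl ?_
      rintro s₃ ⟨r2, r3, hs₃⟩
      exact ⟨r3, hs₃.tables.reg0, hs₃.writeReg (by omega) _, by simp [Memory.writeReg, r2]⟩
    · nlinarith
    · rintro s₂ ⟨hs₂, h2'⟩
      refine ⟨h2', hs₂.tables.reg0, OutputState.writeReg ⟨hs₂.tables, ?_, ?_⟩ le_rfl _⟩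
      · have := hs₂.len
        rw [Nat.add_mul]
        omega
      · rw [validBefore_succ_zero]
        exact hs₂.lists
  · have : 1 ≤ (n + 1) ^ 2 := Nat.one_le_pow _ _ (by omega)
    calc (n + 1) * (210 * (n + 1) ^ 2 + 10) ≤ (n + 1) * (220 * (n + 1) ^ 2) :=
          Nat.mul_le_mul_left _ (by omega)
      _ = 220 * (n + 1) ^ 3 := by ring
  · intro s' hs'
    refine ⟨hs'.tables.reg0, by simpa using hs'.len, hs'.tables.rarr, ?_⟩
    have : validBefore E n 0 = {p | Enumeration.valid E p.1 p.2 = 1} := by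
      ext p
      simp [validBefore]
    rw [Lists, ← this]
    exact hs'.lists

theorem tableIs_input (G : SimpleGraph (Fin n)) (c : Fin n → ℝ≥0) :
    TableIs n (input G c) 0 (adjNat G) := by
  classical
  intro i hi j hj
  simp only [input, adjNat, true_and]
  refine if_congr ?_ rfl rfl
  constructor
  · rintro ⟨u, v, huv, heq⟩
    have hu := u.2
    have hv := v.2
    have hiu : i = u := by
      rcases lt_trichotomy i (u : ℕ) with h | h | h
      · nlinarith
      · exact h
      · nlinarith
    subst hiu
    have hjv : j = v := by omega
    subst hjv
    exact ⟨hi, hj, huv⟩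
  · rintro ⟨_, _, h⟩
    exact ⟨⟨i, hi⟩, ⟨j, hj⟩, h, rfl⟩

/-- The enumeration program lists the minimal connected dominating sets. -/
theorem runs_enumerate {G : SimpleGraph (Fin n)} (hn : 0 < n) (hG : IsChordalGraph G)
    (hD : IsConnectedDomishold G) (c : Fin n → ℝ≥0) (hB : n * n * n + n * n + 3 * n ≤ B) :
    Runs B enumerate (input G c) (3100 * (n + 1) ^ 3) fun s => s.reg 0 = n ∧ s.reg 1 ≤ n * n ∧
      s.rarr = (input G c).rarr ∧ Lists n s {D | IsMinimalCDS G D} := by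
  have hB' : n * n + n + n * 2 ≤ B := by nlinarith [Nat.zero_le (n * n * n)]
  set E := elimCut G (pickVertex G hn) with hE
  have hpick := isSimplicialIn_pickVertex hG hn
  obtain ⟨hmono, w, hw⟩ := hD.exists_weight
  have hcorrect : Enumeration.Correct E (IsBlocker G) := by
    refine ⟨hmono, isBlocker_univ, fun x y => ?_, fun i hi => ?_, fun F hF => ?_⟩
    · exact (le_total (w y) (w x)).imp (hw x y) (hw y x)
    · exact isBlocker_elimCut hpick (by rwa [Fintype.card_fin])
    · obtain ⟨i, hi, h⟩ := exists_elimCut_eq_of_minimal_isBlocker hpick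
        (by rwa [Fintype.card_fin]) hF
      exact ⟨i, by rwa [Fintype.card_fin] at hi, h⟩
  have hbij := hcorrect.bijOn
  have himage : pairSet E '' {p | Enumeration.valid E p.1 p.2 = 1} = {D | IsMinimalCDS G D} := by
    refine hbij.image_eq.trans ?_
    ext D
    exact isMinimalCDS_iff.symm
  have hpow : (n + 1) ^ 2 ≤ (n + 1) ^ 3 := Nat.pow_le_pow_right (by omega) (by omega)
  refine ((runs_openPairTable (B := B) (s := input G c) (by simp [input]) hB'
    (tableIs_input G c)).seq (T' := 2810 * (n + 1) ^ 3) ?_).mono (by omega) fun _ h => h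
  rintro s₁ ⟨a₁, h7⟩
  have r₁ : s₁.reg 0 = n := (a₁.reg 0 (by omega)).trans (by simp [input])
  refine ((runs_elimInit (pick := pickVertex G hn) r₁ hn hB'
    (a₁.tableIs (tableIs_input G c) (by decide)) h7).seq (T' := 2530 * (n + 1) ^ 3) ?_).mono
    (by omega) fun _ h => h
  intro s₂ h₂
  refine ((runs_elimLoop hG hn h₂ hB').seq (T' := 1820 * (n + 1) ^ 3) ?_).mono
    (by omega) fun _ h => h
  intro s₃ h₃
  have hr1 : s₃.reg 1 = 0 := by
    rw [h₃.reg1, a₁.reg 1 (by omega)]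
    simp [input]
  refine (runs_enumerationTables (E := E) (T := 220 * (n + 1) ^ 3) h₃.reg0 hB' h₃.cut ?_).mono
    (by omega) fun _ h => h
  intro s₄ h₄ h₄'
  refine (runs_outputLoop hbij.injOn
    ⟨h₄.reg0, rfl, h₄.sets, h₄.discard, h₄.rank, h₄.skip⟩ (h₄'.trans hr1) hB).mono le_rfl ?_
  rintro s₅ ⟨h0, h1, h2, h3⟩
  refine ⟨h0, h1, ?_, himage ▸ h3⟩
  rw [h2, h₄.rarr, h₃.rarr, a₁.rarr]

/-! ### Minimum cost -/

/-- Computes the cost of set number `i` of the output in real register 0. -/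
def costProg : Program :=
  .seq (.setRReg 0 .zero) (forLoop 3 0 (.ite (.eq (cell 1 regI regJ) (.const 1))
    (.setRReg 0 (.add (.reg 0) (.arr 0 regJ))) .skip))

/-- Keeps the number of the cheapest set so far in word register 6 and its cost in real
register 1. -/
def updateBest : Program :=
  .ite (.disj (.eq regI (.const 0)) (.rlt (.reg 0) (.reg 1)))
    (.seq (.setRReg 1 (.reg 0)) (.setReg 6 regI)) .skip

/-- Moves the cheapest set of the output to its front. -/
def selectBest : Program :=
  .seq (forLoop 2 1 (.seq costProg updateBest))
    (forLoop 3 0 (.setArr 1 regJ (.eqE (cell 1 (.reg 6) regJ) (.const 1))))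

/-- `s` agrees with `s₀` in its arrays and in word registers 0 and 1. -/
structure SameData (s₀ s : Memory) : Prop where
  arr : s.arr = s₀.arr
  rarr : s.rarr = s₀.rarr
  reg0 : s.reg 0 = s₀.reg 0
  reg1 : s.reg 1 = s₀.reg 1

theorem SameData.writeReg {s₀ s : Memory} (h : SameData s₀ s) {r : ℕ} (hr : 2 ≤ r) (v : ℕ) :
    SameData s₀ (s.writeReg r v) := by
  refine ⟨h.arr, h.rarr, ?_, ?_⟩
  · simp only [Memory.writeReg]
    rw [Function.update_of_ne (by omega), h.reg0]
  · simp only [Memory.writeReg]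
    rw [Function.update_of_ne (by omega), h.reg1]

theorem runs_costProg {s₀ s : Memory} {c : Fin n → ℝ≥0} {q : ℕ} (hn : n ≤ B)
    (h0 : s₀.reg 0 = n) (hc : ∀ v : Fin n, s₀.rarr 0 v = c v) (hs : SameData s₀ s)
    (h2 : s.reg 2 = q) :
    Runs B costProg s (50 * (n + 1)) fun s' => SameData s₀ s' ∧ s'.reg 2 = q ∧
      s'.reg 6 = s.reg 6 ∧ s'.rreg 1 = s.rreg 1 ∧
      s'.rreg 0 = ∑ v ∈ outputSet n s₀ q, (c v : ℝ) := by
  have hsum : ∑ v ∈ outputSet n s₀ q, (c v : ℝ) =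
      ∑ u ∈ Finset.range n, if s₀.arr 1 (q * n + u) = 1 then s₀.rarr 0 u else 0 := by
    rw [outputSet, Finset.sum_filter, Finset.sum_range]
    exact Finset.sum_congr rfl fun v _ => by rw [hc v]
  rw [hsum]
  refine (Runs.seq (T := 2) (T' := (n + 1) * 40) (Q := fun s' => SameData s₀ s' ∧ s'.reg 2 = q ∧
      s'.reg 6 = s.reg 6 ∧ s'.rreg 1 = s.rreg 1 ∧ s'.rreg 0 = 0)
    (runs_setRReg ⟨⟨hs.arr, hs.rarr, hs.reg0, hs.reg1⟩, h2, rfl, ?_, ?_⟩) ?_).mono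
    (by omega) fun _ h => h
  rotate_left
  · simp [Memory.writeRReg]
  · simp [Memory.writeRReg, RExpr.eval]
  rintro s₁ ⟨hs₁, r2, r6, q1, q0⟩
  refine runs_forLoop (n := n) (T := 30) (fun k s' => SameData s₀ s' ∧ s'.reg 2 = q ∧
      s'.reg 6 = s.reg 6 ∧ s'.rreg 1 = s.rreg 1 ∧ s'.rreg 0 =
      ∑ u ∈ Finset.range k, if s₀.arr 1 (q * n + u) = 1 then s₀.rarr 0 u else 0)
      (by omega) (hs₁.reg0.trans h0) hn ⟨hs₁.writeReg (by omega) _, ?_, ?_, q1, ?_⟩ ?_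
  · simp [Memory.writeReg, r2]
  · simp [Memory.writeReg, r6]
  · simpa [Memory.writeReg] using q0
  · rintro k hk s₂ ⟨hs₂, r2, r6, q1, q0⟩ r3 r0
    have htest : (Test.eq (cell 1 regI regJ) (.const 1)).holds s₂ ↔
        s₀.arr 1 (q * n + k) = 1 := by
      simp only [Test.holds, Expr.eval, eval_cell, r0, r2, r3, hs₂.arr]
    refine (runs_ite (T := 10) (fun ht => ?_) fun ht => ?_).mono (by decide) fun _ h => h
    · rw [htest] at ht
      refine (runs_setRReg ?_).mono (by decide) fun _ h => h
      refine ⟨r3, r0, SameData.writeReg (s := s₂.writeRReg _ _)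
          ⟨hs₂.arr, hs₂.rarr, hs₂.reg0, hs₂.reg1⟩ (by omega) _,
        ?_, ?_, ?_, ?_⟩
      · simp [Memory.writeReg, Memory.writeRReg, r2]
      · simp [Memory.writeReg, Memory.writeRReg, r6]
      · simp [Memory.writeReg, Memory.writeRReg, q1]
      · rw [Finset.sum_range_succ, if_pos ht]
        simp [Memory.writeReg, Memory.writeRReg, RExpr.eval, Expr.eval, q0, r3, hs₂.rarr]
    · rw [htest] at ht
      refine (runs_skip ?_).mono (by decide) fun _ h => h
      refine ⟨r3, r0, hs₂.writeReg (by omega) _, ?_, ?_, q1, ?_⟩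
      · simp [Memory.writeReg, r2]
      · simp [Memory.writeReg, r6]
      · rw [Finset.sum_range_succ, if_neg ht, add_zero]
        exact q0

theorem runs_selectBest {s₀ : Memory} {c : Fin n → ℝ≥0} {F : Set (Finset (Fin n))}
    (hB : n * n + n ≤ B) (h0 : s₀.reg 0 = n) (h1 : s₀.reg 1 ≤ n * n)
    (hc : ∀ v : Fin n, s₀.rarr 0 v = c v) (hF : Lists n s₀ F) (hne : F.Nonempty) :
    Runs B selectBest s₀ (200 * (n + 1) ^ 3) fun s => outputSet n s 0 ∈ F ∧
      ∀ S ∈ F, ∑ v ∈ outputSet n s 0, c v ≤ ∑ v ∈ S, c v := by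
  let cost : ℕ → ℝ := fun q => ∑ v ∈ outputSet n s₀ q, (c v : ℝ)
  have hpos : 0 < s₀.reg 1 := by
    obtain ⟨S, hS⟩ := hne
    obtain ⟨q, hq, -⟩ := hF.surjOn hS
    exact lt_of_le_of_lt (Nat.zero_le q) hq
  refine (Runs.seq (T := 140 * (n + 1) ^ 3) (T' := (n + 1) * 40)
    (Q := fun s => SameData s₀ s ∧ (s₀.reg 1 = 0 ∨ s.reg 6 < s₀.reg 1 ∧
      s.rreg 1 = cost (s.reg 6) ∧ ∀ q < s₀.reg 1, s.rreg 1 ≤ cost q))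
    ((runs_forLoop (n := s₀.reg 1) (T := 50 * (n + 1) + 30) (fun i s => SameData s₀ s ∧
      (i = 0 ∨ s.reg 6 < i ∧ s.rreg 1 = cost (s.reg 6) ∧ ∀ q < i, s.rreg 1 ≤ cost q))
      (by omega) rfl (by omega) ⟨SameData.writeReg ⟨rfl, rfl, rfl, rfl⟩ le_rfl _, Or.inl rfl⟩
      ?_).mono ?_ fun _ h => h) ?_).mono ?_ fun _ h => h
  · rintro i hi s ⟨hs, hbest⟩ r2 _
    refine ((runs_costProg (by omega) h0 hc hs r2).seq (T' := 30) ?_).mono le_rfl fun _ h => h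
    rintro s₁ ⟨hs₁, r2, r6, q1, q0⟩
    change s₁.rreg 0 = cost i at q0
    have htest : (Test.disj (.eq regI (.const 0)) (.rlt (.reg 0) (.reg 1))).holds s₁ ↔
        i = 0 ∨ cost i < s₁.rreg 1 := by
      simp only [Test.holds, Expr.eval, RExpr.eval, r2, q0]
    refine (runs_ite (T := 10) (fun ht => ?_) fun ht => ?_).mono (by decide) fun _ h => h
    · rw [htest] at ht
      refine (Runs.seq (T := 2) (T' := 2) (Q := fun s' => SameData s₀ s' ∧ s'.reg 2 = i ∧
        s'.rreg 1 = cost i) (runs_setRReg ⟨⟨hs₁.arr, hs₁.rarr, hs₁.reg0, hs₁.reg1⟩, r2, ?_⟩)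
        ?_).mono (by decide) fun _ h => h
      rotate_left
      · simp [Memory.writeRReg, RExpr.eval, q0]
      rintro s₂ ⟨hs₂, r2, q1'⟩
      refine runs_setReg (by simp only [Expr.eval, r2]; omega) ?_
      simp only [Expr.eval, r2]
      refine ⟨by simp [Memory.writeReg, r2], ?_,
        (hs₂.writeReg (by omega) _).writeReg (by omega) _, Or.inr ⟨?_, ?_, fun q hq => ?_⟩⟩
      · simp [Memory.writeReg, hs₂.reg1]
      · simp [Memory.writeReg]
      · simp [Memory.writeReg, q1']
      · change s₂.rreg 1 ≤ cost q
        rw [q1']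
        rcases Nat.lt_succ_iff_lt_or_eq.1 hq with h' | rfl
        · rcases ht with h'' | h''
          · omega
          · rcases hbest with h3 | ⟨-, -, h3⟩
            · omega
            · exact (h''.le.trans q1.le).trans (h3 q h')
        · exact le_rfl
    · rw [htest, not_or] at ht
      refine (runs_skip ?_).mono (by decide) fun _ h => h
      obtain ⟨hb1, hb2, hb3⟩ := hbest.resolve_left ht.1
      refine ⟨r2, hs₁.reg1, hs₁.writeReg (by omega) _, Or.inr ⟨?_, ?_, fun q hq => ?_⟩⟩
      · simp [Memory.writeReg, r6]
        omega
      · simp [Memory.writeReg, r6, q1, hb2]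
      · change s₁.rreg 1 ≤ cost q
        rcases Nat.lt_succ_iff_lt_or_eq.1 hq with h' | rfl
        · rw [q1]
          exact hb3 q h'
        · exact not_lt.1 ht.2
  · calc (s₀.reg 1 + 1) * (50 * (n + 1) + 30 + 10) ≤ (n + 1) ^ 2 * (140 * (n + 1)) :=
        Nat.mul_le_mul (by nlinarith) (by omega)
      _ = 140 * (n + 1) ^ 3 := by ring
  · rintro s ⟨hs, hbest⟩
    obtain ⟨hb1, hb2, hb3⟩ := hbest.resolve_left hpos.ne'
    set b := s.reg 6 with hb
    refine (runs_forLoop (n := n) (T := 30) (fun k s' => s'.reg 6 = b ∧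
      (∀ u < k, s'.arr 1 u = if s₀.arr 1 (b * n + u) = 1 then 1 else 0) ∧
      ∀ u ≥ k, s'.arr 1 u = s₀.arr 1 u) (by omega) (hs.reg0.trans h0) (by omega)
      ⟨by simp [Memory.writeReg, hb], fun u hu => absurd hu (by omega),
        fun u _ => by simp [Memory.writeReg, hs.arr]⟩ ?_).mono le_rfl ?_
    · rintro k hk s' ⟨r6, hdone, hrest⟩ r3 r0
      -- the cell to be copied has not been overwritten: it is cell `k` itself, or lies in a
      -- later row
      have hval : (Expr.eqE (cell 1 (.reg 6) regJ) (.const 1)).eval s' =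
          if s₀.arr 1 (b * n + k) = 1 then 1 else 0 := by
        simp only [Expr.eval_eqE, Expr.eval, eval_cell, r0, r3, r6]
        -- this cell has not been overwritten yet, even if the best set already is in row 0
        rw [hrest _ (by omega)]
      have haddr : regJ.eval s' = k := r3
      refine (runs_setArr (by rw [haddr]; omega) (by rw [hval]; split_ifs <;> omega) ?_).mono
        (by decide) fun _ h => h
      rw [haddr, hval]
      refine ⟨r3, r0, by simp [Memory.writeReg, Memory.writeArr, r6], fun u hu => ?_,
        fun u hu => ?_⟩
      · simp only [Memory.writeReg, Memory.writeArr, Function.update_self]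
        rcases Nat.lt_succ_iff_lt_or_eq.1 hu with h' | rfl
        · rw [Function.update_of_ne (by omega), hdone u h']
        · rw [Function.update_self]
      · simp only [Memory.writeReg, Memory.writeArr, Function.update_self]
        rw [Function.update_of_ne (by omega), hrest u (by omega)]
    · rintro s' ⟨-, hdone, -⟩
      have hout : outputSet n s' 0 = outputSet n s₀ b := by
        ext u
        simp [outputSet, hdone u u.2]
      rw [hout]
      refine ⟨hF.mapsTo hb1, fun S hS => ?_⟩
      obtain ⟨q, hq, rfl⟩ := hF.surjOn hS
      have := hb3 q hq
      rw [hb2] at this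
      simp only [cost] at this
      exact_mod_cast this
  · have : (n + 1) * 40 ≤ 40 * (n + 1) ^ 3 := by
      have : (n + 1) ^ 1 ≤ (n + 1) ^ 3 := Nat.pow_le_pow_right (by omega) (by omega)
      rw [pow_one] at this
      omega
    omega

end RAM

/-! ### The counting and algorithmic results -/

theorem isConnectedDominatingSet_univ {V : Type*} [Fintype V] {G : SimpleGraph V}
    (hG : G.Connected) : IsConnectedDominatingSet G Finset.univ := by
  refine ⟨fun v hv => absurd (Finset.mem_univ v) hv, ?_⟩
  rw [Finset.coe_univ]
  exact (SimpleGraph.induceUnivIso G).connected_iff.2 hG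

theorem mainTheorem7 :
    (∃ C : ℕ, ∀ (V : Type*) [Fintype V] (G : SimpleGraph V),
      IsChordalGraph G → IsConnectedDomishold G →
        {D : Finset V | IsMinimalCDS G D}.ncard ≤ C * Fintype.card V ^ 2) ∧
    (∃ (P : RAM.Program) (C k : ℕ), ∀ (n : ℕ) (G : SimpleGraph (Fin n)), 1 ≤ n →
      IsChordalGraph G → IsConnectedDomishold G →
        ∃ (s : RAM.Memory) (t : ℕ), RAM.Exec (C * n ^ k) P (RAM.input G 0) s t ∧
          t ≤ C * n ^ 3 ∧ RAM.Lists n s {D | IsMinimalCDS G D}) ∧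
    (∃ (P : RAM.Program) (C k : ℕ), ∀ (n : ℕ) (G : SimpleGraph (Fin n)) (c : Fin n → ℝ≥0),
      G.Connected → IsChordalGraph G → IsConnectedDomishold G →
        ∃ (s : RAM.Memory) (t : ℕ), RAM.Exec (C * n ^ k) P (RAM.input G c) s t ∧
          t ≤ C * n ^ 3 ∧ IsMinimumCostCDS G c (RAM.outputSet n s 0)) := by
  have hcube : ∀ n : ℕ, 1 ≤ n → (n + 1) ^ 3 ≤ 8 * n ^ 3 := by
    intro n hn
    calc (n + 1) ^ 3 ≤ (2 * n) ^ 3 := Nat.pow_le_pow_left (by omega) 3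
      _ = 8 * n ^ 3 := by ring
  have hword : ∀ n : ℕ, 1 ≤ n → n * n * n + n * n + 3 * n ≤ 30000 * n ^ 3 := by
    intro n hn
    have h1 : n ^ 2 ≤ n ^ 3 := Nat.pow_le_pow_right hn (by omega)
    have h2 : n ^ 1 ≤ n ^ 3 := Nat.pow_le_pow_right hn (by omega)
    have h3 : n * n * n = n ^ 3 := by ring
    have h4 : n * n = n ^ 2 := by ring
    rw [pow_one] at h2
    omega
  -- the running times are at most `3300 * (n + 1) ^ 3`, and `8 * 3300 ≤ 30000`
  refine ⟨⟨1, fun V _ G hG hD => ?_⟩, ⟨RAM.enumerate, 30000, 3, fun n G hn hG hD => ?_⟩,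
    ⟨.seq RAM.enumerate RAM.selectBest, 30000, 3, fun n G c hconn hG hD => ?_⟩⟩
  · classical
    rw [one_mul]
    exact hD.ncard_isMinimalCDS_le hG
  · obtain ⟨s, t, he, ht, -, -, -, hl⟩ := RAM.runs_enumerate (by omega) hG hD 0 (hword n hn)
    refine ⟨s, t, he, ?_, hl⟩
    have := hcube n hn
    omega
  · obtain ⟨v⟩ := hconn.nonempty
    have hn : 1 ≤ n := by have := v.2; omega
    have hne : {D | IsMinimalCDS G D}.Nonempty := by
      obtain ⟨D, -, hD⟩ := exists_minimal_subset (isConnectedDominatingSet_univ hconn)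
      exact ⟨D, hD⟩
    have hw := hword n hn
    obtain ⟨s, t, he, ht, hmem, hmin⟩ := (RAM.runs_enumerate (by omega) hG hD c hw).seq
      (T' := 200 * (n + 1) ^ 3) (R := fun s => RAM.outputSet n s 0 ∈ {D | IsMinimalCDS G D} ∧
        ∀ S ∈ {D | IsMinimalCDS G D}, ∑ v ∈ RAM.outputSet n s 0, c v ≤ ∑ v ∈ S, c v)
      fun s hs => RAM.runs_selectBest (by nlinarith) hs.1 hs.2.1
        (fun v => by rw [hs.2.2.1]; simp [RAM.input]) hs.2.2.2 hne
    refine ⟨s, t, he, ?_, hmem.prop, fun T hT => ?_⟩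
    · have := hcube n hn
      omega
    · obtain ⟨D, hDT, hD⟩ := exists_minimal_subset hT
      exact (hmin D hD).trans (Finset.sum_le_sum_of_subset hDT)
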